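/- **Conventions.** Fix $k\in\mathbb N$ and the ordered alphabet $X_k'=\{1'<1<2'<2<\cdots<k'<k\}$; each step in this order is a *half unit*. A *primed tableau* is a filling $T$ of a partition shape (rows numbered downwards) by letters of $X_k'$ with weakly increasing rows and columns, at most one $i'$ in each row and at most one $i$ in each column, for each $i$. The double weight $dw=(X,Y)\in\mathbb Z_{\ge0}^k\times\mathbb Z_{\ge0}^k$ of a word or tableau records in $X_i$ the number of letters $i'$ and in $Y_i$ the number of letters $i$. Let $1\le i\le k-1$ and $j=i+1$. All operators take values in the given set together with $0$, and every map is extended by $0\mapsto0$. *Words.* In a word in $X_k'$, bracket each $i$ with the nearest not yet bracketed $j$ to its left, if there is one. $f_i$ changes the rightmost unbracketed $i$ to $j$, and $e_i$ the leftmost unbracketed $j$ to $i$ (giving $0$ if there is none). $f_{\bar i},e_{\bar i}$ are defined in the same way with the letters $i',j'$ in place of $i,j$. *Tableaux.* The reading word of $T$ consists of its unprimed entries, read by rows from bottom to top, each row from left to right. Write $c(p)$ for the content of position $p$ and $N_p,E_p,S_p,W_p$ for the neighbours of $p$; contents of positions outside $T$ count as $\infty$ for $E_p,S_p$ and as smaller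 than every letter for $N_p,W_p$. * $f_i(T)=0$ if the reading word has no unbracketed $i$. Otherwise let $x$ be the box of the rightmost unbracketed $i$; $f_i(T)$ is obtained by increasing $c(x)$ and $c(q)$ by a half unit each (by a full unit in total if $q=x$), where: $q=x$ if $c(E_x)\ge j$ and $c(S_x)>j$; $q=E_x$ if $c(E_x)=j'$; if $c(E_x)\ge j$ and $c(S_x)\in\{j',j\}$, then $q$ is the southwesternmost box of the maximal ribbon with entries in $\{j',j\}$ that starts at $S_x$ and extends south and/or west. * $e_i(T)=0$ if the reading word has no unbracketed $j$. Otherwise let $y$ be the box of the leftmost unbracketed $j$; $e_i(T)$ is obtained by decreasing $c(y)$ and $c(p)$ by a half unit each, where: $p=y$ if $c(W_y)\le i$ and $c(N_y)<i$; $p=W_y$ if $c(W_y)=j'$; if $c(W_y)\le i$ and $c(N_y)\in\{i,j'\}$, then $p$ is the northeasternmost box of the maximal ribbon with entries in $\{i,j'\}$ that starts at $N_y$ and extends north and/or east. * $T^{\pm}$ is the transpose of $T$ with every entry increased, respectively decreased, by a half unit (for $T^+$ the alphabet is enlarged by $(k+1)'$), and $f_{\bar i}(T)=(f_i(T^+))^-$,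 $e_{\bar i}(T)=(e_i(T^+))^-$. *Nonshifted mixed Haiman insertion.* The letters of a word $w$ in $X_k'$ are inserted one after another, starting from the empty tableau: an unprimed letter into the top row, a primed letter into the leftmost column. A letter that is inserted into a row (column) replaces the leftmost (uppermost) entry strictly greater than it; the bumped entry, if unprimed, is inserted into the row below the one it was in, and, if primed, into the column to the right of the one it was in. If there is no strictly greater entry, the letter is appended at the end of the row (column) and the insertion of that letter of $w$ ends. $\mathcal P(w)$ is the resulting tableau, and $\mathcal Q(w)$ is the standard filling recording in which step each box was added. *Bicrystals.* A bicrystal of type $A_{k-1}$ is a nonempty set $B$ with maps $e_i,f_i,e_{\bar i},f_{\bar i}:B\to B\cup\{0\}$ $(1\le i\le k-1)$ and $dw:B\to\mathbb Z_{\ge0}^k\times\mathbb Z_{\ge0}^k$ such that, for $b,b'\in B$ and with $\alpha_i=\epsilon_i-\epsilon_{i+1}$: $f_ib=b'$ if and only if $e_ib'=b$, and then $dw(b')=dw(b)-(0,\alpha_i)$; and $f_{\bar i}b=b'$ if and only if $e_{\bar i}b'=b$, and then $dw(b')=dw(b)-(\alpha_i,0)$. **Theorem.** Let $k\in\mathbb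 N$. 1. For every word $w$ in $X_k'$ and $1\le i\le k-1$, $$\mathcal P(f_i(w))=f_i(\mathcal P(w))\qquad\text{and}\qquad \mathcal P(f_{\bar i}(w))=f_{\bar i}(\mathcal P(w)).$$ 2. The map $w\mapsto(\mathcal P(w),\mathcal Q(w))$ is an isomorphism of bicrystals from the words in $X_k'$ to the pairs $(T,S)$ consisting of a primed tableau $T$ with entries in $X_k'$ and a standard Young tableau $S$ of the same shape, where the double weight of $(T,S)$ is that of $T$ and the operators act on $T$ and leave $S$ unchanged: it is a bijection that preserves the double weight and commutes with all $e_i,f_i,e_{\bar i},f_{\bar i}$. 3. The operators $e_i,f_i,e_{\bar i},f_{\bar i}$ and $dw$ make the set of all primed tableaux with entries in $X_k'$ a bicrystal of type $A_{k-1}$, and likewise, for each shape $\lambda$, the set of those of shape $\lambda$ if it is nonempty. -/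

import Mathlib

namespace PrimedCrystal

/-! ### Letters, words and fillings

A letter of the ordered alphabet `1' < 1 < 2' < 2 < ⋯` is represented by its rank, that is, it is
measured in half units: `i'` is `2 * i - 1` and `i` is `2 * i` (for `i ≥ 1`).
So adding a half unit is adding `1`, and a letter is unprimed exactly when its rank is even. -/

/-- The primed letter `i'` (for `i ≥ 1`). -/
def prm (i : ℕ) : ℕ := 2 * i - 1

/-- The unprimed letter `i` (for `i ≥ 1`). -/
def unp (i : ℕ) : ℕ := 2 * i

/-- The words in the alphabet `X'_k = {1' < 1 < ⋯ < k' < k}`. -/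
def Words (k : ℕ) : Set (List ℕ) := {w | ∀ a ∈ w, 1 ≤ a ∧ a ≤ 2 * k}

/-- A filling is the list of its rows, from top to bottom; rows and columns are numbered from `0`,
and a position is a pair (row, column). -/
abbrev Filling := List (List ℕ)

/-- The content `c(p)` of a position `p`; it is `∞` at a position that is not a filled box. -/
def content (T : Filling) (r c : ℕ) : WithTop ℕ :=
  match (T.getD r [])[c]? with
  | some a => (a : WithTop ℕ)
  | none => ⊤

/-- The `c`-th column, from top to bottom. -/
def column (T : Filling) (c : ℕ) : List ℕ := T.filterMap (fun row => row[c]?)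

/-- The list of row lengths. -/
def shape (T : Filling) : List ℕ := T.map List.length

/-- Partitions, as weakly decreasing lists of positive integers. -/
def IsPartition (l : List ℕ) : Prop := l.Pairwise (· ≥ ·) ∧ ∀ a ∈ l, 0 < a

/-- `T` is a primed tableau with entries in `X'_k`, of (straight) partition shape. -/
structure IsPrimedTableau (k : ℕ) (T : Filling) : Prop where
  partition : IsPartition (shape T)
  entries : ∀ row ∈ T, ∀ a ∈ row, 1 ≤ a ∧ a ≤ 2 * k
  row_weak : ∀ r c, content T r c ≤ content T r (c + 1)
  col_weak : ∀ r c, content T r c ≤ content T (r + 1) c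
  row_primed : ∀ row ∈ T, ∀ i, 1 ≤ i → row.count (prm i) ≤ 1
  col_unprimed : ∀ c i, 1 ≤ i → (column T c).count (unp i) ≤ 1

/-- The set of all primed tableaux with entries in `X'_k`. -/
def PT (k : ℕ) : Set Filling := {T | IsPrimedTableau k T}

/-- `S` is a standard Young tableau: the entries are `1, …, n`, each used once, and they increase
strictly along rows and columns. -/
structure IsStandard (S : Filling) : Prop where
  partition : IsPartition (shape S)
  entries : S.flatten.Perm (List.range' 1 S.flatten.length)
  row_strict : ∀ row ∈ S, row.Pairwise (· < ·)
  col_strict : ∀ c, (column S c).Pairwise (· < ·)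

/-- The double weight of a word: the coordinate `a : Fin k` of the first (second) vector is the
number of primed (unprimed) letters `a + 1`. -/
def wordDW (k : ℕ) (w : List ℕ) : (Fin k → ℕ) × (Fin k → ℕ) :=
  (fun a => w.count (prm (a + 1)), fun a => w.count (unp (a + 1)))

/-- The double weight of a filling. -/
def tabDW (k : ℕ) (T : Filling) : (Fin k → ℕ) × (Fin k → ℕ) := wordDW k T.flatten

/-! ### Bracketing and the usual crystal operators on words -/

/-- One step of the bracketing. The state consists of the positions of the `a`s that
were found to be unbracketed and of the positions of the `b`s not bracketed so far, the most recent
ones first. An `a` is bracketed with the nearest available `b` to its left. -/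
def bracketStep {α : Type} (a b : ℕ) (s : List α × List α) (x : ℕ × α) : List α × List α :=
  if x.1 = b then (s.1, x.2 :: s.2)
  else if x.1 = a then
    match s.2 with
    | [] => (x.2 :: s.1, [])
    | _ :: t => (s.1, t)
  else s

/-- The positions of the unbracketed `a`s and of the unbracketed `b`s in a word whose letters
carry positions; both lists run from right to left. Letters other than `a`, `b` are ignored. -/
def unbracketed {α : Type} (a b : ℕ) (w : List (ℕ × α)) : List α × List α :=
  w.foldl (bracketStep a b) ([], [])

/-- Change the rightmost unbracketed `a` into `b`; the value `none` stands for `0`. -/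
def lower (a b : ℕ) (w : List ℕ) : Option (List ℕ) :=
  (unbracketed a b w.zipIdx).1.head?.map (fun p => w.set p b)

/-- Change the leftmost unbracketed `b` into `a`; the value `none` stands for `0`. -/
def raise (a b : ℕ) (w : List ℕ) : Option (List ℕ) :=
  (unbracketed a b w.zipIdx).2.getLast?.map (fun p => w.set p a)

/-- `f_i` on words: the usual crystal operator on the unprimed letters. -/
def wordF (i : ℕ) (w : List ℕ) : Option (List ℕ) := lower (unp i) (unp (i + 1)) w

/-- `e_i` on words. -/
def wordE (i : ℕ) (w : List ℕ) : Option (List ℕ) := raise (unp i) (unp (i + 1)) w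

/-- `f_{ī}` on words: the usual crystal operator on the primed letters. -/
def wordFbar (i : ℕ) (w : List ℕ) : Option (List ℕ) := lower (prm i) (prm (i + 1)) w

/-- `e_{ī}` on words. -/
def wordEbar (i : ℕ) (w : List ℕ) : Option (List ℕ) := raise (prm i) (prm (i + 1)) w

/-! ### The operators on primed tableaux -/

/-- The reading word, with positions: rows from bottom to top, each from left to right, keeping
only the unprimed entries. -/
def reading (T : Filling) : List (ℕ × (ℕ × ℕ)) :=
  (T.zipIdx.reverse.flatMap (fun x => x.1.zipIdx.map (fun y => (y.1, (x.2, y.2))))).filter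
    (fun z => z.1 % 2 = 0)

/-- Apply `g` to the entry at position `p`. -/
def modifyAt (g : ℕ → ℕ) (T : Filling) (p : ℕ × ℕ) : Filling :=
  T.modify p.1 (fun row => row.modify p.2 g)

/-- Does the content of a position belong to `{a, b}`? -/
def isOneOf (a b : ℕ) (x : WithTop ℕ) : Bool := x = (a : WithTop ℕ) || x = (b : WithTop ℕ)

/-- Walk from a box to the South or West as long as the entries are `a` or `b`.
The first argument bounds the number of steps. -/
def ribbonSW (T : Filling) (a b : ℕ) : ℕ → ℕ × ℕ → ℕ × ℕ
  | 0, p => p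
  | n + 1, (r, c) =>
    if isOneOf a b (content T (r + 1) c) then ribbonSW T a b n (r + 1, c)
    else if 0 < c ∧ isOneOf a b (content T r (c - 1)) then ribbonSW T a b n (r, c - 1)
    else (r, c)

/-- Walk from a box to the North or East as long as the entries are `a` or `b`.
The first argument bounds the number of steps. -/
def ribbonNE (T : Filling) (a b : ℕ) : ℕ → ℕ × ℕ → ℕ × ℕ
  | 0, p => p
  | n + 1, (r, c) =>
    if 0 < r ∧ isOneOf a b (content T (r - 1) c) then ribbonNE T a b n (r - 1, c)
    else if isOneOf a b (content T r (c + 1)) then ribbonNE T a b n (r, c + 1)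
    else (r, c)

/-- The box `q` in the definition of `f_i(T)`, given `x = (r, c)`; with `j = i + 1`, the three
cases are F1, F2 and F3. They are exhaustive on primed tableaux.
The number of boxes bounds the length of the ribbon. -/
def boxQ (i : ℕ) (T : Filling) (r c : ℕ) : Option (ℕ × ℕ) :=
  let j := i + 1
  let cE := content T r (c + 1)
  let cS := content T (r + 1) c
  if (unp j : WithTop ℕ) ≤ cE ∧ (unp j : WithTop ℕ) < cS then some (r, c)
  else if cE = (prm j : WithTop ℕ) then some (r, c + 1)
  else if (unp j : WithTop ℕ) ≤ cE ∧ isOneOf (prm j) (unp j) cS then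
    some (ribbonSW T (prm j) (unp j) T.flatten.length (r + 1, c))
  else none

/-- `f_i` on primed tableaux: with `x` the rightmost unbracketed `i` of the reading word, increase
`c(x)` and `c(q)` by a half unit. -/
def tabF (i : ℕ) (T : Filling) : Option Filling :=
  (unbracketed (unp i) (unp (i + 1)) (reading T)).1.head?.bind fun x =>
    (boxQ i T x.1 x.2).map fun q => modifyAt (· + 1) (modifyAt (· + 1) T x) q

/-- The content of the position to the left of `(r, c)`, a position outside of the tableau counting
as smaller than all letters. -/
def contentW (T : Filling) (r c : ℕ) : WithTop ℕ := if c = 0 then 0 else content T r (c - 1)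

/-- The content of the position above `(r, c)`, a position outside of the tableau counting as
smaller than all letters. -/
def contentN (T : Filling) (r c : ℕ) : WithTop ℕ := if r = 0 then 0 else content T (r - 1) c

/-- The box `p` in the definition of `e_i(T)`, given `y = (r, c)`. The three cases are exhaustive on
primed tableaux. -/
def boxP (i : ℕ) (T : Filling) (r c : ℕ) : Option (ℕ × ℕ) :=
  let j := i + 1
  let cW := contentW T r c
  let cN := contentN T r c
  if cW ≤ (unp i : WithTop ℕ) ∧ cN < (unp i : WithTop ℕ) then some (r, c)
  else if cW = (prm j : WithTop ℕ) then some (r, c - 1)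
  else if cW ≤ (unp i : WithTop ℕ) ∧ isOneOf (unp i) (prm j) cN then
    some (ribbonNE T (unp i) (prm j) T.flatten.length (r - 1, c))
  else none

/-- `e_i` on primed tableaux: with `y` the leftmost unbracketed `i + 1` of the reading word,
decrease `c(y)` and `c(p)` by a half unit. -/
def tabE (i : ℕ) (T : Filling) : Option Filling :=
  (unbracketed (unp i) (unp (i + 1)) (reading T)).2.getLast?.bind fun y =>
    (boxP i T y.1 y.2).map fun p => modifyAt (· - 1) (modifyAt (· - 1) T y) p

/-- The transpose of a filling of partition shape. -/
def transpose (T : Filling) : Filling := (List.range (T.headD []).length).map (column T)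

/-- `T⁺`: transpose and add a half unit to each entry. -/
def plus (T : Filling) : Filling := (transpose T).map (List.map (· + 1))

/-- `T⁻`: transpose and subtract a half unit from each entry. -/
def minus (T : Filling) : Filling := (transpose T).map (List.map (· - 1))

/-- `f_{ī}(T) = (f_i(T⁺))⁻`. -/
def tabFbar (i : ℕ) (T : Filling) : Option Filling := (tabF i (plus T)).map minus

/-- `e_{ī}(T) = (e_i(T⁺))⁻`. -/
def tabEbar (i : ℕ) (T : Filling) : Option Filling := (tabE i (plus T)).map minus

/-! ### Nonshifted mixed Haiman insertion -/

/-- Put `a` into the box `p = (r, c)`: replace the entry if the box is filled; otherwise append `a`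
to the end of row `r`, or start a new row. -/
def place (T : Filling) (p : ℕ × ℕ) (a : ℕ) : Filling :=
  if p.1 < T.length then
    T.modify p.1 (fun row => if p.2 < row.length then row.set p.2 a else row ++ [a])
  else T ++ [[a]]

/-- The box into which `a` goes when it is inserted into the row `l` (if `a` is unprimed) or into
the column `l` (if `a` is primed): the first box of that row or column whose content exceeds `a`.
It is the first unfilled position if no entry exceeds `a`. -/
def target (T : Filling) (a l : ℕ) : ℕ × ℕ :=
  if a % 2 = 0 then (l, (T.getD l []).findIdx (fun b => a < b))
  else (T.findIdx (fun row => match row[l]? with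
    | some b => decide (a < b)
    | none => true), l)

/-- Insert `a` into the row or column `l` and continue with the entry that is bumped: an unprimed
entry goes into the next row, a primed entry into the next column. Also return the box
that is added at the end. The first argument bounds the number of steps. -/
def insertAux : ℕ → Filling → ℕ → ℕ → Filling × (ℕ × ℕ)
  | 0, T, _, _ => (T, (0, 0))
  | n + 1, T, a, l =>
    let p := target T a l
    let T' := place T p a
    match (T.getD p.1 [])[p.2]? with
    | none => (T', p)
    | some y => insertAux n T' y (if y % 2 = 0 then p.1 + 1 else p.2 + 1)

/-- Insertion of a letter, starting with the top row or the leftmost column. Every bumped entry is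
strictly larger than the one that bumps it, so there are at most as many bumps as boxes. -/
def insertLetter (T : Filling) (a : ℕ) : Filling × (ℕ × ℕ) :=
  insertAux (T.flatten.length + 1) T a 0

/-- The pair of the insertion tableau and the recording tableau of a word. -/
def haiman (w : List ℕ) : Filling × Filling :=
  (w.zipIdx 1).foldl
    (fun X x => ((insertLetter X.1 x.1).1, place X.2 (insertLetter X.1 x.1).2 x.2)) ([], [])

/-- The insertion tableau `𝒫(w)`. -/
def insertionTableau (w : List ℕ) : Filling := (haiman w).1

/-! ### Bicrystals -/

/-- The simple root `α_i = ε_i - ε_{i+1}` of type `A_{k-1}`, for `1 ≤ i < k`; the coordinate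
`a : Fin k` has the number `a + 1`. -/
def simpleRoot (k i : ℕ) : Fin k → ℤ :=
  fun a => if (a : ℕ) + 1 = i then 1 else if (a : ℕ) = i then -1 else 0

/-- A vector of natural numbers as an integer vector. -/
def toInt {k : ℕ} (v : Fin k → ℕ) : Fin k → ℤ := fun a => (v a : ℤ)

/-- The nonempty set `B` with the given maps `B → B ∪ {0}` (where `0` is `none`) and double weight
is an abstract bicrystal of type `A_{k-1}`. -/
structure IsBicrystal (k : ℕ) {β : Type} (B : Set β) (e f ebar fbar : ℕ → β → Option β)
    (dw : β → (Fin k → ℕ) × (Fin k → ℕ)) : Prop where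
  nonempty : B.Nonempty
  mem : ∀ i, 1 ≤ i → i < k → ∀ b ∈ B, ∀ b',
    (e i b = some b' ∨ f i b = some b' ∨ ebar i b = some b' ∨ fbar i b = some b') → b' ∈ B
  inverse : ∀ i, 1 ≤ i → i < k → ∀ b ∈ B, ∀ b' ∈ B, f i b = some b' ↔ e i b' = some b
  weight : ∀ i, 1 ≤ i → i < k → ∀ b ∈ B, ∀ b' ∈ B, f i b = some b' →
    (dw b').1 = (dw b).1 ∧ toInt (dw b').2 = toInt (dw b).2 - simpleRoot k i
  inverse_bar : ∀ i, 1 ≤ i → i < k → ∀ b ∈ B, ∀ b' ∈ B, fbar i b = some b' ↔ ebar i b' = some b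
  weight_bar : ∀ i, 1 ≤ i → i < k → ∀ b ∈ B, ∀ b' ∈ B, fbar i b = some b' →
    toInt (dw b').1 = toInt (dw b).1 - simpleRoot k i ∧ (dw b').2 = (dw b).2

/-- `Φ` is a bijection from `B` to `B'` that preserves the double weight and commutes with the four
families of operators (with `Φ(0) = 0`). -/
structure IsBicrystalIso (k : ℕ) {β γ : Type} (B : Set β) (e f ebar fbar : ℕ → β → Option β)
    (dw : β → (Fin k → ℕ) × (Fin k → ℕ)) (B' : Set γ) (e' f' ebar' fbar' : ℕ → γ → Option γ)
    (dw' : γ → (Fin k → ℕ) × (Fin k → ℕ)) (Φ : β → γ) : Prop where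
  bij : Set.BijOn Φ B B'
  dw_eq : ∀ b ∈ B, dw' (Φ b) = dw b
  map_e : ∀ i, 1 ≤ i → i < k → ∀ b ∈ B, (e i b).map Φ = e' i (Φ b)
  map_f : ∀ i, 1 ≤ i → i < k → ∀ b ∈ B, (f i b).map Φ = f' i (Φ b)
  map_ebar : ∀ i, 1 ≤ i → i < k → ∀ b ∈ B, (ebar i b).map Φ = ebar' i (Φ b)
  map_fbar : ∀ i, 1 ≤ i → i < k → ∀ b ∈ B, (fbar i b).map Φ = fbar' i (Φ b)

/-- The pairs `(T, S)` of a primed tableau and a standard Young tableau of the same shape. -/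
def Pairs (k : ℕ) : Set (Filling × Filling) :=
  {X | IsPrimedTableau k X.1 ∧ IsStandard X.2 ∧ shape X.1 = shape X.2}

/-- Let an operator on tableaux act on the first component of a pair. -/
def onFirst (g : ℕ → Filling → Option Filling) (i : ℕ) (X : Filling × Filling) :
    Option (Filling × Filling) :=
  (g i X.1).map fun T => (T, X.2)

end PrimedCrystal

/-!
A tableau is regarded as the chain of the Young diagrams `Λ a` occupied by its entries of rank at
most `a`. Successive diagrams differ by a horizontal strip for an unprimed letter and by a vertical
strip for a primed one, and nothing prevents the letters of the two types from being ordered in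
another way (`IsChain τ`). Insertion becomes a local rule on such chains: the new box in `Λ a`
determines the new box in `Λ (a + 1)` (`bumpBox`, `insertChain`, `growth`). That the rule describes
Haiman's insertion is `represents_insertionTableau`.

*Switching.* Let `l ⊆ m ⊆ n` be a horizontal strip followed by a vertical strip. The boxes of `n / l`
form ribbons, and in each ribbon only one box is free to belong to either strip. If the order of the
two letters is exchanged, one box of each ribbon is free again, now at its other end. Giving both
free boxes the same type defines a bijection between the fillings (`RowSwitch`, `Switched`). The local
rules for the two letters respect it (`Switched.bump`), hence exchanging the order of two adjacent
letters of different types changes an insertion tableau only by switching these letters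
(`switched_growth`).

*The operators `f_i` and `e_i`.* If the two letters of a crystal operator are adjacent and both of them
fill horizontal strips, then the operator is the usual one of semistandard tableaux. It commutes with
insertion (`loweredChain_growth`); this is an induction over the letters of the word, in which the
heights of the rows (`height`) locate the letter that changes. In the alphabet of the theorem the
letter `(i + 1)'` stands between `i` and `i + 1`. For `f_i` it is switched with `i + 1`, and for `e_i`
with `i`. After that one box changes its letter. Switching back moves a second half unit to the end of
a ribbon, and this is the second box of the definition of `f_i` and `e_i` (`RowSwitch.lowered_right`,
`RowSwitch.lowered_left`). Switching does not affect which letter of the reading word is the relevant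
unbracketed one (`LowestMax.switch_right`, `TopmostMax.switch_left`, and the lemmas on `IsBracketing`).

*The operators with a bar.* They reduce to the others, as increasing all letters of a word by a half
unit transposes its insertion tableau and increases the entries by a half unit
(`plus_insertionTableau`).

*The isomorphism.* The local rule can be reversed, so a word is determined by its two tableaux, and
every pair occurs (`growth_injective`, `IsChain.exists_growth`). The operators preserve the shapes of
the insertion tableaux of all prefixes, and with them the recording tableau (`recording_eq`). Every
primed tableau is the insertion tableau of a word, so the axioms of a bicrystal for tableaux follow
from those for words.
-/

namespace PrimedCrystal

/-! ### Adding boxes to Young diagrams -/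

/-- The box `b` can be added to the diagram `μ`: it is the first free position of its row and of
its column. -/
def Addable (μ : YoungDiagram) (b : ℕ × ℕ) : Prop := μ.rowLen b.1 = b.2 ∧ μ.colLen b.2 = b.1

/-- The diagram `μ` together with the box `b`. To have a diagram for every `b`, all positions
weakly above and to the left of `b` are added; for an addable `b` this adds only `b`. -/
def addBox (μ : YoungDiagram) (b : ℕ × ℕ) : YoungDiagram where
  cells := μ.cells ∪ Finset.Iic b
  isLowerSet := by
    rw [Finset.coe_union, Finset.coe_Iic]
    exact μ.isLowerSet.union (isLowerSet_Iic b)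

theorem mem_addBox_iff {μ : YoungDiagram} {b p : ℕ × ℕ} : p ∈ addBox μ b ↔ p ∈ μ ∨ p ≤ b := by
  simp [addBox, ← YoungDiagram.mem_cells]

theorem Addable.notMem {μ : YoungDiagram} {b : ℕ × ℕ} (h : Addable μ b) : b ∉ μ := by
  obtain ⟨r, c⟩ := b
  rw [YoungDiagram.mem_iff_lt_rowLen]
  exact fun h' => absurd h.1 (by simpa using h'.ne')

theorem Addable.mem_addBox {μ : YoungDiagram} {b : ℕ × ℕ} (h : Addable μ b) {p : ℕ × ℕ} :
    p ∈ addBox μ b ↔ p ∈ μ ∨ p = b := by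
  rw [mem_addBox_iff]
  constructor
  · rintro (h1 | h1)
    · exact Or.inl h1
    · obtain ⟨r, c⟩ := b
      obtain ⟨r', c'⟩ := p
      obtain ⟨h2, h3⟩ := Prod.mk_le_mk.1 h1
      obtain ⟨h4, h5⟩ := h
      simp only at h4 h5
      rcases Nat.lt_or_ge r' r with h6 | h6
      · left
        exact μ.up_left_mem le_rfl h3 (YoungDiagram.mem_iff_lt_colLen.2 (by omega))
      · obtain rfl : r' = r := le_antisymm h2 h6
        rcases Nat.lt_or_ge c' c with h7 | h7
        · left
          exact YoungDiagram.mem_iff_lt_rowLen.2 (by omega)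
        · right
          rw [le_antisymm h3 h7]
  · rintro (h1 | rfl)
    · exact Or.inl h1
    · exact Or.inr le_rfl

theorem Addable.rowLen_addBox {μ : YoungDiagram} {b : ℕ × ℕ} (h : Addable μ b) (t : ℕ) :
    (addBox μ b).rowLen t = μ.rowLen t + if t = b.1 then 1 else 0 := by
  obtain ⟨r, c⟩ := b
  apply eq_of_forall_lt_iff
  intro d
  rw [← YoungDiagram.mem_iff_lt_rowLen, h.mem_addBox, YoungDiagram.mem_iff_lt_rowLen,
    Prod.mk.injEq]
  have := h.1
  simp only at this ⊢
  split_ifs with h1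
  · subst h1
    omega
  · simp [h1]

theorem addable_iff_rowLen {μ : YoungDiagram} {r c : ℕ} :
    Addable μ (r, c) ↔ μ.rowLen r = c ∧ (∀ t, r = t + 1 → c < μ.rowLen t) := by
  have key : (∀ t, r = t + 1 → c < μ.rowLen t) ↔ r ≤ μ.colLen c := by
    constructor
    · intro h
      cases r with
      | zero => omega
      | succ t => exact YoungDiagram.mem_iff_lt_colLen.1 (YoungDiagram.mem_iff_lt_rowLen.2 (h t rfl))
    · rintro h t rfl
      exact YoungDiagram.mem_iff_lt_rowLen.1 (YoungDiagram.mem_iff_lt_colLen.2 h)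
  unfold Addable
  simp only
  rw [key]
  constructor
  · rintro ⟨h1, h2⟩
    exact ⟨h1, h2.ge⟩
  · rintro ⟨h1, h2⟩
    refine ⟨h1, le_antisymm ?_ h2⟩
    by_contra h3
    have h4 := YoungDiagram.mem_iff_lt_rowLen.1
      (YoungDiagram.mem_iff_lt_colLen.2 (not_le.1 h3))
    omega

theorem addable_transpose {μ : YoungDiagram} {b : ℕ × ℕ} :
    Addable μ.transpose b.swap ↔ Addable μ b := by
  simp [Addable, and_comm]

theorem addBox_transpose (μ : YoungDiagram) (b : ℕ × ℕ) :
    (addBox μ b).transpose = addBox μ.transpose b.swap := by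
  ext p
  simp only [YoungDiagram.mem_cells, YoungDiagram.mem_transpose, mem_addBox_iff]
  rw [← Prod.swap_le_swap, Prod.swap_swap]

theorem addBox_injective {μ ν : YoungDiagram} {b : ℕ × ℕ} (h : Addable μ b) (h' : Addable ν b)
    (e : addBox μ b = addBox ν b) : μ = ν := by
  ext p
  have : p ∈ addBox μ b ↔ p ∈ addBox ν b := by rw [e]
  rw [h.mem_addBox, h'.mem_addBox] at this
  simp only [YoungDiagram.mem_cells]
  by_cases hp : p = b
  · subst hp
    simp [h.notMem, h'.notMem]
  · simpa [hp] using this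

/-- A box that is last in its row and in its column can be removed. -/
theorem exists_addBox_eq {μ : YoungDiagram} {r c : ℕ} (h1 : μ.rowLen r = c + 1)
    (h2 : μ.rowLen (r + 1) ≤ c) : ∃ ν, Addable ν (r, c) ∧ addBox ν (r, c) = μ := by
  have hmem : (r, c) ∈ μ := YoungDiagram.mem_iff_lt_rowLen.2 (by omega)
  let ν : YoungDiagram :=
    { cells := μ.cells.erase (r, c)
      isLowerSet := by
        rintro ⟨a1, a2⟩ ⟨b1, b2⟩ hab ha
        simp only [Finset.coe_erase, Set.mem_sdiff, Finset.mem_coe, YoungDiagram.mem_cells,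
          Set.mem_singleton_iff] at ha ⊢
        obtain ⟨h3, h4⟩ := Prod.mk_le_mk.1 hab
        refine ⟨μ.up_left_mem h3 h4 ha.1, ?_⟩
        intro h5
        obtain ⟨rfl, rfl⟩ := Prod.mk.inj h5
        apply ha.2
        have h6 := YoungDiagram.mem_iff_lt_rowLen.1 ha.1
        rcases Nat.lt_or_ge b1 a1 with h7 | h7
        · have := μ.rowLen_anti (b1 + 1) a1 h7
          omega
        · obtain rfl : a1 = b1 := le_antisymm h7 h3
          rw [show a2 = b2 by omega] }
  have hν : ∀ p, p ∈ ν ↔ p ≠ (r, c) ∧ p ∈ μ := fun p => by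
    rw [← YoungDiagram.mem_cells]
    simp [ν]
  have hrow : ∀ t, ν.rowLen t = μ.rowLen t - if t = r then 1 else 0 := by
    intro t
    apply eq_of_forall_lt_iff
    intro d
    rw [← YoungDiagram.mem_iff_lt_rowLen, hν, YoungDiagram.mem_iff_lt_rowLen]
    simp only [ne_eq, Prod.mk.injEq]
    split_ifs with h3
    · subst h3
      omega
    · simp [h3]
  have hadd : Addable ν (r, c) := by
    rw [addable_iff_rowLen, hrow]
    refine ⟨by simp [h1], ?_⟩
    rintro t rfl
    rw [hrow]
    have := μ.rowLen_anti t (t + 1) (by omega)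
    simp
    omega
  refine ⟨ν, hadd, ?_⟩
  ext p
  simp only [YoungDiagram.mem_cells]
  rw [hadd.mem_addBox, hν]
  by_cases hp : p = (r, c)
  · simp [hp, hmem]
  · simp [hp]

/-! ### Growth of a chain of diagrams under insertion -/

/-- The difference of two diagrams is a horizontal strip (for the type `true`, of an unprimed
letter) or a vertical strip (for the type `false`, of a primed letter). -/
def Strip (h : Bool) (μ ν : YoungDiagram) : Prop :=
  μ ≤ ν ∧ if h then ∀ r c, (r + 1, c) ∈ ν → (r, c) ∈ μ else ∀ r c, (r, c + 1) ∈ ν → (r, c) ∈ μ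

/-- The box in which a letter is put that is inserted into the top row or the leftmost column. -/
def startBox (h : Bool) (μ : YoungDiagram) : ℕ × ℕ :=
  if h then (0, μ.rowLen 0) else (μ.colLen 0, 0)

/-- The local rule of insertion. Among the entries at most `a`, a tableau occupies the diagram `μ`,
and among those smaller than `a` it gets the new box `b`. Then `b` is also the new box among
the entries at most `a`, unless it was occupied by a letter `a`. That letter is then bumped, and the
new box is at the end of the next row or column. -/
def bumpBox (h : Bool) (μ : YoungDiagram) (b : ℕ × ℕ) : ℕ × ℕ :=
  if b ∈ μ then if h then (b.1 + 1, μ.rowLen (b.1 + 1)) else (μ.colLen (b.2 + 1), b.2 + 1) else b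

theorem strip_transpose {h : Bool} {μ ν : YoungDiagram} :
    Strip (!h) μ.transpose ν.transpose ↔ Strip h μ ν := by
  unfold Strip
  cases h <;> simp <;> exact fun _ => forall_comm

theorem startBox_transpose (h : Bool) (μ : YoungDiagram) :
    startBox (!h) μ.transpose = (startBox h μ).swap := by
  cases h <;> simp [startBox]

theorem bumpBox_transpose (h : Bool) (μ : YoungDiagram) (b : ℕ × ℕ) :
    bumpBox (!h) μ.transpose b.swap = (bumpBox h μ b).swap := by
  unfold bumpBox
  cases h <;> simp <;> split_ifs <;> simp

theorem Strip.rowLen_le {h : Bool} {μ ν : YoungDiagram} (s : Strip h μ ν) (t : ℕ) :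
    μ.rowLen t ≤ ν.rowLen t := by
  by_contra h1
  have := YoungDiagram.mem_iff_lt_rowLen.1 (s.1 (YoungDiagram.mem_iff_lt_rowLen.2 (not_le.1 h1)))
  omega

theorem strip_true_iff {μ ν : YoungDiagram} : Strip true μ ν ↔
    (∀ t, μ.rowLen t ≤ ν.rowLen t) ∧ ∀ t, ν.rowLen (t + 1) ≤ μ.rowLen t := by
  constructor
  · intro s
    refine ⟨s.rowLen_le, fun t => ?_⟩
    by_contra h1
    have := YoungDiagram.mem_iff_lt_rowLen.1 (s.2 t _ (YoungDiagram.mem_iff_lt_rowLen.2 (not_le.1 h1)))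
    omega
  · rintro ⟨h1, h2⟩
    refine ⟨fun ⟨r, c⟩ h => ?_, ?_⟩
    · rw [YoungDiagram.mem_iff_lt_rowLen] at h ⊢
      exact h.trans_le (h1 r)
    · intro r c h
      rw [YoungDiagram.mem_iff_lt_rowLen] at h ⊢
      exact h.trans_le (h2 r)

theorem strip_false_iff {μ ν : YoungDiagram} : Strip false μ ν ↔
    (∀ t, μ.rowLen t ≤ ν.rowLen t) ∧ ∀ t, ν.rowLen t ≤ μ.rowLen t + 1 := by
  constructor
  · intro s
    refine ⟨s.rowLen_le, fun t => ?_⟩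
    by_contra h1
    have := YoungDiagram.mem_iff_lt_rowLen.1 (s.2 t _ (YoungDiagram.mem_iff_lt_rowLen.2 (not_le.1 h1)))
    omega
  · rintro ⟨h1, h2⟩
    refine ⟨fun ⟨r, c⟩ h => ?_, ?_⟩
    · rw [YoungDiagram.mem_iff_lt_rowLen] at h ⊢
      exact h.trans_le (h1 r)
    · intro r c h
      rw [YoungDiagram.mem_iff_lt_rowLen] at h ⊢
      have := h2 r
      omega

theorem addable_startBox (h : Bool) (μ : YoungDiagram) : Addable μ (startBox h μ) := by
  have key : ∀ μ : YoungDiagram, Addable μ (startBox true μ) := fun μ => by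
    simp only [startBox, if_true]
    rw [addable_iff_rowLen]
    simp
  cases h with
  | true => exact key μ
  | false =>
    rw [← addable_transpose, ← startBox_transpose]
    exact key _

/-- The local rule leads from a box that can be added to the inner diagram to one that can be added
to the outer diagram. -/
theorem Strip.addable_bumpBox {h : Bool} {μ ν : YoungDiagram} (s : Strip h μ ν) {b : ℕ × ℕ}
    (hb : Addable μ b) : Addable ν (bumpBox h ν b) := by
  have key : ∀ {μ ν : YoungDiagram}, Strip true μ ν → ∀ {b : ℕ × ℕ}, Addable μ b →
      Addable ν (bumpBox true ν b) := by
    rintro μ ν s ⟨r, c⟩ hb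
    rw [addable_iff_rowLen] at hb
    rw [strip_true_iff] at s
    have h1 := s.1 r
    simp only [bumpBox, if_true, YoungDiagram.mem_iff_lt_rowLen]
    split_ifs with h2
    · rw [addable_iff_rowLen]
      refine ⟨rfl, ?_⟩
      rintro t ht
      obtain rfl : r = t := by omega
      have := s.2 r
      omega
    · rw [addable_iff_rowLen]
      refine ⟨by omega, ?_⟩
      rintro t rfl
      have := s.1 t
      have := hb.2 t rfl
      omega
  cases h with
  | true => exact key s hb
  | false =>
    rw [← addable_transpose, ← bumpBox_transpose]
    exact key (strip_transpose.2 s) (addable_transpose.2 hb)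

/-- The local rule preserves the type of a strip. -/
theorem Strip.addBox {h : Bool} {μ ν : YoungDiagram} (s : Strip h μ ν) {b : ℕ × ℕ}
    (hb : Addable μ b) : Strip h (addBox μ b) (addBox ν (bumpBox h ν b)) := by
  have key : ∀ {μ ν : YoungDiagram}, Strip true μ ν → ∀ {b : ℕ × ℕ}, Addable μ b →
      Strip true (PrimedCrystal.addBox μ b) (PrimedCrystal.addBox ν (bumpBox true ν b)) := by
    rintro μ ν s ⟨r, c⟩ hb
    have hb' := s.addable_bumpBox hb
    rw [strip_true_iff] at s ⊢
    simp only [hb.rowLen_addBox, hb'.rowLen_addBox]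
    rw [addable_iff_rowLen] at hb
    simp only [bumpBox, if_true, YoungDiagram.mem_iff_lt_rowLen]
    have h4 := s.1 r
    have h5 := s.2 r
    refine ⟨fun t => ?_, fun t => ?_⟩
    · have h1 := s.1 t
      by_cases h3 : c < ν.rowLen r
      · simp only [h3, if_true]
        split_ifs with h6 h7
        all_goals first | omega | (subst h6; omega)
      · simp only [h3, if_false]
        omega
    · have h2 := s.2 t
      by_cases h3 : c < ν.rowLen r
      · simp only [h3, if_true]
        split_ifs with h6 h7 h7
        all_goals omega
      · simp only [h3, if_false]
        split_ifs with h6 h7 h7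
        · omega
        · have := hb.2 t h6.symm
          rw [h6]
          omega
        · omega
        · omega
  cases h with
  | true => exact key s hb
  | false =>
    rw [← strip_transpose, addBox_transpose, addBox_transpose, ← bumpBox_transpose]
    exact key (strip_transpose.2 s) (addable_transpose.2 hb)

theorem strip_addBox_startBox {h : Bool} {μ ν : YoungDiagram} (s : Strip h μ ν) :
    Strip h μ (addBox ν (startBox h ν)) := by
  have key : ∀ {μ ν : YoungDiagram}, Strip true μ ν →
      Strip true μ (addBox ν (startBox true ν)) := by
    rintro μ ν s
    rw [strip_true_iff] at s ⊢
    simp only [(addable_startBox true ν).rowLen_addBox]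
    refine ⟨fun t => ?_, fun t => ?_⟩
    · have h1 := s.1 t
      omega
    · have h2 := s.2 t
      simp [startBox]
      omega
  cases h with
  | true => exact key s
  | false =>
    rw [← strip_transpose, addBox_transpose, ← startBox_transpose]
    exact key (strip_transpose.2 s)

/-- A tableau in general alphabets, given by the diagrams `Λ a` that the entries at most `a`
occupy. The letters of type `true` fill horizontal strips, those of type `false` vertical ones.
The letters are positive. -/
structure IsChain (τ : ℕ → Bool) (Λ : ℕ → YoungDiagram) : Prop where
  zero : Λ 0 = ⊥
  strip : ∀ a, Strip (τ (a + 1)) (Λ a) (Λ (a + 1))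

/-- The box that is new in `Λ a` when the letter `x` is inserted (for `x ≤ a`). -/
def newBox (τ : ℕ → Bool) (Λ : ℕ → YoungDiagram) (x : ℕ) : ℕ → ℕ × ℕ
  | 0 => startBox (τ 0) (Λ 0)
  | a + 1 => if a + 1 ≤ x then startBox (τ (a + 1)) (Λ (a + 1))
      else bumpBox (τ (a + 1)) (Λ (a + 1)) (newBox τ Λ x a)

/-- The insertion of the letter `x` into a tableau that is given as a chain of diagrams. -/
def insertChain (τ : ℕ → Bool) (Λ : ℕ → YoungDiagram) (x a : ℕ) : YoungDiagram :=
  if a < x then Λ a else addBox (Λ a) (newBox τ Λ x a)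

/-- The insertion tableau of a word, as a chain of diagrams. -/
def growth (τ : ℕ → Bool) (w : List ℕ) : ℕ → YoungDiagram :=
  w.foldl (insertChain τ) (fun _ => ⊥)

theorem newBox_self (τ : ℕ → Bool) (Λ : ℕ → YoungDiagram) (x : ℕ) :
    newBox τ Λ x x = startBox (τ x) (Λ x) := by
  cases x <;> simp [newBox]

theorem newBox_succ (τ : ℕ → Bool) (Λ : ℕ → YoungDiagram) {x a : ℕ} (h : x ≤ a) :
    newBox τ Λ x (a + 1) = bumpBox (τ (a + 1)) (Λ (a + 1)) (newBox τ Λ x a) := by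
  rw [newBox, if_neg (by omega)]

theorem insertChain_of_lt (τ : ℕ → Bool) (Λ : ℕ → YoungDiagram) {x a : ℕ} (h : a < x) :
    insertChain τ Λ x a = Λ a := if_pos h

theorem insertChain_of_le (τ : ℕ → Bool) (Λ : ℕ → YoungDiagram) {x a : ℕ} (h : x ≤ a) :
    insertChain τ Λ x a = addBox (Λ a) (newBox τ Λ x a) := if_neg (by omega)

theorem growth_append (τ : ℕ → Bool) (w : List ℕ) (x : ℕ) :
    growth τ (w ++ [x]) = insertChain τ (growth τ w) x := by
  simp [growth]

theorem IsChain.addable_newBox {τ : ℕ → Bool} {Λ : ℕ → YoungDiagram} (hΛ : IsChain τ Λ)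
    {x a : ℕ} (h : x ≤ a) : Addable (Λ a) (newBox τ Λ x a) := by
  induction a, h using Nat.le_induction with
  | base =>
    rw [newBox_self]
    exact addable_startBox _ _
  | succ a h ih =>
    rw [newBox_succ _ _ h]
    exact (hΛ.strip a).addable_bumpBox ih

theorem IsChain.insertChain {τ : ℕ → Bool} {Λ : ℕ → YoungDiagram} (hΛ : IsChain τ Λ)
    {x : ℕ} (hx : 1 ≤ x) : IsChain τ (insertChain τ Λ x) := by
  refine ⟨?_, fun a => ?_⟩
  · rw [insertChain_of_lt _ _ (by omega), hΛ.zero]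
  · rcases Nat.lt_trichotomy (a + 1) x with h | h | h
    · rw [insertChain_of_lt _ _ (by omega), insertChain_of_lt _ _ h]
      exact hΛ.strip a
    · rw [insertChain_of_lt _ _ (by omega), insertChain_of_le _ _ h.ge, h, newBox_self, ← h]
      exact strip_addBox_startBox (hΛ.strip a)
    · rw [insertChain_of_le _ _ (by omega), insertChain_of_le _ _ (by omega),
        newBox_succ _ _ (by omega)]
      exact (hΛ.strip a).addBox (hΛ.addable_newBox (by omega))

theorem isChain_growth (τ : ℕ → Bool) {w : List ℕ} (hw : ∀ x ∈ w, 1 ≤ x) :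
    IsChain τ (growth τ w) := by
  induction w using List.reverseRecOn with
  | nil =>
    refine ⟨rfl, fun a => ⟨le_rfl, ?_⟩⟩
    simp [growth]
  | append_singleton w x ih =>
    rw [growth_append]
    exact (ih fun y hy => hw y (by simp [hy])).insertChain (hw x (by simp))

theorem IsChain.mono {τ : ℕ → Bool} {Λ : ℕ → YoungDiagram} (hΛ : IsChain τ Λ) : Monotone Λ :=
  monotone_nat_of_le_succ fun a => (hΛ.strip a).1

/-! ### Switching a horizontal strip with a vertical one -/

/-- Switching. The diagrams with the row lengths `l ⊆ m ⊆ n` differ by a horizontal strip followed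
by a vertical strip, and `l ⊆ p ⊆ n` by a vertical strip followed by a horizontal strip. The boxes of
`n / l` form ribbons. In the first filling only the type of the northeasternmost box of a ribbon
is not forced, in the second filling only the type of the southwesternmost one. The relation
says that these two types agree for each ribbon; `k t` says that this common type, for the
ribbon that meets row `t`, is the horizontal one. -/
structure RowSwitch (l m p n : ℕ → ℕ) (k : ℕ → Prop) : Prop where
  lm : ∀ t, l t ≤ m t
  mn : ∀ t, m t ≤ n t
  lp : ∀ t, l t ≤ p t
  pn : ∀ t, p t ≤ n t
  horizontal_lm : ∀ t, m (t + 1) ≤ l t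
  vertical_mn : ∀ t, n t ≤ m t + 1
  vertical_lp : ∀ t, p t ≤ l t + 1
  horizontal_pn : ∀ t, n (t + 1) ≤ p t
  ribbon : ∀ t, l t < n (t + 1) → (k t ↔ k (t + 1))
  top_zero : l 0 < n 0 → (m 0 = n 0 ↔ k 0)
  top_succ : ∀ t, l (t + 1) < n (t + 1) → n (t + 1) ≤ l t → (m (t + 1) = n (t + 1) ↔ k (t + 1))
  bottom : ∀ t, l t < n t → n (t + 1) ≤ l t → (p t = l t ↔ k t)

/-- `Switched λ μ ρ ν` says that the fillings `λ ⊆ μ ⊆ ν` and `λ ⊆ ρ ⊆ ν` arise from each other by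
switching a horizontal strip with a vertical one. -/
def Switched (κ μ ρ ν : YoungDiagram) : Prop :=
  ∃ k, RowSwitch κ.rowLen μ.rowLen ρ.rowLen ν.rowLen k

theorem RowSwitch.le_of_mem_col {κ μ ρ ν : YoungDiagram} {k : ℕ → Prop}
    (h : RowSwitch κ.rowLen μ.rowLen ρ.rowLen ν.rowLen k) {c s t : ℕ} (hst : s ≤ t)
    (hs : κ.rowLen s ≤ c) (ht : c < ν.rowLen t) : k s ↔ k t := by
  induction t, hst using Nat.le_induction with
  | base => rfl
  | succ t hst ih =>
    have h1 := ν.rowLen_anti t (t + 1) (by omega)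
    have h2 := κ.rowLen_anti s t hst
    exact (ih (by omega)).trans (h.ribbon t (by omega))

theorem lt_rowLen_iff {μ : YoungDiagram} {r c : ℕ} : c < μ.rowLen r ↔ r < μ.colLen c := by
  rw [← YoungDiagram.mem_iff_lt_rowLen, YoungDiagram.mem_iff_lt_colLen]

/-- Transposition exchanges the two fillings, and it negates the type of each ribbon. The ribbon
that meets the column `c` is found in the row below the column `c` of the inner diagram. -/
theorem RowSwitch.transpose {κ μ ρ ν : YoungDiagram} {k : ℕ → Prop}
    (h : RowSwitch κ.rowLen μ.rowLen ρ.rowLen ν.rowLen k) :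
    RowSwitch κ.colLen ρ.colLen μ.colLen ν.colLen (fun c => ¬ k (κ.colLen c)) := by
  have e : ∀ {μ ν : YoungDiagram}, (∀ t, μ.rowLen t ≤ ν.rowLen t) → ∀ t, μ.colLen t ≤ ν.colLen t := by
    intro μ ν h t
    by_contra h1
    have h2 := lt_rowLen_iff.2 (not_le.1 h1)
    have h3 := lt_rowLen_iff.1 (h2.trans_le (h _))
    omega
  -- the ribbon of a column does not depend on the row in which it is looked up
  have hk : ∀ c r, κ.rowLen r ≤ c → c < ν.rowLen r → (k (κ.colLen c) ↔ k r) := by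
    intro c r h1 h2
    apply h.le_of_mem_col (c := c) _ _ h2
    · by_contra h3
      have := lt_rowLen_iff.2 (not_le.1 h3)
      omega
    · by_contra h3
      have := lt_rowLen_iff.1 (not_le.1 h3)
      omega
  refine ⟨e h.lp, e h.pn, e h.lm, e h.mn, ?_, ?_, ?_, ?_, ?_, ?_, ?_, ?_⟩
  · intro c
    by_contra h1
    have h2 := lt_rowLen_iff.2 (not_le.1 h1)
    have h3 := h.vertical_lp (κ.colLen c)
    have h4 : ¬ c < κ.rowLen (κ.colLen c) := by rw [lt_rowLen_iff]; omega
    omega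
  · intro c
    by_contra h1
    have h2 := lt_rowLen_iff.2 (not_le.1 h1)
    have h3 := h.horizontal_pn (ρ.colLen c)
    have h4 : ¬ c < ρ.rowLen (ρ.colLen c) := by rw [lt_rowLen_iff]; omega
    omega
  · intro c
    by_contra h1
    have h2 := lt_rowLen_iff.2 (not_le.1 h1)
    have h3 := h.horizontal_lm (κ.colLen c)
    have h4 : ¬ c < κ.rowLen (κ.colLen c) := by rw [lt_rowLen_iff]; omega
    omega
  · intro c
    by_contra h1
    have h2 := lt_rowLen_iff.2 (not_le.1 h1)
    have h3 := h.vertical_mn (μ.colLen c)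
    have h4 : ¬ c < μ.rowLen (μ.colLen c) := by rw [lt_rowLen_iff]; omega
    omega
  · intro c h1
    have h2 := lt_rowLen_iff.2 h1
    have h4 : ¬ c < κ.rowLen (κ.colLen c) := by rw [lt_rowLen_iff]; omega
    rw [hk (c + 1) (κ.colLen c) (by omega) h2]
  · intro h1
    have h2 := lt_rowLen_iff.2 h1
    have h4 : ¬ 0 < κ.rowLen (κ.colLen 0) := by rw [lt_rowLen_iff]; omega
    -- the bottom box of the first column
    have h5 : 0 < ν.rowLen (ν.colLen 0 - 1) := lt_rowLen_iff.2 (by omega)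
    have h6 : ¬ 0 < ν.rowLen (ν.colLen 0 - 1 + 1) := by rw [lt_rowLen_iff]; omega
    have h7 : ¬ 0 < κ.rowLen (ν.colLen 0 - 1) := by rw [lt_rowLen_iff]; omega
    rw [hk 0 (ν.colLen 0 - 1) (by omega) h5, ← h.bottom _ (by omega) (by omega)]
    have h8 : 0 < ρ.rowLen (ν.colLen 0 - 1) ↔ ν.colLen 0 - 1 < ρ.colLen 0 := lt_rowLen_iff
    have h9 := e h.pn 0
    omega
  · intro c h1 h1'
    have h2 := lt_rowLen_iff.2 h1
    have h5 : c + 1 < ν.rowLen (ν.colLen (c + 1) - 1) := lt_rowLen_iff.2 (by omega)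
    have h6 : ¬ c + 1 < ν.rowLen (ν.colLen (c + 1) - 1 + 1) := by rw [lt_rowLen_iff]; omega
    have h7 : ¬ c + 1 < κ.rowLen (ν.colLen (c + 1) - 1) := by rw [lt_rowLen_iff]; omega
    have h10 : c < κ.rowLen (ν.colLen (c + 1) - 1) := lt_rowLen_iff.2 (by omega)
    rw [hk (c + 1) (ν.colLen (c + 1) - 1) (by omega) h5, ← h.bottom _ (by omega) (by omega)]
    have h8 : c + 1 < ρ.rowLen (ν.colLen (c + 1) - 1) ↔ ν.colLen (c + 1) - 1 < ρ.colLen (c + 1) :=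
      lt_rowLen_iff
    have h9 := e h.pn (c + 1)
    have h11 := h.lp (ν.colLen (c + 1) - 1)
    omega
  · intro c h1 h1'
    have h2 := lt_rowLen_iff.2 h1
    have h4 : ¬ c < κ.rowLen (κ.colLen c) := by rw [lt_rowLen_iff]; omega
    have h5 : ¬ c + 1 < ν.rowLen (κ.colLen c) := by rw [lt_rowLen_iff]; omega
    have h9 := e h.lm c
    have h8 : c < μ.rowLen (κ.colLen c) ↔ κ.colLen c < μ.colLen c := lt_rowLen_iff
    have h10 := h.mn (κ.colLen c)
    have key : μ.rowLen (κ.colLen c) = ν.rowLen (κ.colLen c) ↔ k (κ.colLen c) := by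
      rcases hr : κ.colLen c with _ | t
      · rw [hr] at h2 h4
        exact h.top_zero (by omega)
      · rw [hr] at h2 h4 h5
        have h6 : c < κ.rowLen t := lt_rowLen_iff.2 (by omega)
        exact h.top_succ t (by omega) (by omega)
    rw [← key]
    omega

theorem Switched.transpose {κ μ ρ ν : YoungDiagram} (h : Switched κ μ ρ ν) :
    Switched κ.transpose ρ.transpose μ.transpose ν.transpose := by
  obtain ⟨k, hk⟩ := h
  refine ⟨fun c => ¬ k (κ.colLen c), ?_⟩
  have e : ∀ μ : YoungDiagram, μ.transpose.rowLen = μ.colLen := fun μ =>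
    funext (YoungDiagram.rowLen_transpose μ)
  rw [e, e, e, e]
  exact hk.transpose

theorem Switched.strips {κ μ ρ ν : YoungDiagram} (h : Switched κ μ ρ ν) :
    Strip true κ μ ∧ Strip false μ ν ∧ Strip false κ ρ ∧ Strip true ρ ν := by
  obtain ⟨k, hk⟩ := h
  simp only [strip_true_iff, strip_false_iff]
  exact ⟨⟨hk.lm, hk.horizontal_lm⟩, ⟨hk.mn, hk.vertical_mn⟩, ⟨hk.lp, hk.vertical_lp⟩,
    ⟨hk.pn, hk.horizontal_pn⟩⟩

/-- The effect on a switched pair if the new box is in row `r` for the inner diagram and the letter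
of this box leaves for the row `r + 1`: the row lengths change by the same amounts in all cases. -/
theorem RowSwitch.bump {l m p n : ℕ → ℕ} {k : ℕ → Prop} (h : RowSwitch l m p n k) {r : ℕ}
    (h1 : l r < n r) (h2 : l r + 2 ≤ n r ∨ n (r + 1) ≤ l r ∧ k r)
    (h3 : ∀ t, r = t + 1 → l r < l t) :
    RowSwitch (fun t => l t + if t = r then 1 else 0) (fun t => m t + if t = r + 1 then 1 else 0)
      (fun t => p t + if t = r then 1 else 0) (fun t => n t + if t = r + 1 then 1 else 0)
      (fun t => if t = r + 1 ∧ l t = n t then True else k t) := by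
  obtain ⟨lm, mn, lp, pn, hlm, vmn, vlp, hpn, hr, ht0, hts, hb⟩ := h
  have lm' := lm r
  have mn' := mn r
  have lp' := lp r
  have pn' := pn r
  have lm'' := lm (r + 1)
  have mn'' := mn (r + 1)
  have hlm' := hlm r
  have vmn' := vmn r
  have vlp' := vlp r
  have hpn' := hpn r
  have hr' := hr r
  have ht0' := ht0
  have hb' := hb r
  have hts' := hts r
  have key : l r + 1 ≤ m r := by
    rcases h2 with h2 | ⟨h2, h4⟩
    · omega
    · rcases Nat.eq_zero_or_pos r with h5 | h5
      · subst h5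
        have := (ht0 h1).2 h4
        omega
      · obtain ⟨t, rfl⟩ : ∃ t, r = t + 1 := ⟨r - 1, by omega⟩
        by_cases h6 : n (t + 1) ≤ l t
        · have := (hts t h1 h6).2 h4
          omega
        · have := h3 t rfl
          have := hlm t
          have := vmn (t + 1)
          omega
  refine ⟨?_, ?_, ?_, ?_, ?_, ?_, ?_, ?_, ?_, ?_, ?_, ?_⟩
  · intro t; grind
  · intro t; grind
  · intro t; grind
  · intro t; grind
  · intro t; grind
  · intro t; grind
  · intro t; grind
  · intro t; grind
  · intro t; grind
  · grind
  · intro t; grind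
  · intro t; grind

/-- The effect on a switched pair of a new box in row `r` that is outside of all its diagrams. -/
theorem RowSwitch.add {l m p n : ℕ → ℕ} {k : ℕ → Prop} (h : RowSwitch l m p n k) {r : ℕ}
    (h1 : l r = n r) (h3 : ∀ t, r = t + 1 → l r < l t) :
    RowSwitch (fun t => l t + if t = r then 1 else 0) (fun t => m t + if t = r then 1 else 0)
      (fun t => p t + if t = r then 1 else 0) (fun t => n t + if t = r then 1 else 0) k := by
  obtain ⟨lm, mn, lp, pn, hlm, vmn, vlp, hpn, hr, ht0, hts, hb⟩ := h
  have lm' := lm r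
  have mn' := mn r
  have lp' := lp r
  have pn' := pn r
  have hlm' := hlm r
  have hpn' := hpn r
  refine ⟨?_, ?_, ?_, ?_, ?_, ?_, ?_, ?_, ?_, ?_, ?_, ?_⟩
  · intro t; grind
  · intro t; grind
  · intro t; grind
  · intro t; grind
  · intro t; grind
  · intro t; grind
  · intro t; grind
  · intro t; grind
  · intro t; grind
  · grind
  · intro t; grind
  · intro t; grind

/-- The effect on a switched pair of a new letter, of the type of a horizontal strip, in the
top row. -/
theorem RowSwitch.start {l m p n : ℕ → ℕ} {k : ℕ → Prop} (h : RowSwitch l m p n k) :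
    RowSwitch l (fun t => m t + if t = 0 then 1 else 0) p (fun t => n t + if t = 0 then 1 else 0)
      (fun t => if t = 0 ∧ l t = n t then True else k t) := by
  obtain ⟨lm, mn, lp, pn, hlm, vmn, vlp, hpn, hr, ht0, hts, hb⟩ := h
  have lm' := lm 0
  have mn' := mn 0
  have lp' := lp 0
  have pn' := pn 0
  have hlm' := hlm 0
  have hpn' := hpn 0
  have vmn' := vmn 0
  have vlp' := vlp 0
  have hr' := hr 0
  have hb' := hb 0
  refine ⟨?_, ?_, ?_, ?_, ?_, ?_, ?_, ?_, ?_, ?_, ?_, ?_⟩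
  · intro t; grind
  · intro t; grind
  · intro t; grind
  · intro t; grind
  · intro t; grind
  · intro t; grind
  · intro t; grind
  · intro t; grind
  · intro t; grind
  · grind
  · intro t; grind
  · intro t; grind

/-- The local rules for the two letters commute with switching if the new box reaches the row `r +
1`; this happens if its row contains two boxes of the ribbon, or if the box is the southwestern end
of a ribbon of the horizontal type. -/
theorem Switched.bump_of_lt {κ μ ρ ν : YoungDiagram} {k : ℕ → Prop}
    (h : RowSwitch κ.rowLen μ.rowLen ρ.rowLen ν.rowLen k) {r c : ℕ} (hb : Addable κ (r, c))
    (h1 : c < ν.rowLen r) (h2 : c + 2 ≤ ν.rowLen r ∨ ν.rowLen (r + 1) ≤ c ∧ k r) :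
    bumpBox true ν (bumpBox false ρ (r, c)) = bumpBox false ν (bumpBox true μ (r, c)) ∧
    Switched (addBox κ (r, c)) (addBox μ (bumpBox true μ (r, c)))
      (addBox ρ (bumpBox false ρ (r, c)))
      (addBox ν (bumpBox false ν (bumpBox true μ (r, c)))) := by
  obtain ⟨s1, s2, s3, s4⟩ := Switched.strips ⟨k, h⟩
  have hb1 := s1.addable_bumpBox hb
  have hb2 := s2.addable_bumpBox hb1
  have hd1 := s3.addable_bumpBox hb
  have hb' := addable_iff_rowLen.1 hb
  obtain ⟨rfl, h3⟩ := hb'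
  have hsw := h.bump h1 h2 h3
  have vmn := h.vertical_mn
  have vlp := h.vertical_lp r
  have lm := h.lm
  have mn := h.mn (r + 1)
  have lp := h.lp r
  have hlm := h.horizontal_lm
  have hpn := h.horizontal_pn
  -- the letter of the new box is bumped by the first insertion
  have hm : κ.rowLen r < μ.rowLen r := by
    have := hsw.lm r
    simpa using this
  have e1 : bumpBox true μ (r, κ.rowLen r) = (r + 1, μ.rowLen (r + 1)) := by
    simp [bumpBox, YoungDiagram.mem_iff_lt_rowLen, hm]
  have e2 : bumpBox false ν (r + 1, μ.rowLen (r + 1)) = (r + 1, ν.rowLen (r + 1)) := by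
    unfold bumpBox
    simp only [YoungDiagram.mem_iff_lt_rowLen, Bool.false_eq_true, if_false]
    split_ifs with h4
    · have h5 := vmn (r + 1)
      have h6 : ν.rowLen (r + 1) = μ.rowLen (r + 1) + 1 := by omega
      have h7 : ν.rowLen (r + 1) < ν.rowLen r := by
        have := hlm r
        have := hpn r
        omega
      have h8 := lt_rowLen_iff.1 h7
      have h9 : ¬ ν.rowLen (r + 1) < ν.rowLen (r + 1) := lt_irrefl _
      rw [lt_rowLen_iff] at h9
      rw [← h6]
      ext <;> simp
      omega
    · ext <;> simp
      omega
  have e4 : bumpBox false ρ (r, κ.rowLen r) = (r, ρ.rowLen r) := by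
    unfold bumpBox
    simp only [YoungDiagram.mem_iff_lt_rowLen, Bool.false_eq_true, if_false]
    split_ifs with h4
    · have h5 : κ.rowLen r + 2 ≤ ν.rowLen r := by
        rcases h2 with h2 | ⟨h2, h5⟩
        · exact h2
        · have := (h.bottom r h1 h2).2 h5
          omega
      have h6 : ¬ κ.rowLen r + 1 < ρ.rowLen r := by omega
      rw [lt_rowLen_iff] at h6
      have h7 : ρ.colLen (κ.rowLen r + 1) = r := by
        refine le_antisymm (by omega) ?_
        rcases r with _ | t
        · omega
        · have := hpn t
          exact lt_rowLen_iff.1 (by omega)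
      rw [h7]
      ext <;> simp
      omega
    · ext <;> simp
      omega
  have e3 : bumpBox true ν (r, ρ.rowLen r) = (r + 1, ν.rowLen (r + 1)) := by
    unfold bumpBox
    simp only [YoungDiagram.mem_iff_lt_rowLen, if_true]
    rw [if_pos]
    rcases h2 with h2 | ⟨h2, h5⟩
    · omega
    · have := (h.bottom r h1 h2).2 h5
      omega
  rw [e1] at hb1 hb2 ⊢
  rw [e2] at hb2 ⊢
  rw [e4] at hd1 ⊢
  refine ⟨e3, fun t => if t = r + 1 ∧ κ.rowLen t = ν.rowLen t then True else k t, ?_⟩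
  convert hsw using 1
  · exact funext hb.rowLen_addBox
  · exact funext hb1.rowLen_addBox
  · exact funext hd1.rowLen_addBox
  · exact funext hb2.rowLen_addBox

/-- The local rules for two adjacent letters of different types commute with switching: the new box
that is passed on to the larger letters is the same, and the new fillings are switched again. -/
theorem Switched.bump {κ μ ρ ν : YoungDiagram} (h : Switched κ μ ρ ν) {b : ℕ × ℕ}
    (hb : Addable κ b) :
    bumpBox true ν (bumpBox false ρ b) = bumpBox false ν (bumpBox true μ b) ∧
    Switched (addBox κ b) (addBox μ (bumpBox true μ b)) (addBox ρ (bumpBox false ρ b))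
      (addBox ν (bumpBox false ν (bumpBox true μ b))) := by
  obtain ⟨k, hk⟩ := h
  obtain ⟨r, c⟩ := b
  have hb' := addable_iff_rowLen.1 hb
  by_cases h1 : c < ν.rowLen r
  · by_cases h2 : c + 2 ≤ ν.rowLen r ∨ ν.rowLen (r + 1) ≤ c ∧ k r
    · exact Switched.bump_of_lt hk hb h1 h2
    · -- the transposed situation is the one of the preceding lemma
      have hkt := hk.transpose
      have e : ∀ μ : YoungDiagram, μ.transpose.rowLen = μ.colLen := fun μ =>
        funext (YoungDiagram.rowLen_transpose μ)
      rw [← e, ← e, ← e, ← e] at hkt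
      have hbt : Addable κ.transpose (c, r) := addable_transpose.2 hb
      have hc : κ.colLen c = r := hb.2
      have h3 : (c + 1 < ν.rowLen r ↔ r < ν.colLen (c + 1)) := lt_rowLen_iff
      have h4 : (c < ν.rowLen (r + 1) ↔ r + 1 < ν.colLen c) := lt_rowLen_iff
      have := Switched.bump_of_lt hkt hbt (by simpa using lt_rowLen_iff.1 h1) (by
        simp only [YoungDiagram.rowLen_transpose, hc]
        by_cases h5 : k r
        · left
          have : ¬ ν.rowLen (r + 1) ≤ c := fun h6 => h2 (Or.inr ⟨h6, h5⟩)
          omega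
        · right
          exact ⟨by omega, h5⟩)
      obtain ⟨h5, h6⟩ := this
      have t2 : ∀ (h : Bool) (μ : YoungDiagram) (b : ℕ × ℕ),
          bumpBox h μ.transpose b.swap = (bumpBox (!h) μ b).swap := fun h μ b => by
        have := bumpBox_transpose (!h) μ b
        rwa [Bool.not_not] at this
      rw [show (c, r) = Prod.swap (r, c) from rfl] at h5 h6
      simp only [t2, Bool.not_true, Bool.not_false] at h5 h6
      have h7 := Prod.swap_injective h5
      refine ⟨h7.symm, ?_⟩
      have h8 := h6.transpose
      simpa only [addBox_transpose, YoungDiagram.transpose_transpose, Prod.swap_swap,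
        Prod.swap_prod_mk, h7] using h8
  · have h2 : ∀ {μ : YoungDiagram}, (∀ t, μ.rowLen t ≤ ν.rowLen t) → ∀ h,
        bumpBox h μ (r, c) = (r, c) := by
      intro μ hμ h
      unfold bumpBox
      rw [if_neg]
      rw [YoungDiagram.mem_iff_lt_rowLen]
      exact fun h3 => h1 (h3.trans_le (hμ r))
    obtain ⟨s1, s2, s3, s4⟩ := Switched.strips ⟨k, hk⟩
    have e1 := h2 hk.mn true
    have e2 := h2 hk.pn false
    have e3 := h2 (fun t => le_refl _) true
    have e4 := h2 (fun t => le_refl _) false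
    have hb1 := s1.addable_bumpBox hb
    have hb2 := s2.addable_bumpBox hb1
    have hd1 := s3.addable_bumpBox hb
    rw [e1] at hb1 hb2
    rw [e2] at hd1
    rw [e4] at hb2
    rw [e1, e2, e3, e4]
    refine ⟨rfl, k, ?_⟩
    have h3 := hk.lm r
    have h4 := hk.mn r
    have := hk.add (r := r) (by omega) (by rw [hb'.1]; exact hb'.2)
    convert this using 1
    · exact funext hb.rowLen_addBox
    · exact funext hb1.rowLen_addBox
    · exact funext hd1.rowLen_addBox
    · exact funext hb2.rowLen_addBox

/-- Switching commutes with the insertion of the letter that fills the horizontal strip. -/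
theorem Switched.start_true {κ μ ρ ν : YoungDiagram} (h : Switched κ μ ρ ν) :
    startBox true ν = bumpBox false ν (startBox true μ) ∧
    Switched κ (addBox μ (startBox true μ)) ρ (addBox ν (startBox true ν)) := by
  obtain ⟨k, hk⟩ := h
  constructor
  · simp only [startBox, bumpBox, if_true, Bool.false_eq_true, if_false,
      YoungDiagram.mem_iff_lt_rowLen]
    split_ifs with h1
    · have h2 := hk.vertical_mn 0
      have h3 : ν.rowLen 0 = μ.rowLen 0 + 1 := by omega
      have h4 : ¬ μ.rowLen 0 + 1 < ν.rowLen 0 := by omega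
      rw [lt_rowLen_iff] at h4
      ext <;> simp <;> omega
    · have := hk.mn 0
      ext <;> simp
      omega
  · refine ⟨fun t => if t = 0 ∧ κ.rowLen t = ν.rowLen t then True else k t, ?_⟩
    convert hk.start using 1
    · exact funext (addable_startBox true μ).rowLen_addBox
    · exact funext (addable_startBox true ν).rowLen_addBox

/-- Switching commutes with the insertion of the letter that fills the vertical strip. -/
theorem Switched.start_false {κ μ ρ ν : YoungDiagram} (h : Switched κ μ ρ ν) :
    startBox false ν = bumpBox true ν (startBox false ρ) ∧
    Switched κ μ (addBox ρ (startBox false ρ)) (addBox ν (startBox false ν)) := by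
  obtain ⟨h1, h2⟩ := h.transpose.start_true
  have s : ∀ μ : YoungDiagram, startBox true μ.transpose = (startBox false μ).swap :=
    fun μ => startBox_transpose false μ
  have t : ∀ (μ : YoungDiagram) (b : ℕ × ℕ),
      bumpBox false μ.transpose b.swap = (bumpBox true μ b).swap := fun μ b =>
    bumpBox_transpose true μ b
  simp only [s, t] at h1 h2
  refine ⟨Prod.swap_injective h1, ?_⟩
  have h8 := h2.transpose
  simpa only [addBox_transpose, YoungDiagram.transpose_transpose, Prod.swap_swap] using h8

/-- In a switched pair, the second filling determines the first one. -/
theorem RowSwitch.unique_left {l m m' p n : ℕ → ℕ} {k k' : ℕ → Prop} (h : RowSwitch l m p n k)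
    (h' : RowSwitch l m' p n k') (hn : ∃ N, ∀ t, N ≤ t → n t = 0) : m = m' := by
  obtain ⟨N, hN⟩ := hn
  -- the types of the ribbons agree, by induction from the bottom row upwards
  have key : ∀ d t, N ≤ t + d → l t < n t → (k t ↔ k' t) := by
    intro d
    induction d with
    | zero =>
      intro t h1 h2
      have := hN t h1
      omega
    | succ d ih =>
      intro t h1 h2
      by_cases h3 : n (t + 1) ≤ l t
      · rw [← h.bottom t h2 h3, ← h'.bottom t h2 h3]
      · have h4 := h.lm (t + 1)
        have h5 := h.horizontal_lm t
        have h6 := h.horizontal_pn t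
        have h7 := h.vertical_mn (t + 1)
        have h8 := h.ribbon t (by omega)
        have h9 := h'.ribbon t (by omega)
        rw [h8, h9]
        apply ih _ (by omega)
        by_contra h10
        have := h.pn t
        have := h.vertical_lp t
        omega
  have key' : ∀ t, l t < n t → (k t ↔ k' t) := fun t => key N t (by omega)
  funext t
  have a1 := h.lm t
  have a2 := h.mn t
  have a3 := h'.lm t
  have a4 := h'.mn t
  have a5 := h.vertical_mn t
  have a6 := h'.vertical_mn t
  by_cases h1 : l t < n t
  · have h2 := key' t h1
    rcases t with _ | t
    · have h3 := h.top_zero h1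
      have h4 := h'.top_zero h1
      rw [← h3, ← h4] at h2
      omega
    · by_cases h5 : n (t + 1) ≤ l t
      · have h3 := h.top_succ t h1 h5
        have h4 := h'.top_succ t h1 h5
        rw [← h3, ← h4] at h2
        omega
      · have := h.horizontal_lm t
        have := h'.horizontal_lm t
        omega
  · omega

/-- In a switched pair, the first filling determines the second one. -/
theorem RowSwitch.unique_right {l m p p' n : ℕ → ℕ} {k k' : ℕ → Prop} (h : RowSwitch l m p n k)
    (h' : RowSwitch l m p' n k') : p = p' := by
  have key : ∀ t, l t < n t → (k t ↔ k' t) := by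
    intro t
    induction t with
    | zero =>
      intro h1
      rw [← h.top_zero h1, ← h'.top_zero h1]
    | succ t ih =>
      intro h1
      by_cases h2 : n (t + 1) ≤ l t
      · rw [← h.top_succ t h1 h2, ← h'.top_succ t h1 h2]
      · have h3 := h.ribbon t (by omega)
        have h4 := h'.ribbon t (by omega)
        have h5 := h.horizontal_pn t
        have h6 := h.pn t
        rw [← h3, ← h4]
        exact ih (by omega)
  funext t
  have a1 := h.lp t
  have a2 := h.pn t
  have a3 := h'.lp t
  have a4 := h'.pn t
  have a5 := h.vertical_lp t
  have a6 := h'.vertical_lp t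
  have a7 := h.horizontal_pn t
  have a8 := h'.horizontal_pn t
  by_cases h1 : l t < n t
  · have h2 := key t h1
    by_cases h5 : n (t + 1) ≤ l t
    · have h3 := h.bottom t h1 h5
      have h4 := h'.bottom t h1 h5
      rw [← h3, ← h4] at h2
      omega
    · omega
  · omega

/-! ### Insertion commutes with switching -/

theorem newBox_congr {τ τ' : ℕ → Bool} {Λ Λ' : ℕ → YoungDiagram} {x a : ℕ}
    (h : ∀ b ≤ a, Λ b = Λ' b ∧ τ b = τ' b) : newBox τ Λ x a = newBox τ' Λ' x a := by
  induction a with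
  | zero =>
    obtain ⟨h1, h2⟩ := h 0 le_rfl
    simp [newBox, h1, h2]
  | succ a ih =>
    obtain ⟨h1, h2⟩ := h (a + 1) le_rfl
    simp [newBox, h1, h2, ih fun b hb => h b (by omega)]

/-- The local rules above the level `a` depend on the insertion only by the new box at this level.
-/
theorem newBox_eq_of_le {τ τ' : ℕ → Bool} {Λ Λ' : ℕ → YoungDiagram} {x x' a b : ℕ}
    (h : ∀ c, a < c → Λ c = Λ' c ∧ τ c = τ' c) (hx : x ≤ a) (hx' : x' ≤ a)
    (e : newBox τ Λ x a = newBox τ' Λ' x' a) (hab : a ≤ b) :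
    newBox τ Λ x b = newBox τ' Λ' x' b := by
  induction b, hab using Nat.le_induction with
  | base => exact e
  | succ b hab ih =>
    obtain ⟨h1, h2⟩ := h (b + 1) (by omega)
    rw [newBox_succ _ _ (by omega), newBox_succ _ _ (by omega), h1, h2, ih]

/-- One insertion commutes with switching. The letters `n + 1` and `n + 2` change their order, so
the inserted letter is changed accordingly. -/
theorem switched_insertChain {τ τ' : ℕ → Bool} {Λ Λ' : ℕ → YoungDiagram} {n x x' : ℕ}
    (hΛ : IsChain τ Λ) (hτ : ∀ a, a ≠ n + 1 → a ≠ n + 2 → τ' a = τ a)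
    (h1 : τ (n + 1) = true) (h2 : τ (n + 2) = false)
    (h1' : τ' (n + 1) = false) (h2' : τ' (n + 2) = true)
    (hx : x' = Equiv.swap (n + 1) (n + 2) x)
    (he : ∀ a, a ≠ n + 1 → Λ' a = Λ a)
    (hs : Switched (Λ n) (Λ (n + 1)) (Λ' (n + 1)) (Λ (n + 2))) :
    (∀ a, a ≠ n + 1 → insertChain τ' Λ' x' a = insertChain τ Λ x a) ∧
    Switched (insertChain τ Λ x n) (insertChain τ Λ x (n + 1)) (insertChain τ' Λ' x' (n + 1))
      (insertChain τ Λ x (n + 2)) := by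
  have above : ∀ c, n + 2 < c → Λ' c = Λ c ∧ τ' c = τ c := fun c hc =>
    ⟨he c (by omega), hτ c (by omega) (by omega)⟩
  have below : ∀ c, c ≤ n → Λ' c = Λ c ∧ τ' c = τ c := fun c hc =>
    ⟨he c (by omega), hτ c (by omega) (by omega)⟩
  rcases Nat.lt_or_ge n x with hn | hn
  · rcases eq_or_ne x (n + 1) with rfl | hn1
    · rw [Equiv.swap_apply_left] at hx
      subst hx
      obtain ⟨h3, h4⟩ := hs.start_true
      have h5 : newBox τ' Λ' (n + 2) (n + 2) = newBox τ Λ (n + 1) (n + 2) := by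
        rw [newBox_self, newBox_succ _ _ (by omega), newBox_self, h1, h2, h2', he _ (by omega), h3]
      constructor
      · intro a ha
        rcases Nat.lt_or_ge a (n + 1) with h6 | h6
        · rw [insertChain_of_lt _ _ (by omega), insertChain_of_lt _ _ h6, he a ha]
        · rw [insertChain_of_le _ _ (by omega), insertChain_of_le _ _ h6, he a ha,
            newBox_eq_of_le above (by omega) (by omega) h5 (by omega)]
      · rw [insertChain_of_lt _ _ (by omega), insertChain_of_le _ _ (by omega),
          insertChain_of_lt _ _ (by omega), insertChain_of_le _ _ (by omega), ← h5,
          newBox_self, newBox_self, h1, h2', he (n + 2) (by omega)]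
        exact h4
    · rcases eq_or_ne x (n + 2) with rfl | hn2
      · rw [Equiv.swap_apply_right] at hx
        subst hx
        obtain ⟨h3, h4⟩ := hs.start_false
        have h5 : newBox τ' Λ' (n + 1) (n + 2) = newBox τ Λ (n + 2) (n + 2) := by
          rw [newBox_self, newBox_succ _ _ (by omega), newBox_self, h1', h2, h2', he _ (by omega), h3]
        constructor
        · intro a ha
          rcases Nat.lt_or_ge a (n + 1) with h6 | h6
          · rw [insertChain_of_lt _ _ (by omega), insertChain_of_lt _ _ (by omega), he a ha]
          · rw [insertChain_of_le _ _ (by omega), insertChain_of_le _ _ (by omega), he a ha,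
              newBox_eq_of_le above (by omega) (by omega) h5 (by omega)]
        · rw [insertChain_of_lt _ _ (by omega), insertChain_of_lt _ _ (by omega),
            insertChain_of_le _ _ (by omega), insertChain_of_le _ _ (by omega),
            newBox_self, newBox_self, h1', h2]
          exact h4
      · rw [Equiv.swap_apply_of_ne_of_ne hn1 hn2] at hx
        subst hx
        have h5 : newBox τ' Λ' x' x' = newBox τ Λ x' x' := by
          rw [newBox_self, newBox_self, he _ hn1, hτ _ hn1 hn2]
        constructor
        · intro a ha
          rcases Nat.lt_or_ge a x' with h6 | h6
          · rw [insertChain_of_lt _ _ h6, insertChain_of_lt _ _ h6, he a ha]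
          · rw [insertChain_of_le _ _ h6, insertChain_of_le _ _ h6, he a ha,
              newBox_eq_of_le (fun c hc => above c (by omega)) le_rfl le_rfl h5 h6]
        · rw [insertChain_of_lt _ _ (by omega), insertChain_of_lt _ _ (by omega),
            insertChain_of_lt _ _ (by omega), insertChain_of_lt _ _ (by omega)]
          exact hs
  · rw [Equiv.swap_apply_of_ne_of_ne (by omega) (by omega)] at hx
    subst hx
    have h0 : ∀ a, a ≤ n → newBox τ' Λ' x' a = newBox τ Λ x' a := fun a ha =>
      newBox_congr fun b hb => below b (by omega)
    have h0' := h0 n le_rfl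
    obtain ⟨h3, h4⟩ := hs.bump (hΛ.addable_newBox hn)
    have h5 : newBox τ' Λ' x' (n + 2) = newBox τ Λ x' (n + 2) := by
      rw [newBox_succ _ _ (by omega), newBox_succ _ _ (by omega), newBox_succ _ _ (by omega),
        newBox_succ _ _ (by omega), h0', h1, h1', h2, h2', he (n + 2) (by omega)]
      exact h3
    constructor
    · intro a ha
      rcases Nat.lt_or_ge a x' with h6 | h6
      · rw [insertChain_of_lt _ _ h6, insertChain_of_lt _ _ h6, he a ha]
      · rw [insertChain_of_le _ _ h6, insertChain_of_le _ _ h6, he a ha]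
        rcases Nat.lt_or_ge n a with h7 | h7
        · rw [newBox_eq_of_le above (by omega) (by omega) h5 (by omega)]
        · rw [h0 a h7]
    · rw [insertChain_of_le _ _ (by omega), insertChain_of_le _ _ (by omega),
        insertChain_of_le _ _ (by omega), insertChain_of_le _ _ (by omega),
        newBox_succ _ _ (show x' ≤ n + 1 by omega), newBox_succ _ _ hn, newBox_succ _ _ hn,
        h0', h1, h2, h1']
      exact h4

/-- Insertion commutes with the change of the order of two adjacent letters, of which one is primed
and the other one is not: the insertion tableaux differ by switching these letters. -/
theorem switched_growth {τ : ℕ → Bool} {n : ℕ} (h1 : τ (n + 1) = true) (h2 : τ (n + 2) = false)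
    {w : List ℕ} (hw : ∀ x ∈ w, 1 ≤ x) :
    (∀ a, a ≠ n + 1 → growth (τ ∘ Equiv.swap (n + 1) (n + 2)) (w.map (Equiv.swap (n + 1) (n + 2))) a =
      growth τ w a) ∧
    Switched (growth τ w n) (growth τ w (n + 1))
      (growth (τ ∘ Equiv.swap (n + 1) (n + 2)) (w.map (Equiv.swap (n + 1) (n + 2))) (n + 1))
      (growth τ w (n + 2)) := by
  induction w using List.reverseRecOn with
  | nil =>
    have e : ∀ t, (⊥ : YoungDiagram).rowLen t = 0 := fun t => by
      by_contra h
      have := YoungDiagram.mem_iff_lt_rowLen.2 (Nat.pos_of_ne_zero h)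
      simp at this
    refine ⟨fun a _ => rfl, fun _ => True, ?_⟩
    constructor <;> simp [growth, e]
  | append_singleton w x ih =>
    have hw' : ∀ y ∈ w, 1 ≤ y := fun y hy => hw y (by simp [hy])
    obtain ⟨ih1, ih2⟩ := ih hw'
    rw [List.map_append, List.map_singleton, growth_append, growth_append]
    apply switched_insertChain (isChain_growth τ hw') _ h1 h2 _ _ rfl ih1 ih2
    · intro a h3 h4
      rw [Function.comp_apply, Equiv.swap_apply_of_ne_of_ne h3 h4]
    · rw [Function.comp_apply, Equiv.swap_apply_left, h2]
    · rw [Function.comp_apply, Equiv.swap_apply_right, h1]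

/-! ### The crystal operators on words -/

/-- The number of unbracketed letters `a` in a word. -/
def phi (a b : ℕ) (w : List ℕ) : ℕ := (unbracketed a b w.zipIdx).1.length

/-- The number of unbracketed letters `b` in a word. -/
def eps (a b : ℕ) (w : List ℕ) : ℕ := (unbracketed a b w.zipIdx).2.length

theorem unbracketed_zipIdx_append (a b : ℕ) (w : List ℕ) (x : ℕ) :
    unbracketed a b (w ++ [x]).zipIdx =
      bracketStep a b (unbracketed a b w.zipIdx) (x, w.length) := by
  simp [unbracketed, List.zipIdx_append]

theorem lt_length_of_mem_unbracketed {a b : ℕ} {w : List ℕ} {p : ℕ}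
    (hp : p ∈ (unbracketed a b w.zipIdx).1 ∨ p ∈ (unbracketed a b w.zipIdx).2) :
    p < w.length := by
  induction w using List.reverseRecOn with
  | nil => simp [unbracketed] at hp
  | append_singleton w x ih =>
    rw [unbracketed_zipIdx_append] at hp
    obtain ⟨A, B⟩ := unbracketed a b w.zipIdx
    simp only [List.length_append, List.length_singleton]
    cases B <;> grind [bracketStep]

theorem phi_append {a b : ℕ} (hab : a ≠ b) (w : List ℕ) (x : ℕ) :
    phi a b (w ++ [x]) = phi a b w + if x = a ∧ eps a b w = 0 then 1 else 0 := by
  unfold phi eps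
  rw [unbracketed_zipIdx_append]
  obtain ⟨A, B⟩ := unbracketed a b w.zipIdx
  cases B <;> grind [bracketStep]

theorem eps_append {a b : ℕ} (w : List ℕ) (x : ℕ) :
    eps a b (w ++ [x]) = if x = b then eps a b w + 1 else if x = a then eps a b w - 1
      else eps a b w := by
  unfold eps
  rw [unbracketed_zipIdx_append]
  obtain ⟨A, B⟩ := unbracketed a b w.zipIdx
  cases B <;> grind [bracketStep]

/-- A new letter `a` is the one that changes if there is no letter `b` left for its bracket. In all
other cases a new letter has no influence. -/
theorem lower_append {a b : ℕ} (hab : a ≠ b) (w : List ℕ) (x : ℕ) :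
    lower a b (w ++ [x]) = if x = a ∧ eps a b w = 0 then some (w ++ [b])
      else (lower a b w).map (· ++ [x]) := by
  unfold lower eps
  rw [unbracketed_zipIdx_append]
  have h := @lt_length_of_mem_unbracketed a b w
  rcases hU : unbracketed a b w.zipIdx with ⟨A, B⟩
  simp only [hU] at h
  have key : A.head?.map (fun p => (w ++ [x]).set p b) =
      (A.head?.map (fun p => w.set p b)).map (· ++ [x]) := by
    cases A with
    | nil => rfl
    | cons p A => simp [List.set_append_left _ _ (h (p := p) (by simp))]
  unfold bracketStep
  simp only
  rcases eq_or_ne x b with rfl | hb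
  · simp only [if_true, hab.symm, false_and, if_false]
    exact key
  · simp only [hb, if_false]
    rcases eq_or_ne x a with rfl | ha
    · cases B with
      | nil => simp
      | cons p B =>
        simp only [if_true, List.length_cons, Nat.succ_ne_zero, and_false, if_false]
        exact key
    · simp only [ha, if_false, false_and]
      exact key

/-- A new letter `b` is the one that changes if it is the only unbracketed one. A new letter `a`
brackets the last unbracketed `b`, so it matters only if there are no others. -/
theorem raise_append {a b : ℕ} (hab : a ≠ b) (w : List ℕ) (x : ℕ) :
    raise a b (w ++ [x]) = if x = b ∧ eps a b w = 0 then some (w ++ [a])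
      else if x = a ∧ eps a b w ≤ 1 then none else (raise a b w).map (· ++ [x]) := by
  unfold raise eps
  rw [unbracketed_zipIdx_append]
  have h := @lt_length_of_mem_unbracketed a b w
  rcases hU : unbracketed a b w.zipIdx with ⟨A, B⟩
  simp only [hU] at h
  have key : B.getLast?.map (fun p => (w ++ [x]).set p a) =
      (B.getLast?.map (fun p => w.set p a)).map (· ++ [x]) := by
    rcases List.eq_nil_or_concat B with rfl | ⟨B, p, rfl⟩
    · rfl
    · simp [List.set_append_left _ _ (h (p := p) (by simp))]
  unfold bracketStep
  simp only
  rcases eq_or_ne x b with rfl | hb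
  · simp only [if_true, hab.symm, false_and, if_false]
    cases B with
    | nil => simp
    | cons p B =>
      simp only [List.length_cons, Nat.succ_ne_zero, and_false, if_false]
      exact key
  · simp only [hb, if_false, false_and]
    rcases eq_or_ne x a with rfl | ha
    · cases B with
      | nil => simp
      | cons p B =>
        cases B with
        | nil => simp
        | cons q B => simpa using key
    · simp only [ha, if_false, false_and]
      exact key

theorem lower_eq_none_iff {a b : ℕ} {w : List ℕ} : lower a b w = none ↔ phi a b w = 0 := by
  simp [lower, phi]

theorem raise_eq_none_iff {a b : ℕ} {w : List ℕ} : raise a b w = none ↔ eps a b w = 0 := by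
  simp [raise, eps]

theorem raise_of_lower {a b : ℕ} (hab : a ≠ b) {w w' : List ℕ} (h : lower a b w = some w') :
    raise a b w' = some w ∧ phi a b w' + 1 = phi a b w ∧ eps a b w' = eps a b w + 1 := by
  induction w using List.reverseRecOn generalizing w' with
  | nil => simp [lower, unbracketed] at h
  | append_singleton w x ih =>
    rw [lower_append hab] at h
    split_ifs at h with h1
    · obtain rfl := Option.some.inj h
      obtain ⟨rfl, h1⟩ := h1
      simp [raise_append hab, phi_append hab, eps_append, h1, hab, hab.symm]
    · obtain ⟨w₀, h2, rfl⟩ := Option.map_eq_some_iff.1 h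
      obtain ⟨h3, h4, h5⟩ := ih h2
      rw [raise_append hab, phi_append hab, eps_append, phi_append hab, eps_append, h3, h5,
        ← h4]
      refine ⟨?_, ?_, ?_⟩
      · rw [if_neg (by omega), if_neg]
        · rfl
        · rintro ⟨h6, h7⟩
          exact h1 ⟨h6, by omega⟩
      · rw [if_neg (by omega), if_neg h1]
      · split_ifs with h6 h7
        · rfl
        · have : eps a b w ≠ 0 := fun h8 => h1 ⟨h7, h8⟩
          omega
        · rfl

theorem lower_of_raise {a b : ℕ} (hab : a ≠ b) {w w' : List ℕ} (h : raise a b w = some w') :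
    lower a b w' = some w ∧ eps a b w' + 1 = eps a b w := by
  induction w using List.reverseRecOn generalizing w' with
  | nil => simp [raise, unbracketed] at h
  | append_singleton w x ih =>
    rw [raise_append hab] at h
    split_ifs at h with h1 h1'
    · obtain rfl := Option.some.inj h
      obtain ⟨rfl, h1⟩ := h1
      simp [lower_append hab, eps_append, h1, hab]
    · obtain ⟨w₀, h2, rfl⟩ := Option.map_eq_some_iff.1 h
      obtain ⟨h3, h4⟩ := ih h2
      rw [lower_append hab, eps_append, eps_append, h3, ← h4]
      refine ⟨?_, ?_⟩
      · rw [if_neg]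
        · rfl
        · rintro ⟨h6, h7⟩
          exact h1' ⟨h6, by omega⟩
      · split_ifs with h6 h7
        · rfl
        · have : ¬ eps a b w ≤ 1 := fun h8 => h1' ⟨h7, h8⟩
          omega
        · rfl

theorem lower_eq_some_iff {a b : ℕ} (hab : a ≠ b) {w w' : List ℕ} :
    lower a b w = some w' ↔ raise a b w' = some w :=
  ⟨fun h => (raise_of_lower hab h).1, fun h => (lower_of_raise hab h).1⟩

/-- The operators depend only on the positions of the letters `a` and `b`. -/
theorem lower_map {f : ℕ → ℕ} (hf : f.Injective) {a b : ℕ} (hab : a ≠ b) (w : List ℕ) :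
    lower (f a) (f b) (w.map f) = (lower a b w).map (List.map f) ∧
      eps (f a) (f b) (w.map f) = eps a b w := by
  have hab' : f a ≠ f b := hf.ne hab
  induction w using List.reverseRecOn with
  | nil => simp [lower, eps, unbracketed]
  | append_singleton w x ih =>
    rw [List.map_append, List.map_singleton, lower_append hab', lower_append hab,
      eps_append, eps_append, ih.1, ih.2]
    simp only [hf.eq_iff, and_true]
    split_ifs
    · simp
    · cases lower a b w <;> simp

theorem raise_map {f : ℕ → ℕ} (hf : f.Injective) {a b : ℕ} (hab : a ≠ b) (w : List ℕ) :
    raise (f a) (f b) (w.map f) = (raise a b w).map (List.map f) := by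
  have hab' : f a ≠ f b := hf.ne hab
  induction w using List.reverseRecOn with
  | nil => simp [raise, unbracketed]
  | append_singleton w x ih =>
    rw [List.map_append, List.map_singleton, raise_append hab', raise_append hab, ih,
      (lower_map hf hab w).2]
    simp only [hf.eq_iff]
    split_ifs
    · simp
    · rfl
    · cases raise a b w <;> simp

theorem exists_eq_of_lower {a b : ℕ} (hab : a ≠ b) {w w' : List ℕ} (h : lower a b w = some w') :
    ∃ u v, w = u ++ a :: v ∧ w' = u ++ b :: v := by
  induction w using List.reverseRecOn generalizing w' with
  | nil => simp [lower, unbracketed] at h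
  | append_singleton w x ih =>
    rw [lower_append hab] at h
    split_ifs at h with h1
    · obtain rfl := Option.some.inj h
      obtain ⟨rfl, h1⟩ := h1
      exact ⟨w, [], rfl, rfl⟩
    · obtain ⟨w₀, h2, rfl⟩ := Option.map_eq_some_iff.1 h
      obtain ⟨u, v, rfl, rfl⟩ := ih h2
      exact ⟨u, v ++ [x], by simp, by simp⟩

/-! ### The crystal operators on two adjacent horizontal strips -/

/-- The heights that decide about the bracketing of a reading word. The row `t` contains `m t - l t`
letters `i` and `q t - n t` letters `j`. The height of row `t` is the number of the letters `j` in the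
rows `0, …, t` minus the number of the letters `i` in the rows above row `t`. So the height of the
word before the letters `j` of row `t` (the number of letters `i` minus the number of letters `j`
read so far) differs from it by a constant. -/
def height (l m n q : ℕ → ℕ) : ℕ → ℤ
  | 0 => (q 0 : ℤ) - n 0
  | t + 1 => height l m n q t + ((q (t + 1) : ℤ) - n (t + 1)) - ((m t : ℤ) - l t)

/-- `r` is the lowest row where `K` is maximal. The operator `f_i` acts on the last `i` of
this row. -/
def LowestMax (K : ℕ → ℤ) (r : ℕ) : Prop := (∀ t, r < t → K t < K r) ∧ ∀ t, t < r → K t ≤ K r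

/-- `r` is the topmost row where `K` is maximal. The operator `e_i` acts on the first `j` of
this row. -/
def TopmostMax (K : ℕ → ℤ) (r : ℕ) : Prop := (∀ t, t < r → K t < K r) ∧ ∀ t, r < t → K t ≤ K r

/-- The row lengths `l ⊆ m ⊆ q` differ by two horizontal strips. -/
structure TwoStrips (l m q : ℕ → ℕ) : Prop where
  lm : ∀ t, l t ≤ m t
  mq : ∀ t, m t ≤ q t
  horizontal_lm : ∀ t, m (t + 1) ≤ l t
  horizontal_mq : ∀ t, q (t + 1) ≤ m t

/-- The row of the new box for the diagram with the row lengths `m`, if `s` is its row for the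
diagram with the row lengths `l`, and `m / l` is a horizontal strip. -/
def bumpRow (l m : ℕ → ℕ) (s : ℕ) : ℕ := if l s < m s then s + 1 else s

/-- Row lengths after a box is added to row `s`. -/
def addRow (l : ℕ → ℕ) (s t : ℕ) : ℕ := l t + if t = s then 1 else 0

/-- The local rules for a box that enters in row `s` change at most one height, by one. -/
theorem height_bump {l m q : ℕ → ℕ} (h : TwoStrips l m q) (s j : ℕ) :
    height (addRow l s) (addRow m (bumpRow l m s)) (addRow m (bumpRow l m s))
        (addRow q (bumpRow m q (bumpRow l m s))) j =
      height l m m q j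
        + (if j = s + 1 ∧ l s < m s ∧ q (s + 1) = m (s + 1) then 1 else 0)
        - (if j = s ∧ l s = m s ∧ m s < q s then 1 else 0) := by
  have h1 := h.lm s
  have h2 := h.mq s
  have h3 := h.mq (s + 1)
  have key : ∀ u v, (u = if l s < m s then s + 1 else s) → (v = if m u < q u then u + 1 else u) →
      height (addRow l s) (addRow m u) (addRow m u) (addRow q v) j =
      height l m m q j + (if j = s + 1 ∧ l s < m s ∧ q (s + 1) = m (s + 1) then 1 else 0)
        - (if j = s ∧ l s = m s ∧ m s < q s then 1 else 0) := by
    intro u v hu hv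
    induction j with
    | zero =>
      simp only [height, addRow]
      grind
    | succ j ih =>
      rw [height, height, ih]
      simp only [addRow]
      by_cases c1 : l s < m s
      · rw [if_pos c1] at hu
        subst hu
        grind
      · rw [if_neg c1] at hu
        subst hu
        grind
  exact key _ _ rfl rfl

/-- The insertion of a letter `i` decreases the heights by one, except the height of the top row if
the new letter bumps no letter `j`. -/
theorem height_start_low {l m q : ℕ → ℕ} (h : TwoStrips l m q) (j : ℕ) :
    height l (addRow m 0) (addRow m 0) (addRow q (bumpRow m q 0)) j =
      height l m m q j - 1 + if j = 0 ∧ q 0 = m 0 then 1 else 0 := by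
  have h2 := h.mq 0
  unfold bumpRow
  induction j with
  | zero =>
    simp only [height, addRow]
    grind
  | succ j ih =>
    rw [height, height, ih]
    simp only [addRow]
    grind

/-- The insertion of a letter `j` increases all heights by one. -/
theorem height_start_high (l m q : ℕ → ℕ) (j : ℕ) :
    height l m m (addRow q 0) j = height l m m q j + 1 := by
  induction j with
  | zero =>
    simp only [height, addRow]
    grind
  | succ j ih =>
    rw [height, height, ih]
    simp only [addRow]
    grind

/-- The row lengths of the middle diagram after `f_i` if `r` is the row of the box that
changes its letter. -/
def Lowered (m m' : ℕ → ℕ) (r : ℕ) : Prop := ∀ t, m t = m' t + if t = r then 1 else 0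

/-- The row below the lowest one of maximal height has fewer letters `j` than the row itself has
letters `i`. -/
theorem LowestMax.lt {l m n q : ℕ → ℕ} {r : ℕ} (h : LowestMax (height l m n q) r) :
    (q (r + 1) : ℤ) - n (r + 1) < m r - l r := by
  have := h.1 (r + 1) (by omega)
  rw [height] at this
  omega

/-- `f_i` commutes with the bumps in two adjacent rows of letters. -/
theorem LowestMax.bump {l m m' q : ℕ → ℕ} {r : ℕ} (h : TwoStrips l m q)
    (hr : LowestMax (height l m m q) r) (hm : Lowered m m' r) (s : ℕ) :
    bumpRow m' q (bumpRow l m' s) = bumpRow m q (bumpRow l m s) ∧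
    ∃ r', LowestMax (height (addRow l s) (addRow m (bumpRow l m s)) (addRow m (bumpRow l m s))
        (addRow q (bumpRow m q (bumpRow l m s)))) r' ∧
      Lowered (addRow m (bumpRow l m s)) (addRow m' (bumpRow l m' s)) r' := by
  have hlt := hr.lt
  have hmr := hm r
  have hms := hm s
  have hms' := hm (s + 1)
  have h0 := h.mq r
  have h0' := h.lm r
  have h1 := h.lm s
  have h2 := h.mq s
  have h3 := h.mq (s + 1)
  have h4 := h.mq (r + 1)
  have h5 := h.lm (s + 1)
  have hup : ∀ t, r = t + 1 → (m t : ℤ) - l t ≤ q r - m r := by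
    rintro t rfl
    have := hr.2 t (by omega)
    rw [height] at this
    omega
  have hup' := hup s
  simp only [if_true] at hmr
  constructor
  · unfold bumpRow
    grind
  · refine ⟨if s = r ∧ m r = l r + 1 then r + 1 else r, ?_, ?_⟩
    · have key := height_bump h s
      have hs1 : height l m m q (s + 1) = height l m m q s + ((q (s + 1) : ℤ) - m (s + 1)) -
        ((m s : ℤ) - l s) := rfl
      obtain ⟨hr1, hr2⟩ := hr
      have k1 := hr1 s
      have k2 := hr2 s
      have k3 := hr1 (s + 1)
      have k4 := hr2 (s + 1)
      constructor
      · intro t ht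
        have k5 := hr1 t
        have k6 := hr2 t
        rw [key, key]
        by_cases c1 : s = r
        · subst c1
          by_cases c2 : m s = l s + 1
          · simp only [c2] at ht ⊢
            grind
          · simp only [c2] at ht ⊢
            grind
        · simp only [c1] at ht ⊢
          by_cases c2 : l s < m s <;> grind
      · intro t ht
        have k5 := hr1 t
        have k6 := hr2 t
        rw [key, key]
        by_cases c1 : s = r
        · subst c1
          by_cases c2 : m s = l s + 1
          · simp only [c2] at ht ⊢
            grind
          · simp only [c2] at ht ⊢
            grind
        · simp only [c1] at ht ⊢
          by_cases c2 : l s < m s <;> grind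
    · intro t
      have := hm t
      unfold bumpRow addRow
      grind

/-- The operator `f_i` commutes with the insertion of a letter `i` that gets bracketed. -/
theorem LowestMax.start_low {l m m' q : ℕ → ℕ} {r : ℕ} (h : TwoStrips l m q)
    (hr : LowestMax (height l m m q) r) (hm : Lowered m m' r) (hpos : 0 < height l m m q r) :
    bumpRow m' q 0 = bumpRow m q 0 ∧
    LowestMax (height l (addRow m 0) (addRow m 0) (addRow q (bumpRow m q 0))) r ∧
      Lowered (addRow m 0) (addRow m' 0) r := by
  have hm0 := hm 0
  have h2 := h.mq 0
  have h00 : height l m m q 0 = (q 0 : ℤ) - m 0 := rfl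
  refine ⟨?_, ?_, ?_⟩
  · unfold bumpRow
    grind
  · have key := height_start_low h
    obtain ⟨hr1, hr2⟩ := hr
    constructor
    · intro t ht
      have k5 := hr1 t
      rw [key, key]
      grind
    · intro t ht
      have k5 := hr2 t
      rw [key, key]
      grind
  · intro t
    have := hm t
    unfold addRow
    grind

theorem LowestMax.start_high {l m q : ℕ → ℕ} {r : ℕ} (hr : LowestMax (height l m m q) r) :
    LowestMax (height l m m (addRow q 0)) r := by
  obtain ⟨hr1, hr2⟩ := hr
  constructor
  · intro t ht
    rw [height_start_high, height_start_high]
    have := hr1 t ht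
    omega
  · intro t ht
    rw [height_start_high, height_start_high]
    have := hr2 t ht
    omega

/-- If all letters `j` are bracketed, then `f_i` changes a new letter `i`. -/
theorem lowestMax_start {l m q : ℕ → ℕ} (h : TwoStrips l m q) (h0 : ∀ t, height l m m q t ≤ 0) :
    bumpRow m q 0 = 0 ∧
    LowestMax (height l (addRow m 0) (addRow m 0) (addRow q (bumpRow m q 0))) 0 := by
  have h2 := h.mq 0
  have h00 : height l m m q 0 = (q 0 : ℤ) - m 0 := rfl
  have h3 := h0 0
  refine ⟨?_, ?_⟩
  · unfold bumpRow
    grind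
  · have key := height_start_low h
    constructor
    · intro t ht
      have k5 := h0 t
      rw [key, key]
      grind
    · intro t ht
      omega

/-- The heights `K` belong to a word with `e` unbracketed letters `j` and `f` unbracketed
letters `i`. -/
structure HeightsOf (K : ℕ → ℤ) (e f : ℕ) : Prop where
  le : ∀ t, K t ≤ e
  attained : ∃ t, K t = e
  limit : ∃ N, ∀ t, N ≤ t → K t = e - f

/-- The local rules for smaller letters preserve the numbers of unbracketed letters. -/
theorem HeightsOf.bump {l m q : ℕ → ℕ} (h : TwoStrips l m q) {e f : ℕ}
    (hK : HeightsOf (height l m m q) e f) (s : ℕ) :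
    HeightsOf (height (addRow l s) (addRow m (bumpRow l m s)) (addRow m (bumpRow l m s))
        (addRow q (bumpRow m q (bumpRow l m s)))) e f := by
  have key := height_bump h s
  have hs1 : height l m m q (s + 1) = height l m m q s + ((q (s + 1) : ℤ) - m (s + 1)) -
        ((m s : ℤ) - l s) := rfl
  have h1 := h.lm s
  have h3 := h.mq (s + 1)
  obtain ⟨k1, ⟨t, k2⟩, N, k3⟩ := hK
  refine ⟨?_, ?_, N + s + 2, ?_⟩
  · intro j
    have := k1 j
    have := k1 s
    rw [key]
    grind
  · have a1 := k1 s
    have a2 := k1 (s + 1)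
    by_cases h4 : t = s
    · refine ⟨if l s = m s ∧ m s < q s then s + 1 else s, ?_⟩
      rw [key]
      grind
    · refine ⟨t, ?_⟩
      rw [key]
      grind
  · intro j hj
    have := k3 j (by omega)
    rw [key]
    grind

/-- A new letter `i` either brackets a letter `j` or is unbracketed, according to whether `e` is
zero. The subtraction `e - 1` truncates. -/
theorem HeightsOf.start_low {l m q : ℕ → ℕ} (h : TwoStrips l m q) {e f : ℕ}
    (hK : HeightsOf (height l m m q) e f) :
    HeightsOf (height l (addRow m 0) (addRow m 0) (addRow q (bumpRow m q 0))) (e - 1)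
      (f + if e = 0 then 1 else 0) := by
  have key := height_start_low h
  have h00 : height l m m q 0 = (q 0 : ℤ) - m 0 := rfl
  have h3 := h.mq 0
  obtain ⟨k1, ⟨t, k2⟩, N, k3⟩ := hK
  have k4 := k1 0
  refine ⟨?_, ⟨if e = 0 then 0 else t, ?_⟩, N + 1, ?_⟩
  · intro j
    have := k1 j
    rw [key]
    grind
  · rw [key]
    grind
  · intro j hj
    have := k3 j (by omega)
    rw [key]
    grind

theorem HeightsOf.start_high {l m q : ℕ → ℕ} {e f : ℕ} (hK : HeightsOf (height l m m q) e f) :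
    HeightsOf (height l m m (addRow q 0)) (e + 1) f := by
  obtain ⟨k1, ⟨t, k2⟩, N, k3⟩ := hK
  refine ⟨fun j => ?_, ⟨t, ?_⟩, N, fun j hj => ?_⟩
  · rw [height_start_high]
    have := k1 j
    omega
  · rw [height_start_high]
    omega
  · rw [height_start_high]
    have := k3 j hj
    omega

/-! ### Insertion commutes with the usual crystal operators -/

theorem IsChain.rowLen_insertChain {τ : ℕ → Bool} {Λ : ℕ → YoungDiagram} (hΛ : IsChain τ Λ)
    {x a : ℕ} (h : x ≤ a) :
    (PrimedCrystal.insertChain τ Λ x a).rowLen = addRow (Λ a).rowLen (newBox τ Λ x a).1 := by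
  rw [insertChain_of_le _ _ h]
  exact funext (hΛ.addable_newBox h).rowLen_addBox

theorem IsChain.newBox_succ_fst {τ : ℕ → Bool} {Λ : ℕ → YoungDiagram} (hΛ : IsChain τ Λ)
    {x a : ℕ} (h : x ≤ a) (hτ : τ (a + 1) = true) :
    (newBox τ Λ x (a + 1)).1 = bumpRow (Λ a).rowLen (Λ (a + 1)).rowLen (newBox τ Λ x a).1 := by
  have h1 := hΛ.addable_newBox h
  rw [newBox_succ _ _ h, hτ]
  generalize newBox τ Λ x a = b at h1 ⊢
  obtain ⟨r, c⟩ := b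
  obtain ⟨h1, -⟩ := h1
  simp only at h1
  subst h1
  simp only [bumpBox, bumpRow, YoungDiagram.mem_iff_lt_rowLen, if_true]
  split_ifs <;> rfl

theorem Addable.eq_of_fst_eq {μ : YoungDiagram} {b b' : ℕ × ℕ} (h : Addable μ b)
    (h' : Addable μ b') (e : b.1 = b'.1) : b = b' := by
  ext
  · exact e
  · rw [← h.1, ← h'.1, e]

theorem IsChain.twoStrips {τ : ℕ → Bool} {Λ : ℕ → YoungDiagram} (hΛ : IsChain τ Λ) {n : ℕ}
    (h1 : τ (n + 1) = true) (h2 : τ (n + 2) = true) :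
    TwoStrips (Λ n).rowLen (Λ (n + 1)).rowLen (Λ (n + 2)).rowLen := by
  have s1 := hΛ.strip n
  have s2 := hΛ.strip (n + 1)
  rw [h1, strip_true_iff] at s1
  rw [h2, strip_true_iff] at s2
  exact ⟨s1.1, s2.1, s1.2, s2.2⟩

/-- The heights of a tableau for the letters `n + 1` and `n + 2`, if both of them fill
horizontal strips. -/
def heightAt (Λ : ℕ → YoungDiagram) (n : ℕ) : ℕ → ℤ :=
  height (Λ n).rowLen (Λ (n + 1)).rowLen (Λ (n + 1)).rowLen (Λ (n + 2)).rowLen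

/-- The tableau `Λ'` arises from `Λ` by the usual crystal operator for the letters `n + 1` and
`n + 2`, if both of them fill horizontal strips. -/
def LoweredChain (n : ℕ) (Λ Λ' : ℕ → YoungDiagram) : Prop :=
  (∀ a, a ≠ n + 1 → Λ' a = Λ a) ∧
    ∃ r, LowestMax (heightAt Λ n) r ∧ Lowered (Λ (n + 1)).rowLen (Λ' (n + 1)).rowLen r

/-- The usual crystal operator commutes with an insertion that does not insert a new unbracketed
letter `n + 1`. -/
theorem LoweredChain.insertChain {τ : ℕ → Bool} {Λ Λ' : ℕ → YoungDiagram} {n x : ℕ}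
    (h : LoweredChain n Λ Λ') (hΛ : IsChain τ Λ) (hΛ' : IsChain τ Λ')
    (h1 : τ (n + 1) = true) (h2 : τ (n + 2) = true)
    (hx : x = n + 1 → ∃ t, 0 < heightAt Λ n t) :
    LoweredChain n (insertChain τ Λ x) (insertChain τ Λ' x) := by
  obtain ⟨he, r, hr, hm⟩ := h
  have hs := hΛ.twoStrips h1 h2
  have below : ∀ a, a ≤ n → x ≤ a → newBox τ Λ x a = newBox τ Λ' x a := fun a ha _ =>
    newBox_congr fun b hb => ⟨(he b (by omega)).symm, rfl⟩
  -- equality of the new boxes propagates upwards from the level of the second strip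
  have above : ∀ {b}, n + 2 ≤ b → x ≤ b → (newBox τ Λ x b).1 = (newBox τ Λ' x b).1 →
      ∀ a, b ≤ a → newBox τ Λ x a = newBox τ Λ' x a := by
    intro b hb hxb e a ha
    refine newBox_eq_of_le (fun c hc => ⟨(he c (by omega)).symm, rfl⟩) hxb hxb ?_ ha
    have := hΛ'.addable_newBox hxb
    rw [he b (by omega)] at this
    exact (hΛ.addable_newBox hxb).eq_of_fst_eq this e
  have same : (∀ a, a ≠ n + 1 → x ≤ a → newBox τ Λ x a = newBox τ Λ' x a) →
      ∀ a, a ≠ n + 1 → PrimedCrystal.insertChain τ Λ' x a = PrimedCrystal.insertChain τ Λ x a := by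
    intro h3 a ha
    rcases Nat.lt_or_ge a x with h4 | h4
    · rw [insertChain_of_lt _ _ h4, insertChain_of_lt _ _ h4, he a ha]
    · rw [insertChain_of_le _ _ h4, insertChain_of_le _ _ h4, he a ha, h3 a ha h4]
  rcases Nat.lt_or_ge n x with hn | hn
  · rcases eq_or_ne x (n + 1) with rfl | hn1
    · obtain ⟨t, ht⟩ := hx rfl
      have hpos : 0 < heightAt Λ n r := by
        rcases Nat.lt_trichotomy t r with h3 | h3 | h3
        · have := hr.2 t h3
          omega
        · rwa [h3] at ht
        · have := hr.1 t h3
          omega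
      obtain ⟨h3, h4, h5⟩ := hr.start_low hs hm hpos
      have e1 : ∀ Λ : ℕ → YoungDiagram, (newBox τ Λ (n + 1) (n + 1)).1 = 0 := fun Λ => by
        rw [newBox_self, h1]
        rfl
      have e2 := hΛ.newBox_succ_fst (x := n + 1) le_rfl h2
      have e2' := hΛ'.newBox_succ_fst (x := n + 1) le_rfl h2
      rw [e1] at e2 e2'
      rw [he (n + 2) (by omega)] at e2'
      refine ⟨same fun a ha hxa => above le_rfl (by omega) ?_ a (by omega), r, ?_, ?_⟩
      · rw [e2, e2', h3]
      · unfold heightAt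
        rw [insertChain_of_lt _ _ (by omega), hΛ.rowLen_insertChain le_rfl,
          hΛ.rowLen_insertChain (by omega), e2, e1]
        exact h4
      · rw [hΛ.rowLen_insertChain le_rfl, hΛ'.rowLen_insertChain le_rfl, e1, e1]
        exact h5
    · rcases eq_or_ne x (n + 2) with rfl | hn2
      · have e1 : ∀ Λ : ℕ → YoungDiagram, (newBox τ Λ (n + 2) (n + 2)).1 = 0 := fun Λ => by
          rw [newBox_self, h2]
          rfl
        refine ⟨same fun a ha hxa => above le_rfl (by omega) ?_ a (by omega), r, ?_, ?_⟩
        · rw [e1, e1]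
        · unfold heightAt
          rw [insertChain_of_lt _ _ (by omega), insertChain_of_lt _ _ (by omega),
            hΛ.rowLen_insertChain le_rfl, e1]
          exact hr.start_high
        · rw [insertChain_of_lt _ _ (by omega), insertChain_of_lt _ _ (by omega)]
          exact hm
      · refine ⟨same fun a ha hxa => above (b := x) (by omega) (by omega) ?_ a (by omega), r, ?_, ?_⟩
        · rw [newBox_self, newBox_self, he x hn1]
        · unfold heightAt
          rw [insertChain_of_lt _ _ (by omega), insertChain_of_lt _ _ (by omega),
            insertChain_of_lt _ _ (by omega)]
          exact hr
        · rw [insertChain_of_lt _ _ (by omega), insertChain_of_lt _ _ (by omega)]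
          exact hm
  · obtain ⟨h3, r', h4, h5⟩ := hr.bump hs hm (newBox τ Λ x n).1
    have e1 := hΛ.newBox_succ_fst hn h1
    have e1' := hΛ'.newBox_succ_fst hn h1
    have e2 := hΛ.newBox_succ_fst (show x ≤ n + 1 by omega) h2
    have e2' := hΛ'.newBox_succ_fst (show x ≤ n + 1 by omega) h2
    rw [he n (by omega), ← below n le_rfl hn] at e1'
    rw [he (n + 2) (by omega), e1'] at e2'
    rw [e1] at e2
    refine ⟨same fun a ha hxa => ?_, r', ?_, ?_⟩
    · rcases Nat.lt_or_ge n a with h6 | h6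
      · refine above (b := n + 2) le_rfl (by omega) ?_ a (by omega)
        rw [e2, e2', h3]
      · exact below a h6 hxa
    · unfold heightAt
      rw [hΛ.rowLen_insertChain hn, hΛ.rowLen_insertChain (by omega),
        hΛ.rowLen_insertChain (by omega), e2, e1]
      exact h4
    · rw [hΛ.rowLen_insertChain (by omega), hΛ'.rowLen_insertChain (by omega), e1, e1']
      exact h5

/-- If all letters `n + 2` are bracketed, then the usual crystal operator changes the new letter:
the insertion of `n + 1` becomes that of `n + 2`. -/
theorem loweredChain_start {τ : ℕ → Bool} {Λ : ℕ → YoungDiagram} {n : ℕ} (hΛ : IsChain τ Λ)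
    (h1 : τ (n + 1) = true) (h2 : τ (n + 2) = true) (h0 : ∀ t, heightAt Λ n t ≤ 0) :
    LoweredChain n (insertChain τ Λ (n + 1)) (insertChain τ Λ (n + 2)) := by
  have hs := hΛ.twoStrips h1 h2
  obtain ⟨h3, h4⟩ := lowestMax_start hs h0
  have e1 : (newBox τ Λ (n + 1) (n + 1)).1 = 0 := by
    rw [newBox_self, h1]
    rfl
  have e2 : (newBox τ Λ (n + 2) (n + 2)).1 = 0 := by
    rw [newBox_self, h2]
    rfl
  have e3 := hΛ.newBox_succ_fst (x := n + 1) le_rfl h2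
  rw [e1] at e3
  have e4 : newBox τ Λ (n + 1) (n + 2) = newBox τ Λ (n + 2) (n + 2) := by
    apply (hΛ.addable_newBox (by omega)).eq_of_fst_eq (hΛ.addable_newBox le_rfl)
    rw [e2, e3, h3]
  refine ⟨fun a ha => ?_, 0, ?_, ?_⟩
  · rcases Nat.lt_or_ge a (n + 1) with h5 | h5
    · rw [insertChain_of_lt _ _ (by omega), insertChain_of_lt _ _ h5]
    · rw [insertChain_of_le _ _ (by omega), insertChain_of_le _ _ (by omega),
        newBox_eq_of_le (fun c _ => ⟨rfl, rfl⟩) (by omega) le_rfl e4 (by omega)]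
  · unfold heightAt
    rw [insertChain_of_lt _ _ (by omega), hΛ.rowLen_insertChain le_rfl,
      hΛ.rowLen_insertChain (by omega), e1, e3]
    exact h4
  · rw [insertChain_of_lt (x := n + 2) _ _ (by omega), hΛ.rowLen_insertChain le_rfl, e1]
    intro t
    rfl

theorem rowLen_bot : (⊥ : YoungDiagram).rowLen = fun _ => 0 := by
  funext t
  by_contra h
  have := YoungDiagram.mem_iff_lt_rowLen.2 (Nat.pos_of_ne_zero h)
  simp at this

/-- The bracketing of a word and the heights of its insertion tableau give the same numbers of
unbracketed letters. -/
theorem heightsOf_growth {τ : ℕ → Bool} {n : ℕ} (h1 : τ (n + 1) = true) (h2 : τ (n + 2) = true)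
    {w : List ℕ} (hw : ∀ x ∈ w, 1 ≤ x) :
    HeightsOf (heightAt (growth τ w) n) (eps (n + 1) (n + 2) w) (phi (n + 1) (n + 2) w) := by
  induction w using List.reverseRecOn with
  | nil =>
    have : heightAt (growth τ []) n = fun _ => 0 := by
      funext t
      simp only [heightAt, growth, List.foldl_nil, rowLen_bot]
      induction t with
      | zero => simp [height]
      | succ t ih => simp [height, ih]
    rw [this]
    refine ⟨?_, ?_, ?_⟩ <;> simp [eps, phi, unbracketed]
  | append_singleton w x ih =>
    have hw' : ∀ y ∈ w, 1 ≤ y := fun y hy => hw y (by simp [hy])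
    have ih := ih hw'
    have hΛ := isChain_growth τ hw'
    have hs := hΛ.twoStrips h1 h2
    rw [growth_append, phi_append (show n + 1 ≠ n + 2 by omega), eps_append]
    generalize growth τ w = Λ at ih hΛ hs
    rcases Nat.lt_or_ge n x with hn | hn
    · rcases eq_or_ne x (n + 1) with rfl | hn1
      · have e1 : (newBox τ Λ (n + 1) (n + 1)).1 = 0 := by
          rw [newBox_self, h1]
          rfl
        have e3 := hΛ.newBox_succ_fst (x := n + 1) le_rfl h2
        rw [e1] at e3
        unfold heightAt
        rw [insertChain_of_lt _ _ (by omega), hΛ.rowLen_insertChain le_rfl,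
          hΛ.rowLen_insertChain (by omega), e1, e3]
        simpa using ih.start_low hs
      · rcases eq_or_ne x (n + 2) with rfl | hn2
        · have e2 : (newBox τ Λ (n + 2) (n + 2)).1 = 0 := by
            rw [newBox_self, h2]
            rfl
          unfold heightAt
          rw [insertChain_of_lt _ _ (by omega), insertChain_of_lt _ _ (by omega),
            hΛ.rowLen_insertChain le_rfl, e2]
          simpa using ih.start_high
        · unfold heightAt
          rw [insertChain_of_lt _ _ (by omega), insertChain_of_lt _ _ (by omega),
            insertChain_of_lt _ _ (by omega), if_neg hn2, if_neg hn1, if_neg (by omega)]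
          exact ih
    · unfold heightAt
      rw [hΛ.rowLen_insertChain hn, hΛ.rowLen_insertChain (by omega),
        hΛ.rowLen_insertChain (by omega), hΛ.newBox_succ_fst (show x ≤ n + 1 by omega) h2,
        hΛ.newBox_succ_fst hn h1, if_neg (by omega), if_neg (by omega), if_neg (by omega)]
      exact ih.bump hs _

theorem forall_mem_of_lower {a b : ℕ} (hab : a ≠ b) {w w' : List ℕ} (h : lower a b w = some w')
    {p : ℕ → Prop} (hb : p b) (hw : ∀ x ∈ w, p x) : ∀ x ∈ w', p x := by
  obtain ⟨u, v, rfl, rfl⟩ := exists_eq_of_lower hab h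
  intro x hx
  simp only [List.mem_append, List.mem_cons] at hx hw
  rcases hx with hx | rfl | hx
  · exact hw x (Or.inl hx)
  · exact hb
  · exact hw x (Or.inr (Or.inr hx))

/-- Insertion commutes with the usual crystal operators for two adjacent letters that fill
horizontal strips. -/
theorem loweredChain_growth {τ : ℕ → Bool} {n : ℕ} (h1 : τ (n + 1) = true) (h2 : τ (n + 2) = true)
    {w w' : List ℕ} (hw : ∀ x ∈ w, 1 ≤ x) (h : lower (n + 1) (n + 2) w = some w') :
    LoweredChain n (growth τ w) (growth τ w') := by
  induction w using List.reverseRecOn generalizing w' with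
  | nil => simp [lower, unbracketed] at h
  | append_singleton w x ih =>
    have hw' : ∀ y ∈ w, 1 ≤ y := fun y hy => hw y (by simp [hy])
    have hK := heightsOf_growth h1 h2 hw'
    rw [lower_append (by omega)] at h
    split_ifs at h with h3
    · obtain rfl := Option.some.inj h
      obtain ⟨rfl, h3⟩ := h3
      rw [growth_append, growth_append]
      apply loweredChain_start (isChain_growth τ hw') h1 h2
      intro t
      have := hK.le t
      omega
    · obtain ⟨w₀, h4, rfl⟩ := Option.map_eq_some_iff.1 h
      rw [growth_append, growth_append]
      apply (ih hw' h4).insertChain (isChain_growth τ hw')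
        (isChain_growth τ (forall_mem_of_lower (by omega) h4 (by omega) hw')) h1 h2
      intro h5
      obtain ⟨t, ht⟩ := hK.attained
      refine ⟨t, ?_⟩
      rw [ht]
      have : eps (n + 1) (n + 2) w ≠ 0 := fun h6 => h3 ⟨h5, h6⟩
      omega

/-! ### Crystal operators and switching -/

open Classical in
/-- Switching the letters `j'` and `j` moves a letter `j` from the bottom row to the top row of each
ribbon of the horizontal type. -/
theorem height_switch_right {l m u n q : ℕ → ℕ} {k : ℕ → Prop} (h : RowSwitch m u n q k) (t : ℕ) :
    height l m m u t = height l m n q t + if m t < q (t + 1) ∧ k t then 1 else 0 := by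
  obtain ⟨lm, mn, lp, pn, hlm, vmn, vlp, hpn, hr, ht0, hts, hb⟩ := h
  induction t with
  | zero =>
    have := lm 0
    have := mn 0
    have := lp 0
    have := pn 0
    have := hlm 0
    have := vmn 0
    have := vlp 0
    have := hpn 0
    have := hr 0
    have := hb 0
    simp only [height]
    grind
  | succ t ih =>
    rw [height, height, ih]
    have := lm (t + 1)
    have := mn (t + 1)
    have := lp (t + 1)
    have := pn (t + 1)
    have := hlm (t + 1)
    have := vmn (t + 1)
    have := vlp (t + 1)
    have := hpn (t + 1)
    have := hr t
    have := hr (t + 1)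
    have := hb (t + 1)
    have := hts t
    have := lp t
    have := pn t
    have := hlm t
    have := vlp t
    have := hpn t
    grind

open Classical in
/-- Switching the letters `i` and `j'` moves a letter `i` from the top row to the bottom row of each
ribbon of the horizontal type. -/
theorem height_switch_left {l m v n q : ℕ → ℕ} {k : ℕ → Prop} (h : RowSwitch l m v n k) (t : ℕ) :
    height v n n q t = height l m n q t + if ∃ s, t = s + 1 ∧ l s < n (s + 1) ∧ k s then 1 else 0 := by
  obtain ⟨lm, mn, lp, pn, hlm, vmn, vlp, hpn, hr, ht0, hts, hb⟩ := h
  induction t with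
  | zero =>
    simp [height]
  | succ t ih =>
    rw [height, height, ih]
    have e : (∃ s, t + 1 = s + 1 ∧ l s < n (s + 1) ∧ k s) ↔ l t < n (t + 1) ∧ k t :=
      ⟨fun ⟨s, h1, h2⟩ => by obtain rfl : t = s := by omega
                             exact h2, fun h => ⟨t, rfl, h⟩⟩
    simp only [e]
    have := lm t
    have := mn t
    have := lp t
    have := pn t
    have := hlm t
    have := vmn t
    have := vlp t
    have := hpn t
    have := hr t
    have := hb t
    rcases t with _ | t
    · simp only [Nat.zero_ne_add_one, false_and, exists_const, if_false]
      grind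
    · have e : (∃ s, t + 1 = s + 1 ∧ l s < n (s + 1) ∧ k s) ↔ l t < n (t + 1) ∧ k t :=
        ⟨fun ⟨s, h1, h2⟩ => by obtain rfl : t = s := by omega
                               exact h2, fun h => ⟨t, rfl, h⟩⟩
      simp only [e]
      have := hr t
      have := hts t
      have := vlp t
      have := hlm t
      have := hpn t
      have := pn t
      have := vmn t
      grind

/-- Switching the letters `j'` and `j` does not change the row in which `f_i` acts. -/
theorem LowestMax.switch_right {l m u n q : ℕ → ℕ} {k : ℕ → Prop} (h : RowSwitch m u n q k)
    (hs : TwoStrips l m u) {r : ℕ} (hr : LowestMax (height l m m u) r) :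
    LowestMax (height l m n q) r := by
  have key := fun t => height_switch_right (l := l) h t
  have h1 := hr.lt
  have h2 := hs.horizontal_lm r
  have h3 := h.horizontal_lm r
  have h4 := h.vertical_mn (r + 1)
  have h5 := h.lm (r + 1)
  -- a ribbon of the horizontal type cannot continue below row `r`
  have h6 : ¬ (m r < q (r + 1) ∧ k r) := by
    rintro ⟨h6, -⟩
    omega
  have hr0 := key r
  rw [if_neg h6] at hr0
  constructor
  · intro t ht
    have := hr.1 t ht
    have := key t
    split_ifs at this <;> omega
  · intro t ht
    have := hr.2 t ht
    have := key t
    split_ifs at this <;> omega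

/-- Switching the letters `i` and `j'` does not change the row in which `e_i` acts. -/
theorem TopmostMax.switch_left {l m v n q : ℕ → ℕ} {k : ℕ → Prop} (h : RowSwitch l m v n k)
    (hs : TwoStrips v n q) {r : ℕ} (hr : TopmostMax (height v n n q) r) :
    TopmostMax (height l m n q) r ∧ height l m n q r = height v n n q r := by
  have key := fun t => height_switch_left (q := q) h t
  have h6 : ¬ ∃ s, r = s + 1 ∧ l s < n (s + 1) ∧ k s := by
    rintro ⟨s, rfl, h6, -⟩
    have h7 := hr.1 s (by omega)
    rw [height] at h7
    have := hs.horizontal_mq s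
    have := h.vertical_lp s
    omega
  have hr0 := key r
  rw [if_neg h6] at hr0
  refine ⟨⟨?_, ?_⟩, by omega⟩
  · intro t ht
    have := hr.1 t ht
    have := key t
    split_ifs at this <;> omega
  · intro t ht
    have := hr.2 t ht
    have := key t
    split_ifs at this <;> omega

/-- The reverse of a step of `f_i` is a step of `e_i`. -/
theorem LowestMax.topmostMax {l m m' q : ℕ → ℕ} {r : ℕ} (hs : TwoStrips l m q)
    (hr : LowestMax (height l m m q) r) (hm : Lowered m m' r) :
    TopmostMax (height l m' m' q) r ∧ 0 < height l m' m' q r := by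
  have key : ∀ t, height l m' m' q t = height l m m q t +
      if t < r then 0 else if t = r then 1 else 2 := by
    intro t
    have := hm t
    induction t with
    | zero =>
      simp only [height]
      grind
    | succ t ih =>
      have h2 := hm t
      rw [height, height, ih h2]
      grind
  have h0 : 0 ≤ height l m m q r := by
    have h1 : height l m m q 0 = (q 0 : ℤ) - m 0 := rfl
    have h2 := hs.mq 0
    rcases Nat.eq_zero_or_pos r with h3 | h3
    · subst h3
      omega
    · have := hr.2 0 h3
      omega
  refine ⟨⟨?_, ?_⟩, ?_⟩
  · intro t ht
    have := hr.2 t ht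
    rw [key, key]
    grind
  · intro t ht
    have := hr.1 t ht
    rw [key, key]
    grind
  · rw [key]
    grind

/-- The second box of `f_i`, in terms of row lengths. The row `r` is the row of the box that
changes from `i` to `j` after the letters `j'` and `j` are switched, and the row `r'` that of the
second box of `f_i`. -/
theorem RowSwitch.lowered_right {l m m' u n n' q : ℕ → ℕ} {k k' : ℕ → Prop}
    (h : RowSwitch m u n q k) (h' : RowSwitch m' u n' q k') (hs : TwoStrips l m u) {r r' : ℕ}
    (hr : LowestMax (height l m m u) r) (hm : Lowered m m' r)
    (hrr : r ≤ r') (hconn : ∀ t, r ≤ t → t < r' → m' t < q (t + 1))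
    (hend : r' = r ∧ (n r = m r + 1 ∨ q (r + 1) ≤ m' r) ∨
      r < r' ∧ n r = m r ∧ q (r' + 1) ≤ m r') : Lowered n n' r' := by
  have a1 := hr.lt
  have a2 := hs.horizontal_lm r
  have a3 := h.horizontal_lm r
  have a4 := h.vertical_mn (r + 1)
  have a5 := h.lm (r + 1)
  have a6 := hm r
  have a7 := hs.lm r
  simp only [if_true] at a6
  have b1 := h.lm r
  have b2 := h.mn r
  have b3 := h.lp r
  have b4 := h.pn r
  have b5 := h.vertical_lp r
  have b6 := h.horizontal_pn r
  have b7 := h.bottom r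
  -- the ribbon below the box in row `r` is of the vertical type
  have hkS : m' r < q (r + 1) → q (r + 1) = m r ∧ ¬ k (r + 1) := by
    intro h1
    have h2 := h.top_succ r (by omega) (by omega)
    rw [← h2]
    omega
  have hk : ∀ t, r < t → t ≤ r' → ¬ k t := by
    intro t ht
    induction t, ht using Nat.le_induction with
    | base =>
      intro h1
      exact (hkS (hconn r le_rfl (by omega))).2
    | succ t ht ih =>
      intro h1
      have h2 := hconn t (by omega) (by omega)
      have h3 := hm t
      rw [if_neg (by omega)] at h3
      rw [← h.ribbon t (by omega)]
      exact ih (by omega)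
  have hbot : ∀ t, t = r' → r < r' → n t = m t + 1 := by
    rintro t rfl h1
    rcases hend with ⟨h2, -⟩ | ⟨-, h2, h3⟩
    · omega
    · have h4 := hconn (t - 1) (by omega) (by omega)
      rw [Nat.sub_add_cancel (by omega)] at h4
      have h6 := h.bottom t
      have h7 := h.lp t
      have h8 := h.vertical_lp t
      have h9 := hk t h1 le_rfl
      by_contra h10
      have h11 := hm (t - 1)
      have h12 : m t < q t := by
        have h13 := h.horizontal_lm (t - 1)
        have h14 := h.lm t
        have h15 := h.mn t
        rw [Nat.sub_add_cancel (by omega)] at h13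
        by_contra h16
        have h17 := hs.horizontal_lm (t - 1)
        have h18 := hs.lm (t - 1)
        rw [Nat.sub_add_cancel (by omega)] at h17
        by_cases h19 : t - 1 = r
        · rw [h19] at h17 h4
          omega
        · rw [if_neg h19] at h11
          omega
      exact h9 ((h6 h12 h3).1 (by omega))
  have hn' : 1 ≤ n r' := by
    rcases hend with ⟨rfl, h1⟩ | ⟨h1, h2, h3⟩
    · omega
    · have := hbot r' rfl h1
      omega
  -- the box that changes its letter extends or joins the ribbons to its right and below it; with the
  -- type of the ribbon to its right (the horizontal type if there is none) the following filling
  -- becomes a switched one, so uniqueness identifies it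
  have key : RowSwitch m' u (fun t => n t - if t = r' then 1 else 0) q
      (fun t => if r ≤ t ∧ t ≤ r' then (m r < q r → k r) else k t) := by
    obtain ⟨lm, mn, lp, pn, hlm, vmn, vlp, hpn, hrib, ht0, hts, hb⟩ := h
    obtain ⟨lm', mn', lp', pn', hlm', vmn', vlp', hpn', -, -, -, -⟩ := h'
    have hmt : ∀ t, m t = m' t + if t = r then 1 else 0 := hm
    refine ⟨lm', mn, ?_, ?_, hlm', vmn, ?_, ?_, ?_, ?_, ?_, ?_⟩
    · intro t
      have := hmt t
      have := lp t
      grind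
    · intro t
      have := pn t
      omega
    · intro t
      have := hmt t
      have := vlp t
      have := hbot t
      grind
    · intro t
      have := hmt t
      have := hpn t
      have := hbot t
      grind
    · intro t ht
      have := hmt t
      have := hrib t
      have := hconn t
      have := hk (t + 1)
      have := hk t
      grind
    · intro h1
      have := hmt 0
      have := ht0
      grind
    · intro t h1 h2
      have := hmt t
      have := hmt (t + 1)
      have := hts t
      have := hk (t + 1)
      have := hconn t
      grind
    · intro t h1 h2
      have := hmt t
      have := hb t
      have := hk t
      have := hconn t
      have := hbot t
      grind
  have := h'.unique_right key
  intro t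
  rw [this]
  simp only
  split_ifs with h1
  · subst h1
    omega
  · omega

set_option maxHeartbeats 1000000 in
/-- The second box of `e_i`, in terms of row lengths. The row `r` is the row of the box that
changes from `j` to `i` after the letters `i` and `j'` are switched, and the row `r'` that of the
second box of `e_i`. -/
theorem RowSwitch.lowered_left {l m m' v n n' q : ℕ → ℕ} {k k' : ℕ → Prop}
    (h : RowSwitch l m v n k) (h' : RowSwitch l m' v n' k') (hs : TwoStrips v n q) {r r' : ℕ}
    (hfin : ∃ N, ∀ t, N ≤ t → n' t = 0) (hr : TopmostMax (height v n n q) r) (hm : Lowered n' n r)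
    (hrr : r' ≤ r) (hconn : ∀ t, r' ≤ t → t < r → l t < n' (t + 1))
    (hend : r' = r ∧ (n r = m r + 1 ∨ ∀ s, r = s + 1 → n' r ≤ l s) ∨
      r' < r ∧ n r = m r ∧ ∀ s, r' = s + 1 → n r' ≤ l s) : Lowered m' m r' := by
  have hmt : ∀ t, n' t = n t + if t = r then 1 else 0 := hm
  have a6 := hmt r
  simp only [if_true] at a6
  -- the ribbon above the box in row `r` is of the vertical type
  have hkN : ∀ s, r = s + 1 → l s < n' r → n r = l s ∧ ¬ k s := by
    rintro s rfl h1
    have a1 := hr.1 s (by omega)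
    rw [height] at a1
    have a2 := hs.horizontal_mq s
    have a3 := h.horizontal_pn s
    have a4 := h.vertical_lp s
    have a5 := h.pn s
    have h2 := h.bottom s (by omega) (by omega)
    rw [← h2]
    omega
  have hk : ∀ d t, t + d + 1 = r → r' ≤ t → ¬ k t := by
    intro d
    induction d with
    | zero =>
      intro t ht h1
      have h2 := hconn t h1 (by omega)
      rw [ht] at h2
      exact (hkN t ht.symm h2).2
    | succ d ih =>
      intro t ht h1
      have h2 := hconn t h1 (by omega)
      have h3 := hmt (t + 1)
      rw [if_neg (by omega)] at h3
      rw [h.ribbon t (by omega)]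
      exact ih (t + 1) (by omega) (by omega)
  replace hk : ∀ t, r' ≤ t → t < r → ¬ k t := fun t h1 h2 =>
    hk (r - t - 1) t (by omega) h1
  -- row `r` is the top row of the ribbon to the left of the box
  have hkr : l r < n r → (m r = n r ↔ k r) := by
    intro h1
    rcases r with _ | s
    · exact h.top_zero h1
    · apply h.top_succ s h1
      by_contra h2
      have := hkN s rfl (by omega)
      omega
  have htop : ∀ t, t = r' → r' < r → n t = m t + 1 := by
    rintro t rfl h1
    rcases hend with ⟨h2, -⟩ | ⟨-, h2, h3⟩
    · omega
    · have h4 := hconn t le_rfl h1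
      have h5 := h'.horizontal_pn t
      have h6 := h.pn t
      have h7 := hk t le_rfl h1
      have h8 := h.mn t
      have h9 := h.vertical_mn t
      rcases t with _ | t
      · have h10 := h.top_zero (by omega)
        rw [← h10] at h7
        omega
      · have h10 := h.top_succ t (by omega) (h3 t rfl)
        rw [← h10] at h7
        omega
  -- the box that changes its letter extends or joins the ribbons to its left and above it; with the
  -- type of the ribbon to its left (the horizontal type if there is none) the following filling
  -- becomes a switched one, so uniqueness identifies it
  have key : RowSwitch l (fun t => m t + if t = r' then 1 else 0) v n'
      (fun t => if r' ≤ t ∧ t ≤ r then m r = n r else k t) := by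
    obtain ⟨lm, mn, lp, pn, hlm, vmn, vlp, hpn, hrib, ht0, hts, hb⟩ := h
    obtain ⟨lm', mn', lp', pn', hlm', vmn', vlp', hpn', -, -, -, -⟩ := h'
    refine ⟨?_, ?_, lp, pn', ?_, ?_, vlp, hpn', ?_, ?_, ?_, ?_⟩
    · intro t
      have := lm t
      omega
    · intro t
      have := hmt t
      have := mn t
      have := htop t
      grind
    · intro t
      have := hmt t
      have := hlm t
      have := htop (t + 1)
      have := mn (t + 1)
      grind
    · intro t
      have := hmt t
      have := vmn t
      have := htop t
      grind
    · intro t ht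
      have := hmt t
      have := hmt (t + 1)
      have := hrib t
      have := hconn t
      have := hk (t + 1)
      have := hk t
      grind
    · intro h1
      have := hmt 0
      have := ht0
      have := htop 0
      have := hk 0
      have := mn 0
      grind
    · intro t h1 h2
      have c1 := hmt (t + 1)
      have c2 := hts t
      have c3 := hk (t + 1)
      have c4 := hconn t
      have c5 := htop (t + 1)
      have c6 := mn (t + 1)
      clear hts hmt hk hconn htop mn lm lp pn hlm vmn vlp hpn hrib ht0 hb lm' mn' lp' pn' hlm' vmn'
        vlp' hpn'
      rcases Nat.lt_trichotomy (t + 1) r' with c7 | c7 | c7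
      · have c8 : ¬ t + 1 = r := by omega
        have c9 : ¬ t + 1 = r' := by omega
        have c10 : ¬ (r' ≤ t + 1 ∧ t + 1 ≤ r) := by omega
        simp only [c8, c9, c10, if_false, add_zero] at *
        rw [c1] at h1 h2 ⊢
        exact c2 h1 h2
      · subst c7
        simp only [if_true, le_refl, true_and, hrr]
        grind
      · have c9 : ¬ t + 1 = r' := by omega
        simp only [c9, if_false, add_zero] at *
        grind
    · intro t h1 h2
      have := hmt t
      have := hb t
      have := hk t
      have := hconn t
      grind
  have := h'.unique_left key hfin
  intro t
  rw [this]

/-! ### Reverse insertion -/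

theorem strip_refl (h : Bool) (μ : YoungDiagram) : Strip h μ μ := by
  refine ⟨le_rfl, ?_⟩
  cases h
  · simp only [Bool.false_eq_true, if_false]
    exact fun r c hrc => μ.up_left_mem le_rfl (Nat.le_succ c) hrc
  · simp only [if_true]
    exact fun r c hrc => μ.up_left_mem (Nat.le_succ r) le_rfl hrc

/-- Reversal of one local step of insertion. -/
theorem Strip.reverse {h : Bool} {κ' μ : YoungDiagram} {b : ℕ × ℕ} (hb : Addable μ b)
    (s : Strip h κ' (PrimedCrystal.addBox μ b)) :
    (∃ κ d, Addable κ d ∧ κ' = PrimedCrystal.addBox κ d ∧ Strip h κ μ ∧ bumpBox h μ d = b) ∨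
      (b = startBox h μ ∧ Strip h κ' μ) := by
  have key : ∀ {κ' μ : YoungDiagram} {b : ℕ × ℕ}, Addable μ b →
      Strip true κ' (PrimedCrystal.addBox μ b) →
      (∃ κ d, Addable κ d ∧ κ' = PrimedCrystal.addBox κ d ∧ Strip true κ μ ∧
        bumpBox true μ d = b) ∨ (b = startBox true μ ∧ Strip true κ' μ) := by
    rintro κ' μ ⟨r, c⟩ hb s
    rw [strip_true_iff] at s
    simp only [hb.rowLen_addBox] at s
    obtain ⟨s1, s2⟩ := s
    have hb' := (addable_iff_rowLen.1 hb).1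
    have m1 := μ.rowLen_anti r (r + 1) (by omega)
    have s1r := s1 r
    simp only [if_true] at s1r
    by_cases h1 : c < κ'.rowLen r
    · left
      have h2 := s1 (r + 1)
      rw [if_neg (by omega)] at h2
      obtain ⟨κ, h3, h4⟩ := exists_addBox_eq (μ := κ') (r := r) (c := c) (by omega) (by omega)
      refine ⟨κ, (r, c), h3, h4.symm, ?_, ?_⟩
      · have h5 := h3.rowLen_addBox
        rw [h4] at h5
        rw [strip_true_iff]
        refine ⟨fun t => ?_, fun t => ?_⟩
        · have := s1 t
          have := h5 t
          simp only at this
          omega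
        · have h6 := s2 t
          have h7 := h5 t
          have h8 := μ.rowLen_anti t (t + 1) (by omega)
          simp only at h7
          rcases eq_or_ne t r with rfl | h9
          · simp only [if_true] at h7
            omega
          · rw [if_neg h9] at h7
            split_ifs at h6 with h10
            · subst h10
              omega
            · omega
      · simp [bumpBox, hb.notMem]
    · rcases r with _ | t
      · right
        refine ⟨by simp [startBox, hb'], ?_⟩
        rw [strip_true_iff]
        refine ⟨fun t => ?_, fun t => ?_⟩
        · have h6 := s1 t
          split_ifs at h6 with h7
          · subst h7
            omega
          · omega
        · have := s2 t
          omega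
      · left
        have h2 := s2 t
        simp only [if_true] at h2
        have h3 := s1 t
        rw [if_neg (by omega)] at h3
        obtain ⟨κ, h4, h5⟩ := exists_addBox_eq (μ := κ') (r := t) (c := κ'.rowLen t - 1) (by omega)
          (by omega)
        refine ⟨κ, _, h4, h5.symm, ?_, ?_⟩
        · have h6 := h4.rowLen_addBox
          rw [h5] at h6
          rw [strip_true_iff]
          refine ⟨fun j => ?_, fun j => ?_⟩
          · have h7 := s1 j
            have h8 := h6 j
            simp only at h8
            split_ifs at h7 h8 with h9 h10
            all_goals first | omega | (subst h9; omega)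
          · have h7 := s2 j
            have h8 := h6 j
            simp only at h8
            split_ifs at h7 h8 with h9 h10
            all_goals omega
        · simp only [bumpBox, YoungDiagram.mem_iff_lt_rowLen, if_true]
          rw [if_pos (by omega), hb']
  cases h with
  | true => exact key hb s
  | false =>
    have h1 := strip_transpose.2 s
    rw [addBox_transpose] at h1
    rcases key (addable_transpose.2 hb) h1 with ⟨κ, d, h2, h3, h4, h5⟩ | ⟨h2, h3⟩
    · left
      refine ⟨κ.transpose, d.swap, addable_transpose.2 h2, ?_, ?_, ?_⟩
      · rw [← addBox_transpose, ← h3, YoungDiagram.transpose_transpose]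
      · rw [← strip_transpose, YoungDiagram.transpose_transpose]
        exact h4
      · have h6 := bumpBox_transpose false μ d.swap
        rw [Prod.swap_swap] at h6
        exact Prod.swap_injective (h6.symm.trans h5)
    · right
      refine ⟨?_, strip_transpose.1 h3⟩
      have h6 := startBox_transpose false μ
      exact Prod.swap_injective (h2.trans h6)

/-- The local rule can be reversed: the box `d` is determined by the inner diagram after it is added
and by the box to which it leads. -/
theorem bumpBox_injective {h : Bool} {κ κ' μ : YoungDiagram} {d d' : ℕ × ℕ}
    (s : κ ≤ μ) (s' : κ' ≤ μ) (hd : Addable κ d) (hd' : Addable κ' d')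
    (e : addBox κ d = addBox κ' d') (eb : bumpBox h μ d = bumpBox h μ d') : d = d' := by
  have m1 : d ∈ κ' ∨ d = d' := by
    rw [← hd'.mem_addBox, ← e, hd.mem_addBox]
    exact Or.inr rfl
  have m2 : d' ∈ κ ∨ d' = d := by
    rw [← hd.mem_addBox, e, hd'.mem_addBox]
    exact Or.inr rfl
  by_cases h1 : d ∈ μ
  · by_cases h2 : d' ∈ μ
    · have hr := hd.rowLen_addBox
      have hr' := hd'.rowLen_addBox
      have ht := (addable_transpose.2 hd).rowLen_addBox
      have ht' := (addable_transpose.2 hd').rowLen_addBox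
      rw [← addBox_transpose] at ht ht'
      rw [e] at hr ht
      have a1 := hd.1
      have a2 := hd'.1
      have a3 := hd.2
      have a4 := hd'.2
      cases h
      · simp only [bumpBox, h1, h2, if_true, Bool.false_eq_true, if_false, Prod.mk.injEq] at eb
        have e2 : d.2 = d'.2 := by omega
        have b1 := ht d.2
        have b2 := ht' d.2
        simp only [Prod.fst_swap, YoungDiagram.rowLen_transpose, if_true, e2] at b1 b2
        rw [e2] at a3
        ext <;> omega
      · simp only [bumpBox, h1, h2, if_true, Prod.mk.injEq] at eb
        have e2 : d.1 = d'.1 := by omega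
        have b1 := hr d.1
        have b2 := hr' d.1
        simp only [if_true, e2] at b1 b2
        rw [e2] at a1
        ext <;> omega
    · rcases m2 with h3 | h3
      · exact absurd (s h3) h2
      · exact h3.symm
  · rcases m1 with h3 | h3
    · exact absurd (s' h3) h1
    · exact h3

/-- A bumped letter never ends up where a newly inserted letter starts. -/
theorem bumpBox_ne_startBox {h : Bool} {κ μ : YoungDiagram} {d : ℕ × ℕ} (hd : Addable κ d)
    (s : addBox κ d ≤ μ) : bumpBox h μ d ≠ startBox h μ := by
  have h1 : d ∈ μ := s (hd.mem_addBox.2 (Or.inr rfl))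
  cases h <;> simp [bumpBox, startBox, h1]

/-- An insertion can be undone if its last box is known. -/
theorem insertChain_injective {τ : ℕ → Bool} {Λ Λ' : ℕ → YoungDiagram} (hΛ : IsChain τ Λ)
    (hΛ' : IsChain τ Λ') {x x' N : ℕ} (hx : x ≤ N) (hx' : x' ≤ N)
    (e : insertChain τ Λ x = insertChain τ Λ' x')
    (hN : ∀ a, N ≤ a → newBox τ Λ x a = newBox τ Λ' x' a) : x = x' ∧ Λ = Λ' := by
  have level : ∀ a, x ≤ a → x' ≤ a → newBox τ Λ x a = newBox τ Λ' x' a → Λ a = Λ' a := by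
    intro a h1 h2 h3
    have h4 := congrFun e a
    rw [insertChain_of_le _ _ h1, insertChain_of_le _ _ h2, ← h3] at h4
    have h5 := hΛ'.addable_newBox h2
    rw [← h3] at h5
    exact addBox_injective (hΛ.addable_newBox h1) h5 h4
  have key : ∀ a, x ≤ a → x' ≤ a → newBox τ Λ x a = newBox τ Λ' x' a →
      x = x' ∧ ∀ b ≤ a, x ≤ b → newBox τ Λ x b = newBox τ Λ' x' b := by
    intro a
    induction a with
    | zero =>
      intro h1 h2 h3
      refine ⟨by omega, fun b hb _ => ?_⟩
      obtain rfl : b = 0 := by omega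
      exact h3
    | succ a ih =>
      intro h1 h2 h3
      have h4 := level _ h1 h2 h3
      have h5 := congrFun e a
      rcases eq_or_ne x (a + 1) with rfl | hn
      · rcases eq_or_ne x' (a + 1) with rfl | hn'
        · refine ⟨rfl, fun b hb hb' => ?_⟩
          obtain rfl : b = a + 1 := by omega
          exact h3
        · exfalso
          rw [insertChain_of_lt _ _ (by omega), insertChain_of_le _ _ (by omega)] at h5
          rw [newBox_self, newBox_succ _ _ (by omega), h4] at h3
          refine bumpBox_ne_startBox (hΛ'.addable_newBox (show x' ≤ a by omega)) ?_ h3.symm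
          rw [← h5, ← h4]
          exact (hΛ.strip a).1
      · rcases eq_or_ne x' (a + 1) with rfl | hn'
        · exfalso
          rw [insertChain_of_lt (x := a + 1) _ _ (by omega), insertChain_of_le _ _ (by omega)] at h5
          rw [newBox_self, newBox_succ _ _ (by omega), h4] at h3
          refine bumpBox_ne_startBox (hΛ.addable_newBox (show x ≤ a by omega)) ?_ h3
          rw [h5]
          exact (hΛ'.strip a).1
        · rw [insertChain_of_le _ _ (by omega), insertChain_of_le _ _ (by omega)] at h5
          have h6 := h3
          rw [newBox_succ _ _ (by omega), newBox_succ _ _ (by omega), h4] at h3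
          have h7 := bumpBox_injective (h4 ▸ (hΛ.strip a).1) (hΛ'.strip a).1
            (hΛ.addable_newBox (by omega)) (hΛ'.addable_newBox (by omega)) h5 h3
          obtain ⟨h8, h9⟩ := ih (by omega) (by omega) h7
          refine ⟨h8, fun b hb hb' => ?_⟩
          rcases Nat.lt_or_ge a b with h10 | h10
          · obtain rfl : b = a + 1 := by omega
            exact h6
          · exact h9 b h10 hb'
  obtain ⟨h1, h2⟩ := key N hx hx' (hN N le_rfl)
  refine ⟨h1, funext fun a => ?_⟩
  rcases Nat.lt_or_ge a x with h3 | h3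
  · have h4 := congrFun e a
    rwa [insertChain_of_lt _ _ h3, insertChain_of_lt _ _ (by omega)] at h4
  · apply level a h3 (by omega)
    rcases Nat.lt_or_ge N a with h4 | h4
    · exact hN a h4.le
    · exact h2 a h4 h3

/-- Reverse insertion: a box that can be removed from a tableau is the last box of an
insertion. -/
theorem IsChain.exists_insertChain {τ : ℕ → Bool} (N : ℕ) {Λ' : ℕ → YoungDiagram}
    (hΛ' : IsChain τ Λ') {μ : YoungDiagram} {b : ℕ × ℕ} (hb : Addable μ b)
    (e : Λ' N = PrimedCrystal.addBox μ b) :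
    ∃ x Λ, 1 ≤ x ∧ x ≤ N ∧ IsChain τ Λ ∧ Λ N = μ ∧
      (∀ a ≤ N, PrimedCrystal.insertChain τ Λ x a = Λ' a) ∧ newBox τ Λ x N = b ∧
      ∀ a, N ≤ a → Λ a = μ := by
  induction N generalizing μ b with
  | zero =>
    exfalso
    have : b ∈ Λ' 0 := by
      rw [e, hb.mem_addBox]
      exact Or.inr rfl
    rw [hΛ'.zero] at this
    simp at this
  | succ N ih =>
    have s := hΛ'.strip N
    rw [e] at s
    -- a chain up to the level `N` is continued by the diagram `μ`
    have ext : ∀ Λ : ℕ → YoungDiagram, IsChain τ Λ → Strip (τ (N + 1)) (Λ N) μ →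
        IsChain τ (fun a => if a ≤ N then Λ a else μ) := by
      intro Λ hΛ hs
      refine ⟨by simp [hΛ.zero], fun a => ?_⟩
      rcases Nat.lt_trichotomy a N with h1 | h1 | h1
      · simp only [show a ≤ N by omega, show a + 1 ≤ N by omega, if_true]
        exact hΛ.strip a
      · subst h1
        simpa using hs
      · simp only [show ¬ a ≤ N by omega, show ¬ a + 1 ≤ N by omega, if_false]
        exact strip_refl _ _
    rcases s.reverse hb with ⟨κ, d, h1, h2, h3, h4⟩ | ⟨h1, h2⟩
    · obtain ⟨x, Λ, hx1, hxN, hΛ, rfl, h5, h6, -⟩ := ih h1 h2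
      have hbox : ∀ a ≤ N, newBox τ (fun a => if a ≤ N then Λ a else μ) x a = newBox τ Λ x a :=
        fun a ha => newBox_congr fun c hc => ⟨by simp [show c ≤ N by omega], rfl⟩
      have hbox' : newBox τ (fun a => if a ≤ N then Λ a else μ) x (N + 1) = b := by
        rw [newBox_succ _ _ hxN, hbox N le_rfl, h6]
        simpa using h4
      refine ⟨x, fun a => if a ≤ N then Λ a else μ, hx1, by omega, ext Λ hΛ h3, by simp, ?_,
        hbox', ?_⟩
      · intro a ha
        rcases Nat.lt_or_ge N a with h7 | h7
        · obtain rfl : a = N + 1 := by omega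
          rw [insertChain_of_le _ _ (by omega), hbox', e]
          simp
        · rw [← h5 a h7]
          simp only [PrimedCrystal.insertChain, hbox a h7, h7, if_true]
      · intro a ha
        simp [show ¬ a ≤ N by omega]
    · refine ⟨N + 1, fun a => if a ≤ N then Λ' a else μ, by omega, le_rfl, ext Λ' hΛ' h2, by simp, ?_,
        ?_, ?_⟩
      · intro a ha
        rcases Nat.lt_or_ge N a with h7 | h7
        · obtain rfl : a = N + 1 := by omega
          rw [insertChain_of_le _ _ le_rfl, newBox_self, e]
          simp [← h1]
        · rw [insertChain_of_lt _ _ (by omega)]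
          simp [h7]
      · rw [newBox_self, h1]
        simp
      · intro a ha
        simp [show ¬ a ≤ N by omega]

/-- A standard tableau with `n` boxes, given by the diagrams `M a` of its entries at most `a`. -/
structure IsStandardChain (n : ℕ) (M : ℕ → YoungDiagram) : Prop where
  zero : M 0 = ⊥
  step : ∀ a < n, ∃ b, Addable (M a) b ∧ M (a + 1) = addBox (M a) b

/-- Every diagram is the shape of a standard tableau. -/
theorem exists_isStandardChain (μ : YoungDiagram) : ∃ n M, IsStandardChain n M ∧ M n = μ := by
  induction hn : μ.card using Nat.strong_induction_on generalizing μ with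
  | _ c ih =>
    rcases Nat.eq_zero_or_pos (μ.colLen 0) with h | h
    · refine ⟨0, fun _ => ⊥, ⟨rfl, by simp⟩, ?_⟩
      ext ⟨r, c⟩
      simp only [YoungDiagram.mem_cells, YoungDiagram.notMem_bot, false_iff]
      intro h1
      have := YoungDiagram.mem_iff_lt_colLen.1 (μ.up_left_mem le_rfl (Nat.zero_le c) h1)
      omega
    · have h1 : 0 < μ.rowLen (μ.colLen 0 - 1) := lt_rowLen_iff.2 (by omega)
      have h2 : ¬ 0 < μ.rowLen (μ.colLen 0 - 1 + 1) := by rw [lt_rowLen_iff]; omega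
      obtain ⟨ν, h3, h4⟩ := exists_addBox_eq (μ := μ) (r := μ.colLen 0 - 1)
        (c := μ.rowLen (μ.colLen 0 - 1) - 1) (by omega) (by omega)
      have h5 : ν.card < c := by
        rw [← hn, ← h4]
        apply Finset.card_lt_card
        rw [Finset.ssubset_iff_of_subset]
        · refine ⟨_, ?_, h3.notMem⟩
          rw [YoungDiagram.mem_cells, h3.mem_addBox]
          exact Or.inr rfl
        · intro p hp
          rw [YoungDiagram.mem_cells, h3.mem_addBox]
          exact Or.inl hp
      obtain ⟨n, M, hM, rfl⟩ := ih _ h5 ν rfl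
      refine ⟨n + 1, fun a => if a ≤ n then M a else μ, ⟨by simp [hM.zero], ?_⟩, by simp⟩
      intro a ha
      rcases Nat.lt_or_ge a n with h6 | h6
      · simp only [show a ≤ n by omega, show a + 1 ≤ n by omega, if_true]
        exact hM.step a h6
      · obtain rfl : a = n := by omega
        refine ⟨_, by simpa using h3, by simpa using h4.symm⟩

theorem IsChain.newBox_eq {τ : ℕ → Bool} {Λ : ℕ → YoungDiagram} (hΛ : IsChain τ Λ) {x K a : ℕ}
    (hx : x ≤ K) (hK : ∀ b, K ≤ b → Λ b = Λ K) (ha : K ≤ a) : newBox τ Λ x a = newBox τ Λ x K := by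
  induction a, ha using Nat.le_induction with
  | base => rfl
  | succ a ha ih =>
    have h1 := (hΛ.addable_newBox (show x ≤ a by omega)).notMem
    rw [newBox_succ _ _ (by omega), bumpBox, hK (a + 1) (by omega), ← hK a ha, if_neg h1, ih]

/-- The insertion tableau of a word with letters at most `K` is complete at the level `K`. -/
theorem growth_eq_of_le {τ : ℕ → Bool} {w : List ℕ} {K : ℕ} (hw : ∀ x ∈ w, 1 ≤ x ∧ x ≤ K) {a : ℕ}
    (ha : K ≤ a) : growth τ w a = growth τ w K := by
  induction w using List.reverseRecOn generalizing a with
  | nil => rfl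
  | append_singleton w x ih =>
    have hw' : ∀ y ∈ w, 1 ≤ y ∧ y ≤ K := fun y hy => hw y (by simp [hy])
    have hx := hw x (by simp)
    rw [growth_append, insertChain_of_le _ _ (by omega), insertChain_of_le _ _ (by omega),
      (isChain_growth τ fun y hy => (hw' y hy).1).newBox_eq hx.2 (fun b hb => ih hw' hb) ha,
      ih hw' ha]

/-- Every pair of a tableau and a standard tableau of the same shape comes from a word. -/
theorem IsChain.exists_growth {τ : ℕ → Bool} {n K : ℕ} {Λ M : ℕ → YoungDiagram}
    (hΛ : IsChain τ Λ) (hK : ∀ a, K ≤ a → Λ a = Λ K) (hM : IsStandardChain n M) (e : M n = Λ K) :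
    ∃ w : List ℕ, w.length = n ∧ (∀ x ∈ w, 1 ≤ x ∧ x ≤ K) ∧ growth τ w = Λ ∧
      ∀ a ≤ n, growth τ (w.take a) K = M a := by
  induction n generalizing Λ with
  | zero =>
    refine ⟨[], rfl, by simp, ?_, ?_⟩
    · funext a
      rw [hM.zero] at e
      have h1 : Λ a ≤ Λ K := by
        rcases Nat.lt_or_ge K a with h | h
        · rw [hK a h.le]
        · exact hΛ.mono h
      rw [← e] at h1
      exact (le_bot_iff.1 h1).symm
    · intro a ha
      obtain rfl : a = 0 := by omega
      exact hM.zero.symm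
  | succ n ih =>
    obtain ⟨b, hb, hb'⟩ := hM.step n (by omega)
    rw [e] at hb'
    obtain ⟨x, Λ', hx1, hxK, hΛ', h1, h2, h3, h4⟩ := hΛ.exists_insertChain K hb hb'
    have hK' : ∀ a, K ≤ a → Λ' a = Λ' K := fun a ha => by rw [h4 a ha, h1]
    obtain ⟨w, hw1, hw2, hw3, hw4⟩ := ih hΛ' hK' ⟨hM.zero, fun a ha => hM.step a (by omega)⟩ h1.symm
    refine ⟨w ++ [x], by simp [hw1], ?_, ?_, ?_⟩
    · intro y hy
      rcases List.mem_append.1 hy with hy | hy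
      · exact hw2 y hy
      · rw [List.mem_singleton.1 hy]
        exact ⟨hx1, hxK⟩
    · rw [growth_append, hw3]
      funext a
      rcases Nat.lt_or_ge K a with h | h
      · rw [hK a h.le, ← h2 K le_rfl, insertChain_of_le _ _ (by omega), insertChain_of_le _ _ hxK,
          hΛ'.newBox_eq hxK hK' h.le, hK' a h.le]
      · exact h2 a h
    · intro a ha
      rcases Nat.lt_or_ge n a with h | h
      · obtain rfl : a = n + 1 := by omega
        rw [List.take_of_length_le (by simp [hw1]), growth_append, hw3, h2 K le_rfl, e]
      · rw [List.take_append_of_le_length (by omega)]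
        exact hw4 a h

/-! ### Contents of fillings -/

theorem content_eq_coe {T : Filling} {r c v : ℕ} :
    content T r c = (v : WithTop ℕ) ↔ (T.getD r [])[c]? = some v := by
  unfold content
  cases (T.getD r [])[c]? <;> simp

theorem content_eq_top {T : Filling} {r c : ℕ} :
    content T r c = ⊤ ↔ (T.getD r []).length ≤ c := by
  rw [← List.getElem?_eq_none_iff]
  unfold content
  cases (T.getD r [])[c]? <;> simp

theorem content_ne_top {T : Filling} {r c : ℕ} :
    content T r c ≠ ⊤ ↔ c < (T.getD r []).length := by
  rw [Ne, content_eq_top, not_le]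

theorem exists_content_eq {T : Filling} {r c : ℕ} (h : content T r c ≠ ⊤) :
    ∃ v : ℕ, content T r c = v := by
  obtain ⟨v, hv⟩ := WithTop.ne_top_iff_exists.1 h
  exact ⟨v, hv.symm⟩

theorem ne_top_of_le_coe {x : WithTop ℕ} {a : ℕ} (h : x ≤ (a : WithTop ℕ)) : x ≠ ⊤ := by
  rintro rfl
  simp at h

/-- Partition shapes in terms of contents. -/
theorem isPartition_shape_iff {T : Filling} : IsPartition (shape T) ↔
    (∀ r c, content T (r + 1) c ≠ ⊤ → content T r c ≠ ⊤) ∧ ∀ row ∈ T, row ≠ [] := by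
  simp only [IsPartition, shape, List.pairwise_map, List.mem_map, forall_exists_index, and_imp,
    forall_apply_eq_imp_iff₂, List.length_pos_iff, content_ne_top]
  refine and_congr_left fun hne => ?_
  rw [← List.isChain_iff_pairwise, List.isChain_iff_getElem]
  constructor
  · intro h r c hc
    rcases Nat.lt_or_ge (r + 1) T.length with h1 | h1
    · have h2 := h r h1
      rw [List.getD_eq_getElem _ _ h1] at hc
      rw [List.getD_eq_getElem _ _ (by omega)]
      omega
    · rw [List.getD_eq_default _ _ h1] at hc
      simp at hc
  · intro h r h1
    by_contra h2
    have h3 := h r (T[r].length)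
    rw [List.getD_eq_getElem _ _ h1, List.getD_eq_getElem _ _ (by omega)] at h3
    have := h3 (by simpa using h2)
    omega

theorem eq_of_getD_eq {T T' : Filling} (h : ∀ row ∈ T, row ≠ []) (h' : ∀ row ∈ T', row ≠ [])
    (e : ∀ r, T.getD r [] = T'.getD r []) : T = T' := by
  have len : ∀ {T T' : Filling}, (∀ row ∈ T, row ≠ []) → (∀ r, T.getD r [] = T'.getD r []) →
      T.length ≤ T'.length := by
    intro T T' h e
    by_contra h1
    have h2 := e T'.length
    rw [List.getD_eq_getElem _ _ (by omega), List.getD_eq_default _ _ le_rfl] at h2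
    exact h _ (List.getElem_mem _) h2
  apply List.ext_getElem (le_antisymm (len h e) (len h' fun r => (e r).symm))
  intro r h1 h2
  have := e r
  rwa [List.getD_eq_getElem _ _ h1, List.getD_eq_getElem _ _ h2] at this

theorem filling_ext {T T' : Filling} (h : IsPartition (shape T)) (h' : IsPartition (shape T'))
    (e : ∀ r c, content T r c = content T' r c) : T = T' := by
  refine eq_of_getD_eq (isPartition_shape_iff.1 h).2 (isPartition_shape_iff.1 h').2 fun r => ?_
  apply List.ext_getElem?
  intro c
  have := e r c
  unfold content at this
  revert this
  cases (T.getD r [])[c]? <;> cases (T'.getD r [])[c]? <;> simp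

theorem shape_ext {T T' : Filling} (h : IsPartition (shape T)) (h' : IsPartition (shape T'))
    (e : ∀ r c, content T r c ≠ ⊤ ↔ content T' r c ≠ ⊤) : shape T = shape T' := by
  have e1 : ∀ r, (T.getD r []).length = (T'.getD r []).length := by
    intro r
    apply eq_of_forall_lt_iff
    intro c
    rw [← content_ne_top, e, content_ne_top]
  have key : ∀ T : Filling, (shape T).map (fun n => List.replicate n 0) =
      T.map fun row => List.replicate row.length 0 := fun T => by simp [shape]
  have h1 := (isPartition_shape_iff.1 h).2
  have h2 := (isPartition_shape_iff.1 h').2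
  have e2 : (T.map fun row => List.replicate row.length 0) =
      T'.map fun row => List.replicate row.length 0 := by
    apply eq_of_getD_eq
    · simpa using h1
    · simpa using h2
    · intro r
      have e3 := e1 r
      simp only [List.getD_eq_getElem?_getD, List.getElem?_map] at e3 ⊢
      cases h3 : T[r]? <;> cases h4 : T'[r]? <;> simp_all
  have e4 := congrArg (List.map List.length) e2
  simpa [shape, List.map_map, Function.comp_def] using e4

theorem content_ne_top_of_le {T : Filling} (h : IsPartition (shape T)) {r c r' c' : ℕ}
    (hr : r' ≤ r) (hc : c' ≤ c) (h1 : content T r c ≠ ⊤) : content T r' c' ≠ ⊤ := by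
  induction r, hr using Nat.le_induction with
  | base =>
    rw [content_ne_top] at h1 ⊢
    omega
  | succ r hr ih => exact ih ((isPartition_shape_iff.1 h).1 _ _ h1)

theorem lt_length_of_content_ne_top {T : Filling} {r c : ℕ} (h1 : content T r c ≠ ⊤) :
    r < T.length := by
  by_contra h2
  rw [content_ne_top, List.getD_eq_default _ _ (by omega)] at h1
  simp at h1

/-! ### Changing entries -/

theorem getElem?_getD_eq (T : Filling) (r c : ℕ) :
    (T.getD r [])[c]? = T[r]?.bind fun row => row[c]? := by
  rw [List.getD_eq_getElem?_getD]
  cases T[r]? <;> simp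

theorem content_modifyAt (g : ℕ → ℕ) (T : Filling) (p : ℕ × ℕ) (r c : ℕ) :
    content (modifyAt g T p) r c =
      if (r, c) = p then (content T r c).map g else content T r c := by
  obtain ⟨r', c'⟩ := p
  unfold content modifyAt
  simp only [getElem?_getD_eq, List.getElem?_modify, Prod.mk.injEq]
  cases h1 : T[r]? with
  | none => simp
  | some row =>
    by_cases h2 : r' = r
    · subst h2
      by_cases h3 : c' = c
      · subst h3
        simp
        cases row[c']? <;> rfl
      · simp [h3, Ne.symm h3]
    · simp [h2, Ne.symm h2]

theorem shape_modifyAt (g : ℕ → ℕ) (T : Filling) (p : ℕ × ℕ) :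
    shape (modifyAt g T p) = shape T := by
  apply List.ext_getElem (by simp [shape, modifyAt])
  intro r h1 h2
  simp only [shape, modifyAt, List.getElem_map, List.getElem_modify]
  split_ifs <;> simp

theorem content_place {T : Filling} {p : ℕ × ℕ} (a : ℕ) (h1 : p.1 ≤ T.length)
    (h2 : p.2 ≤ (T.getD p.1 []).length) (r c : ℕ) :
    content (place T p a) r c = if (r, c) = p then (a : WithTop ℕ) else content T r c := by
  obtain ⟨r', c'⟩ := p
  simp only at h1 h2
  unfold content place
  simp only [Prod.mk.injEq]
  rcases Nat.lt_or_ge r' T.length with h3 | h3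
  · simp only [h3, if_true, getElem?_getD_eq, List.getElem?_modify]
    rw [List.getD_eq_getElem _ _ h3] at h2
    by_cases h4 : r' = r
    · subst h4
      rw [List.getElem?_eq_getElem h3]
      simp only [Option.map_eq_map, Option.map_some, Option.bind_some, if_true, true_and]
      by_cases h5 : c' < T[r'].length
      · rw [if_pos h5]
        by_cases h6 : c' = c
        · subst h6
          simp [h5]
        · simp [h6, Ne.symm h6]
      · rw [if_neg h5]
        obtain rfl : c' = T[r'].length := by omega
        rcases Nat.lt_trichotomy c T[r'].length with h6 | h6 | h6
        · rw [List.getElem?_append_left h6, if_neg (by omega)]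
        · subst h6
          simp
        · rw [List.getElem?_eq_none (by simp; omega), List.getElem?_eq_none (by omega),
            if_neg (by omega)]
    · simp [h4, Ne.symm h4]
  · obtain rfl : r' = T.length := by omega
    rw [List.getD_eq_default _ _ le_rfl] at h2
    obtain rfl : c' = 0 := by simpa using h2
    simp only [lt_irrefl, if_false]
    rcases Nat.lt_trichotomy r T.length with h4 | h4 | h4
    · rw [List.getD_append _ _ _ _ h4, if_neg (by omega)]
    · subst h4
      cases c <;> simp
    · rw [List.getD_eq_default _ _ (by simp; omega), List.getD_eq_default _ _ (by omega),
        if_neg (by omega)]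

theorem ne_nil_of_mem_place {T : Filling} (p : ℕ × ℕ) (a : ℕ) (h : ∀ row ∈ T, row ≠ []) :
    ∀ row ∈ place T p a, row ≠ [] := by
  intro row hrow
  unfold place at hrow
  split_ifs at hrow with h1
  · obtain ⟨i, hi, rfl⟩ := List.getElem_of_mem hrow
    have := h (T[i]'(by simpa using hi)) (List.getElem_mem _)
    rw [List.getElem_modify]
    split_ifs <;> simp_all
  · rcases List.mem_append.1 hrow with h2 | h2
    · exact h _ h2
    · simp at h2
      simp [h2]

theorem perm_place_of_content_eq {T : Filling} {p : ℕ × ℕ} {y : ℕ} (a : ℕ)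
    (h : content T p.1 p.2 = (y : WithTop ℕ)) :
    (y :: (place T p a).flatten).Perm (a :: T.flatten) := by
  have h1 := lt_length_of_content_ne_top (by rw [h]; simp : content T p.1 p.2 ≠ ⊤)
  rw [content_eq_coe, List.getD_eq_getElem _ _ h1] at h
  obtain ⟨h2, h3⟩ := List.getElem?_eq_some_iff.1 h
  unfold place
  rw [if_pos h1, List.modify_eq_take_cons_drop h1, if_pos h2]
  conv_rhs => rw [← List.take_append_drop p.1 T, List.drop_eq_getElem_cons h1]
  simp only [List.flatten_append, List.flatten_cons]
  rw [List.set_eq_take_append_cons_drop, if_pos h2]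
  conv_rhs =>
    rw [← List.take_append_drop p.2 T[p.1], List.drop_eq_getElem_cons h2, h3]
  rw [List.perm_iff_count]
  intro b
  simp only [List.count_append, List.count_cons]
  omega

theorem perm_place_of_content_eq_top {T : Filling} {p : ℕ × ℕ} (a : ℕ)
    (h : content T p.1 p.2 = ⊤) :
    (place T p a).flatten.Perm (a :: T.flatten) := by
  rw [content_eq_top] at h
  unfold place
  split_ifs with h1
  · rw [List.getD_eq_getElem _ _ h1] at h
    rw [List.modify_eq_take_cons_drop h1, if_neg (by omega)]
    conv_rhs => rw [← List.take_append_drop p.1 T, List.drop_eq_getElem_cons h1]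
    simp only [List.flatten_append, List.flatten_cons]
    rw [List.perm_iff_count]
    intro b
    simp only [List.count_append, List.count_cons, List.count_nil]
    omega
  · simp only [List.flatten_append, List.flatten_cons, List.flatten_nil, List.append_nil]
    exact List.perm_append_singleton _ _

/-! ### Fillings given by chains of diagrams -/

/-- The entries of `T` that are at most `a` occupy the diagram `Λ a`. -/
structure Represents (T : Filling) (Λ : ℕ → YoungDiagram) : Prop where
  partition : IsPartition (shape T)
  mem_iff : ∀ r c a, (r, c) ∈ Λ a ↔ content T r c ≤ (a : WithTop ℕ)

theorem Represents.eq {T T' : Filling} {Λ : ℕ → YoungDiagram} (h : Represents T Λ)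
    (h' : Represents T' Λ) : T = T' := by
  refine filling_ext h.partition h'.partition fun r c => ?_
  have key : ∀ {T T' : Filling}, Represents T Λ → Represents T' Λ →
      content T r c ≤ content T' r c := by
    intro T T' h h'
    rcases eq_or_ne (content T' r c) ⊤ with h1 | h1
    · rw [h1]
      exact le_top
    · obtain ⟨v, hv⟩ := exists_content_eq h1
      rw [hv, ← h.mem_iff, h'.mem_iff, hv]
  exact le_antisymm (key h h') (key h' h)

theorem Represents.chain_eq {T : Filling} {Λ Λ' : ℕ → YoungDiagram} (h : Represents T Λ)
    (h' : Represents T Λ') : Λ = Λ' := by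
  funext a
  ext ⟨r, c⟩
  rw [YoungDiagram.mem_cells, YoungDiagram.mem_cells, h.mem_iff, h'.mem_iff]

theorem represents_nil : Represents [] (fun _ => ⊥) := by
  refine ⟨by simp [shape, IsPartition], fun r c a => ?_⟩
  simp [content]

/-- The place where a letter `a` is put is the end of a row or column of the diagram of the entries
at most `a`. -/
theorem target_eq {T : Filling} {a : ℕ} {μ : YoungDiagram}
    (h : ∀ r c, (r, c) ∈ μ ↔ content T r c ≤ (a : WithTop ℕ)) (l : ℕ) :
    target T a l = if a % 2 = 0 then (l, μ.rowLen l) else (μ.colLen l, l) := by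
  have key : ∀ {α : Type} (L : List α) (p : α → Bool) (n : ℕ), n ≤ L.length →
      (∀ i (hi : i < L.length), i < n → p L[i] = false) →
      (∀ hn : n < L.length, p L[n] = true) → L.findIdx p = n := by
    intro α L p n h1 h2 h3
    rcases Nat.lt_or_ge n L.length with h4 | h4
    · rw [List.findIdx_eq h4]
      exact ⟨h3 h4, fun j hj => by simpa using h2 j (by omega) hj⟩
    · obtain rfl : n = L.length := by omega
      rw [List.findIdx_eq_length]
      intro x hx
      obtain ⟨i, hi, rfl⟩ := List.getElem_of_mem hx
      simpa using h2 i hi hi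
  unfold target
  split_ifs with h0
  · congr 1
    apply key
    · by_contra h1
      have h2 := (h l (T.getD l []).length).1 (YoungDiagram.mem_iff_lt_rowLen.2 (by omega))
      exact absurd (content_ne_top.1 (ne_top_of_le_coe h2)) (lt_irrefl _)
    · intro i hi h1
      have h2 := (h l i).1 (YoungDiagram.mem_iff_lt_rowLen.2 h1)
      have h3 : content T l i = ((T.getD l [])[i] : ℕ) :=
        content_eq_coe.2 (List.getElem?_eq_getElem hi)
      rw [h3] at h2
      have h4 : (T.getD l [])[i] ≤ a := by exact_mod_cast h2
      simpa using h4
    · intro hn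
      have h2 := mt (h l (μ.rowLen l)).2 (by rw [YoungDiagram.mem_iff_lt_rowLen]; omega)
      have h3 : content T l (μ.rowLen l) = ((T.getD l [])[μ.rowLen l] : ℕ) :=
        content_eq_coe.2 (List.getElem?_eq_getElem hn)
      rw [h3] at h2
      have h4 : ¬ (T.getD l [])[μ.rowLen l] ≤ a := by exact_mod_cast h2
      simpa using h4
  · congr 1
    apply key
    · by_contra h1
      have h2 := (h T.length l).1 (YoungDiagram.mem_iff_lt_colLen.2 (by omega))
      exact absurd (lt_length_of_content_ne_top (ne_top_of_le_coe h2)) (lt_irrefl _)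
    · intro i hi h1
      have h2 := (h i l).1 (YoungDiagram.mem_iff_lt_colLen.2 h1)
      obtain ⟨v, hv⟩ := exists_content_eq (ne_top_of_le_coe h2)
      rw [hv] at h2
      have h4 : v ≤ a := by exact_mod_cast h2
      rw [content_eq_coe, List.getD_eq_getElem _ _ hi] at hv
      rw [hv]
      simpa using h4
    · intro hn
      have h2 := mt (h (μ.colLen l) l).2 (by rw [YoungDiagram.mem_iff_lt_colLen]; omega)
      unfold content at h2
      rw [List.getD_eq_getElem _ _ hn] at h2
      cases h3 : T[μ.colLen l][l]? with
      | none => rfl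
      | some v =>
        simp only [h3] at h2
        have h4 : ¬ v ≤ a := by exact_mod_cast h2
        simpa using h4

/-- The type of the letter with rank `a`: unprimed letters fill horizontal strips. -/
def haimanType (a : ℕ) : Bool := a % 2 = 0

theorem startBox_eq_target {T : Filling} {a : ℕ} {μ : YoungDiagram}
    (h : ∀ r c, (r, c) ∈ μ ↔ content T r c ≤ (a : WithTop ℕ)) :
    startBox (haimanType a) μ = target T a 0 := by
  rw [target_eq h]
  simp [startBox, haimanType]

/-- The course of an insertion. While the letter `a` is being inserted, the entries smaller than
`a` are final, and the other ones are still those of the original tableau. -/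
theorem represents_insertAux {Λ : ℕ → YoungDiagram} {x : ℕ} (hΛ : IsChain haimanType Λ) (n : ℕ) :
    ∀ (T : Filling) (a l : ℕ), IsPartition (shape T) → x ≤ a →
      (∀ r c e : ℕ, content T r c ≤ (e : WithTop ℕ) ↔
        (r, c) ∈ if e < a then insertChain haimanType Λ x e else Λ e) →
      target T a l = newBox haimanType Λ x a → T.flatten.countP (a < ·) < n →
      Represents (insertAux n T a l).1 (insertChain haimanType Λ x) ∧
        (∃ N, ∀ e, N ≤ e → newBox haimanType Λ x e = (insertAux n T a l).2) ∧
        (insertAux n T a l).1.flatten.Perm (a :: T.flatten) := by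
  induction n with
  | zero =>
    intro T a l _ _ _ _ h
    omega
  | succ n ih =>
    intro T a l hT hxa hc ht hn
    obtain ⟨b, hb⟩ : ∃ b, newBox haimanType Λ x a = b := ⟨_, rfl⟩
    have hadd : Addable (Λ a) b := hb ▸ hΛ.addable_newBox hxa
    have hca : ∀ e, a ≤ e → ∀ r c, (r, c) ∈ Λ e ↔ content T r c ≤ (e : WithTop ℕ) := by
      intro e he r c
      rw [hc, if_neg (by omega)]
    -- the box stays where it is as long as it is not occupied
    have stay : ∀ e, a ≤ e → b ∉ Λ e → newBox haimanType Λ x e = b := by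
      intro e he
      induction e, he using Nat.le_induction with
      | base => exact fun _ => hb
      | succ e he ih2 =>
        intro h1
        rw [newBox_succ _ _ (by omega), ih2 fun h2 => h1 ((hΛ.strip e).1 h2), bumpBox, if_neg h1]
    have hp1 : b.1 ≤ T.length := by
      rcases h1 : b.1 with _ | t
      · omega
      · have h2 : (t, b.2) ∈ Λ a := YoungDiagram.mem_iff_lt_colLen.2 (by rw [hadd.2]; omega)
        exact lt_length_of_content_ne_top (ne_top_of_le_coe ((hca a le_rfl _ _).1 h2))
    have hp2 : b.2 ≤ (T.getD b.1 []).length := by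
      rcases h1 : b.2 with _ | t
      · omega
      · have h2 : (b.1, t) ∈ Λ a := YoungDiagram.mem_iff_lt_rowLen.2 (by rw [hadd.1]; omega)
        exact content_ne_top.1 (ne_top_of_le_coe ((hca a le_rfl _ _).1 h2))
    have hplace := content_place a hp1 hp2
    simp only [insertAux, ht, hb]
    cases hy : (T.getD b.1 [])[b.2]? with
    | none =>
      simp only
      have htop : content T b.1 b.2 = ⊤ := by
        rw [content_eq_top]
        exact List.getElem?_eq_none_iff.1 hy
      have hnot : ∀ e, a ≤ e → b ∉ Λ e := fun e he h1 =>
        ne_top_of_le_coe ((hca e he b.1 b.2).1 h1) htop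
      refine ⟨⟨?_, ?_⟩, ⟨a, fun e he => stay e he (hnot e he)⟩, perm_place_of_content_eq_top a htop⟩
      · rw [isPartition_shape_iff] at hT ⊢
        refine ⟨fun r c h1 => ?_, ne_nil_of_mem_place b a hT.2⟩
        rw [hplace] at h1 ⊢
        split_ifs with h2
        · simp
        · split_ifs at h1 with h3
          · have h4 : (r, c) ∈ Λ a := by
              apply YoungDiagram.mem_iff_lt_colLen.2
              rw [← h3] at hadd
              have := hadd.2
              simp only at this
              omega
            exact ne_top_of_le_coe ((hca a le_rfl _ _).1 h4)
          · exact hT.1 r c h1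
      · intro r c e
        rw [hplace]
        rcases Nat.lt_or_ge e a with h1 | h1
        · split_ifs with h2
          · have h3 := hc r c e
            rw [if_pos h1] at h3
            rw [← h3]
            have h4 : content T r c = ⊤ := by rw [← h2] at htop; exact htop
            rw [h4]
            refine iff_of_false (fun h5 => ne_top_of_le_coe h5 rfl) ?_
            rw [Nat.cast_le]
            omega
          · have h3 := hc r c e
            rw [if_pos h1] at h3
            exact h3.symm
        · rw [insertChain_of_le _ _ (by omega), (hΛ.addable_newBox (by omega)).mem_addBox,
            stay e h1 (hnot e h1), hca e h1]
          split_ifs with h2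
          · simp [h2, h1]
          · simp [h2]
    | some y =>
      simp only
      have hyc : content T b.1 b.2 = (y : WithTop ℕ) := content_eq_coe.2 hy
      have hbmem : ∀ e, a ≤ e → (b ∈ Λ e ↔ y ≤ e) := by
        intro e he
        have h1 := hca e he b.1 b.2
        rw [hyc] at h1
        exact_mod_cast h1
      have hay : a < y := by
        by_contra h1
        exact hadd.notMem ((hbmem a le_rfl).2 (by omega))
      have hperm := perm_place_of_content_eq (p := b) a hyc
      have hT' : IsPartition (shape (place T b a)) := by
        rw [isPartition_shape_iff] at hT ⊢
        refine ⟨fun r c h1 => ?_, ne_nil_of_mem_place b a hT.2⟩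
        rw [hplace] at h1 ⊢
        split_ifs with h2
        · simp
        · apply hT.1 r c
          split_ifs at h1 with h3
          · have h4 : content T (r + 1) c = (y : WithTop ℕ) := by rw [← h3] at hyc; exact hyc
            rw [h4]
            simp
          · exact h1
      have hc' : ∀ r c e : ℕ, content (place T b a) r c ≤ (e : WithTop ℕ) ↔
          (r, c) ∈ if e < y then insertChain haimanType Λ x e else Λ e := by
        intro r c e
        rw [hplace]
        rcases Nat.lt_or_ge e a with h1 | h1
        · rw [if_pos (show e < y by omega)]
          have h3 := hc r c e
          rw [if_pos h1] at h3
          rw [← h3]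
          split_ifs with h2
          · have h4 : content T r c = (y : WithTop ℕ) := by rw [← h2] at hyc; exact hyc
            rw [h4, Nat.cast_le, Nat.cast_le]
            omega
          · rfl
        · rcases Nat.lt_or_ge e y with h2 | h2
          · rw [if_pos h2, insertChain_of_le _ _ (by omega),
              (hΛ.addable_newBox (by omega)).mem_addBox,
              stay e h1 (by rw [hbmem e h1]; omega), hca e h1]
            split_ifs with h3
            · simp [h3, h1]
            · simp [h3]
          · rw [if_neg (show ¬ e < y by omega)]
            split_ifs with h3
            · rw [h3, hbmem e h1, Nat.cast_le]
              omega
            · rw [hca e h1]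
      have ht' : target (place T b a) y (if y % 2 = 0 then b.1 + 1 else b.2 + 1) =
          newBox haimanType Λ x y := by
        obtain ⟨y, rfl⟩ : ∃ z, y = z + 1 := ⟨y - 1, by omega⟩
        rw [newBox_succ _ _ (by omega), stay y (by omega) (by rw [hbmem y (by omega)]; omega),
          bumpBox, if_pos ((hbmem _ hay.le).2 le_rfl), target_eq (μ := Λ (y + 1))]
        · simp only [haimanType, decide_eq_true_eq]
          split_ifs <;> rfl
        · intro r c
          rw [hc', if_neg (lt_irrefl _)]
      have hn' : (place T b a).flatten.countP (y < ·) < n := by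
        have h1 := hperm.countP_eq (a < ·)
        rw [List.countP_cons, List.countP_cons] at h1
        have h2 : (place T b a).flatten.countP (y < ·) ≤ (place T b a).flatten.countP (a < ·) :=
          List.countP_mono_left fun z _ hz => by
            simp only [decide_eq_true_eq] at hz ⊢
            omega
        simp only [hay, decide_true, if_true, lt_irrefl, decide_false, Bool.false_eq_true,
          if_false] at h1
        omega
      obtain ⟨h1, h2, h3⟩ := ih _ y _ hT' (by omega) hc' ht' hn'
      exact ⟨h1, h2, h3.trans hperm⟩

/-- Haiman's insertion of a letter is the insertion of this letter into the chain of diagrams. -/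
theorem represents_insertLetter {T : Filling} {Λ : ℕ → YoungDiagram}
    (hΛ : IsChain haimanType Λ) (h : Represents T Λ) (x : ℕ) :
    Represents (insertLetter T x).1 (insertChain haimanType Λ x) ∧
      (∃ N, ∀ e, N ≤ e → newBox haimanType Λ x e = (insertLetter T x).2) ∧
      (insertLetter T x).1.flatten.Perm (x :: T.flatten) := by
  refine represents_insertAux hΛ _ T x 0 h.partition le_rfl ?_ ?_ ?_
  · intro r c e
    rw [← h.mem_iff]
    split_ifs with h1
    · rw [insertChain_of_lt _ _ h1]
    · rfl
  · rw [newBox_self, startBox_eq_target fun r c => h.mem_iff r c x]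
  · exact Nat.lt_succ_of_le List.countP_le_length

/-! ### Insertion tableau and recording tableau of a word -/

theorem haiman_append (w : List ℕ) (x : ℕ) : haiman (w ++ [x]) =
    ((insertLetter (haiman w).1 x).1,
      place (haiman w).2 (insertLetter (haiman w).1 x).2 (w.length + 1)) := by
  unfold haiman
  rw [List.zipIdx_append, List.foldl_append]
  simp [Nat.add_comm 1]

theorem Represents.place {T : Filling} {M : ℕ → YoungDiagram} {n : ℕ} (h : Represents T M)
    (hM : ∀ a, n ≤ a → M a = M n) {b : ℕ × ℕ} (hb : Addable (M n) b) :
    Represents (PrimedCrystal.place T b (n + 1)) (fun a => if a ≤ n then M a else addBox (M n) b) ∧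
      (PrimedCrystal.place T b (n + 1)).flatten.Perm (T.flatten ++ [n + 1]) := by
  have hmem : ∀ r c, (r, c) ∈ M n ↔ content T r c ≠ ⊤ := by
    intro r c
    constructor
    · exact fun h1 => ne_top_of_le_coe ((h.mem_iff _ _ _).1 h1)
    · intro h1
      obtain ⟨v, hv⟩ := exists_content_eq h1
      rcases Nat.lt_or_ge n v with h2 | h2
      · rw [← hM v h2.le, h.mem_iff, hv]
      · rw [h.mem_iff, hv]
        exact_mod_cast h2
  have htop : content T b.1 b.2 = ⊤ := by
    by_contra h1
    exact hb.notMem ((hmem _ _).2 h1)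
  have hp1 : b.1 ≤ T.length := by
    rcases h1 : b.1 with _ | t
    · omega
    · have h2 : (t, b.2) ∈ M n := YoungDiagram.mem_iff_lt_colLen.2 (by rw [hb.2]; omega)
      exact lt_length_of_content_ne_top ((hmem _ _).1 h2)
  have hp2 : b.2 ≤ (T.getD b.1 []).length := by
    rcases h1 : b.2 with _ | t
    · omega
    · have h2 : (b.1, t) ∈ M n := YoungDiagram.mem_iff_lt_rowLen.2 (by rw [hb.1]; omega)
      exact content_ne_top.1 ((hmem _ _).1 h2)
  have hplace := content_place (n + 1) hp1 hp2
  refine ⟨⟨?_, ?_⟩, (perm_place_of_content_eq_top _ htop).trans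
    (List.perm_append_singleton _ _).symm⟩
  · have hT := h.partition
    rw [isPartition_shape_iff] at hT ⊢
    refine ⟨fun r c h1 => ?_, ne_nil_of_mem_place b _ hT.2⟩
    rw [hplace] at h1 ⊢
    split_ifs with h2
    · simp
    · split_ifs at h1 with h3
      · rw [← hmem]
        apply YoungDiagram.mem_iff_lt_colLen.2
        rw [← h3] at hb
        have := hb.2
        simp only at this
        omega
      · exact hT.1 r c h1
  · intro r c a
    rw [hplace]
    rcases Nat.lt_or_ge n a with h1 | h1
    · rw [if_neg (by omega), hb.mem_addBox, ← hM a h1.le, h.mem_iff]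
      split_ifs with h2
      · simp only [h2, or_true, true_iff]
        exact_mod_cast h1
      · simp [h2]
    · rw [if_pos h1, h.mem_iff]
      split_ifs with h2
      · have h3 : content T r c = ⊤ := by rw [← h2] at htop; exact htop
        refine iff_of_false (fun h5 => ne_top_of_le_coe h5 h3) ?_
        rw [Nat.cast_le]
        omega
      · rfl

/-- The insertion tableau of a word is given by the growth of the chain of diagrams, and it has the
same letters as the word. -/
theorem represents_insertionTableau {w : List ℕ} (hw : ∀ x ∈ w, 1 ≤ x) :
    Represents (haiman w).1 (growth haimanType w) ∧ (haiman w).1.flatten.Perm w := by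
  induction w using List.reverseRecOn with
  | nil => exact ⟨represents_nil, List.Perm.refl _⟩
  | append_singleton w x ih =>
    have hw' : ∀ y ∈ w, 1 ≤ y := fun y hy => hw y (by simp [hy])
    obtain ⟨h1, h2⟩ := ih hw'
    obtain ⟨h3, -, h4⟩ := represents_insertLetter (isChain_growth _ hw') h1 x
    rw [haiman_append, growth_append]
    exact ⟨h3, h4.trans ((h2.cons x).trans (List.perm_append_singleton _ _).symm)⟩

/-- The recording tableau is given by the shapes of the insertion tableaux of the prefixes. -/
theorem represents_recording {w : List ℕ} {K : ℕ} (hw : ∀ x ∈ w, 1 ≤ x ∧ x ≤ K) :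
    Represents (haiman w).2 (fun a => growth haimanType (w.take a) K) ∧
      (haiman w).2.flatten.Perm (List.range' 1 w.length) := by
  induction w using List.reverseRecOn with
  | nil =>
    refine ⟨?_, List.Perm.refl _⟩
    simp only [List.take_nil]
    exact represents_nil
  | append_singleton w x ih =>
    have hw' : ∀ y ∈ w, 1 ≤ y ∧ y ≤ K := fun y hy => hw y (by simp [hy])
    have hw1 : ∀ y ∈ w, 1 ≤ y := fun y hy => (hw' y hy).1
    have hx := hw x (by simp)
    obtain ⟨h1, h2⟩ := ih hw'
    have hc := isChain_growth haimanType hw1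
    obtain ⟨-, ⟨N, h3⟩, -⟩ :=
      represents_insertLetter hc (represents_insertionTableau hw1).1 x
    have h4 : newBox haimanType (growth haimanType w) x K = (insertLetter (haiman w).1 x).2 := by
      rw [← h3 (max N K) (le_max_left _ _)]
      exact (hc.newBox_eq hx.2 (fun b hb => growth_eq_of_le hw' hb) (le_max_right _ _)).symm
    have h5 : Addable (growth haimanType (w.take w.length) K) (insertLetter (haiman w).1 x).2 := by
      rw [List.take_length, ← h4]
      exact hc.addable_newBox hx.2
    obtain ⟨h6, h7⟩ := h1.place (n := w.length) (fun a ha => by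
      simp only [List.take_of_length_le ha, List.take_length]) h5
    rw [haiman_append]
    refine ⟨?_, ?_⟩
    · convert h6 using 2 with a
      split_ifs with h8
      · rw [List.take_append_of_le_length h8]
      · rw [List.take_of_length_le (by simp; omega), growth_append, insertChain_of_le _ _ hx.2, h4,
          List.take_length]
    · refine h7.trans ?_
      rw [List.length_append, List.length_singleton, List.range'_concat, Nat.add_comm 1]
      simpa using h2.append_right _

/-- A word is determined by its insertion tableau and its recording tableau. -/
theorem growth_injective {τ : ℕ → Bool} {K : ℕ} {w w' : List ℕ}
    (hw : ∀ x ∈ w, 1 ≤ x ∧ x ≤ K) (hw' : ∀ x ∈ w', 1 ≤ x ∧ x ≤ K) (hl : w.length = w'.length)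
    (e : growth τ w = growth τ w')
    (h : ∀ a, growth τ (w.take a) K = growth τ (w'.take a) K) : w = w' := by
  induction w using List.reverseRecOn generalizing w' with
  | nil => exact (List.length_eq_zero_iff.1 hl.symm).symm
  | append_singleton w x ih =>
    rcases List.eq_nil_or_concat w' with rfl | ⟨w', x', rfl⟩
    · simp at hl
    · rw [List.concat_eq_append] at *
      have h1 : ∀ y ∈ w, 1 ≤ y ∧ y ≤ K := fun y hy => hw y (by simp [hy])
      have h2 : ∀ y ∈ w', 1 ≤ y ∧ y ≤ K := fun y hy => hw' y (by simp [hy])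
      have hx := hw x (by simp)
      have hx' := hw' x' (by simp)
      have hl' : w.length = w'.length := by simpa using hl
      have hc := isChain_growth τ fun y hy => (h1 y hy).1
      have hc' := isChain_growth τ fun y hy => (h2 y hy).1
      have h3 : growth τ w K = growth τ w' K := by
        have := h w.length
        rwa [List.take_append_of_le_length le_rfl, List.take_length, hl',
          List.take_append_of_le_length le_rfl, List.take_length] at this
      rw [growth_append, growth_append] at e
      have h4 : newBox τ (growth τ w) x K = newBox τ (growth τ w') x' K := by
        have h5 := congrFun e K
        rw [insertChain_of_le _ _ hx.2, insertChain_of_le _ _ hx'.2, h3] at h5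
        have h6 := hc.addable_newBox hx.2
        have h7 := hc'.addable_newBox hx'.2
        rw [h3] at h6
        have h8 : newBox τ (growth τ w) x K ∈ addBox (growth τ w' K) (newBox τ (growth τ w') x' K) := by
          rw [← h5, h6.mem_addBox]
          exact Or.inr rfl
        rw [h7.mem_addBox] at h8
        exact h8.resolve_left h6.notMem
      obtain ⟨rfl, h5⟩ := insertChain_injective hc hc' hx.2 hx'.2 e fun a ha => by
        rw [hc.newBox_eq hx.2 (fun b hb => growth_eq_of_le h1 hb) ha,
          hc'.newBox_eq hx'.2 (fun b hb => growth_eq_of_le h2 hb) ha, h4]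
      rw [ih h1 h2 hl' h5]
      intro a
      rcases Nat.lt_or_ge w.length a with h6 | h6
      · rw [List.take_of_length_le h6.le, List.take_of_length_le (by omega), h3]
      · have := h a
        rwa [List.take_append_of_le_length h6, List.take_append_of_le_length (by omega)] at this

/-! ### Primed tableaux and standard tableaux as chains -/

theorem getElem?_column {T : Filling} (hT : IsPartition (shape T)) (r c : ℕ) :
    (column T c)[r]? = (T.getD r [])[c]? := by
  induction T generalizing r with
  | nil => simp [column]
  | cons row T ih =>
    have hT' : IsPartition (shape T) := by
      simp only [IsPartition, shape, List.map_cons, List.pairwise_cons, List.mem_cons] at hT ⊢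
      exact ⟨hT.1.2, fun a ha => hT.2 a (Or.inr ha)⟩
    have ih' := ih hT'
    unfold column at ih' ⊢
    rcases Nat.lt_or_ge c row.length with h | h
    · rw [List.filterMap_cons_some (f := fun row : List ℕ => row[c]?) (List.getElem?_eq_getElem h)]
      cases r with
      | zero => simp [List.getElem?_eq_getElem h]
      | succ r => simpa using ih' r
    · rw [List.filterMap_cons_none (f := fun row : List ℕ => row[c]?) (List.getElem?_eq_none h), ih']
      have h1 : ∀ r, ((row :: T).getD r [])[c]? = none := by
        intro r
        rw [List.getElem?_eq_none_iff]
        by_contra h2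
        have h3 := content_ne_top_of_le hT (Nat.zero_le r) le_rfl (content_ne_top.2 (not_le.1 h2))
        rw [content_ne_top] at h3
        simp at h3
        omega
      rw [h1 r]
      simpa using h1 (r + 1)

theorem getElem?_column_eq_some {T : Filling} (hT : IsPartition (shape T)) {r c v : ℕ} :
    (column T c)[r]? = some v ↔ content T r c = (v : WithTop ℕ) := by
  rw [getElem?_column hT, content_eq_coe]

theorem count_le_one_iff {l : List ℕ} {v : ℕ} :
    l.count v ≤ 1 ↔ ∀ i j : ℕ, i < j → l[i]? = some v → l[j]? ≠ some v := by
  rw [← not_lt, ← Nat.succ_le_iff, ← List.duplicate_iff_two_le_count,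
    List.duplicate_iff_exists_distinct_get]
  constructor
  · intro h i j hij h1 h2
    obtain ⟨h3, h4⟩ := List.getElem?_eq_some_iff.1 h1
    obtain ⟨h5, h6⟩ := List.getElem?_eq_some_iff.1 h2
    exact h ⟨⟨i, h3⟩, ⟨j, h5⟩, hij, h4.symm, h6.symm⟩
  · rintro h ⟨⟨i, hi⟩, ⟨j, hj⟩, hij, h1, h2⟩
    refine h i j hij ?_ ?_
    · rw [List.getElem?_eq_getElem hi]
      exact congrArg some h1.symm
    · rw [List.getElem?_eq_getElem hj]
      exact congrArg some h2.symm

theorem exists_represents {T : Filling} (hT : IsPartition (shape T))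
    (h1 : ∀ r c, content T r c ≤ content T r (c + 1))
    (h2 : ∀ r c, content T r c ≤ content T (r + 1) c) : ∃ Λ, Represents T Λ := by
  have hr : ∀ r, Monotone (content T r) := fun r => monotone_nat_of_le_succ (h1 r)
  have hc : ∀ c, Monotone fun r => content T r c := fun c => monotone_nat_of_le_succ fun r => h2 r c
  have hfin : ∀ a : ℕ, {p : ℕ × ℕ | content T p.1 p.2 ≤ (a : WithTop ℕ)}.Finite := by
    intro a
    refine Set.Finite.subset
      (Finset.finite_toSet (Finset.range T.length ×ˢ Finset.range (T.getD 0 []).length)) ?_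
    rintro ⟨r, c⟩ h
    have h3 := ne_top_of_le_coe h
    simp only [Finset.coe_product, Set.mem_prod, Finset.mem_coe, Finset.mem_range]
    exact ⟨lt_length_of_content_ne_top h3,
      content_ne_top.1 (content_ne_top_of_le hT (Nat.zero_le r) le_rfl h3)⟩
  refine ⟨fun a => ⟨(hfin a).toFinset, ?_⟩, hT, fun r c a => ?_⟩
  · rintro ⟨r, c⟩ ⟨r', c'⟩ h3 h4
    obtain ⟨h5, h6⟩ := Prod.mk_le_mk.1 h3
    simp only [Set.Finite.coe_toFinset, Set.mem_ofPred_eq] at h4 ⊢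
    exact (hr r' h6).trans ((hc c h5).trans h4)
  · rw [← YoungDiagram.mem_cells]
    simp

theorem Represents.weak {T : Filling} {Λ : ℕ → YoungDiagram} (h : Represents T Λ) {r c r' c' : ℕ}
    (hr : r' ≤ r) (hc : c' ≤ c) : content T r' c' ≤ content T r c := by
  rcases eq_or_ne (content T r c) ⊤ with h1 | h1
  · rw [h1]
    exact le_top
  · obtain ⟨v, hv⟩ := exists_content_eq h1
    rw [hv, ← h.mem_iff]
    exact (Λ v).up_left_mem hr hc (by rw [h.mem_iff, hv])

theorem Represents.content_eq_succ {T : Filling} {Λ : ℕ → YoungDiagram} (h : Represents T Λ)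
    {r c v : ℕ} : content T r c = ((v + 1 : ℕ) : WithTop ℕ) ↔ (r, c) ∈ Λ (v + 1) ∧ (r, c) ∉ Λ v := by
  rw [h.mem_iff, h.mem_iff]
  rcases eq_or_ne (content T r c) ⊤ with h1 | h1
  · rw [h1]
    exact iff_of_false (WithTop.natCast_ne_top _).symm fun h2 => ne_top_of_le_coe h2.1 rfl
  · obtain ⟨u, hu⟩ := exists_content_eq h1
    rw [hu, Nat.cast_inj, Nat.cast_le, Nat.cast_le]
    omega

/-- The primed tableaux are the chains of horizontal and vertical strips. -/
theorem isPrimedTableau_iff {k : ℕ} {T : Filling} : IsPrimedTableau k T ↔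
    ∃ Λ, Represents T Λ ∧ IsChain haimanType Λ ∧ ∀ a, 2 * k ≤ a → Λ a = Λ (2 * k) := by
  constructor
  · intro h
    obtain ⟨Λ, hΛ⟩ := exists_represents h.partition h.row_weak h.col_weak
    have hent : ∀ r c v : ℕ, content T r c = (v : WithTop ℕ) → 1 ≤ v ∧ v ≤ 2 * k := by
      intro r c v hv
      have h1 := lt_length_of_content_ne_top (by rw [hv]; simp : content T r c ≠ ⊤)
      rw [content_eq_coe, List.getD_eq_getElem _ _ h1] at hv
      exact h.entries _ (List.getElem_mem h1) _ (List.mem_of_getElem? hv)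
    have hmono : ∀ a, Λ a ≤ Λ (a + 1) := by
      rintro a ⟨r, c⟩ h1
      rw [hΛ.mem_iff] at h1 ⊢
      exact h1.trans (by exact_mod_cast Nat.le_succ a)
    refine ⟨Λ, hΛ, ⟨?_, fun a => ⟨hmono a, ?_⟩⟩, fun a ha => ?_⟩
    · ext ⟨r, c⟩
      rw [YoungDiagram.mem_cells, hΛ.mem_iff]
      simp only [YoungDiagram.cells_bot, Finset.notMem_empty, iff_false]
      intro h1
      obtain ⟨v, hv⟩ := exists_content_eq (ne_top_of_le_coe h1)
      have h2 := hent r c v hv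
      rw [hv] at h1
      have h3 : v ≤ 0 := by exact_mod_cast h1
      omega
    · simp only [haimanType, decide_eq_true_eq]
      split_ifs with h0
      · intro r c h1
        by_contra h2
        have h3 : (r + 1, c) ∉ Λ a := fun h3 => h2 ((Λ a).up_left_mem (by omega) le_rfl h3)
        have h4 := (Λ (a + 1)).up_left_mem (Nat.le_succ r) le_rfl h1
        have h5 := hΛ.content_eq_succ.2 ⟨h1, h3⟩
        have h6 := hΛ.content_eq_succ.2 ⟨h4, h2⟩
        rw [← getElem?_column_eq_some h.partition] at h5 h6
        have h7 := h.col_unprimed c ((a + 1) / 2) (by omega)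
        rw [show unp ((a + 1) / 2) = a + 1 by unfold unp; omega] at h7
        exact count_le_one_iff.1 h7 r (r + 1) (by omega) h6 h5
      · intro r c h1
        by_contra h2
        have h3 : (r, c + 1) ∉ Λ a := fun h3 => h2 ((Λ a).up_left_mem le_rfl (by omega) h3)
        have h4 := (Λ (a + 1)).up_left_mem le_rfl (Nat.le_succ c) h1
        have h5 := hΛ.content_eq_succ.2 ⟨h1, h3⟩
        have h6 := hΛ.content_eq_succ.2 ⟨h4, h2⟩
        have h8 := lt_length_of_content_ne_top (by rw [h5]; simp : content T r (c + 1) ≠ ⊤)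
        rw [content_eq_coe, List.getD_eq_getElem _ _ h8] at h5 h6
        have h7 := h.row_primed _ (List.getElem_mem h8) ((a + 2) / 2) (by omega)
        rw [show prm ((a + 2) / 2) = a + 1 by unfold prm; omega] at h7
        exact count_le_one_iff.1 h7 c (c + 1) (by omega) h6 h5
    · ext ⟨r, c⟩
      rw [YoungDiagram.mem_cells, YoungDiagram.mem_cells, hΛ.mem_iff, hΛ.mem_iff]
      constructor
      · intro h1
        obtain ⟨v, hv⟩ := exists_content_eq (ne_top_of_le_coe h1)
        rw [hv]
        exact_mod_cast (hent r c v hv).2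
      · exact fun h1 => h1.trans (by exact_mod_cast ha)
  · rintro ⟨Λ, h, hΛ, hK⟩
    refine ⟨h.partition, ?_, fun r c => h.weak le_rfl (Nat.le_succ c),
      fun r c => h.weak (Nat.le_succ r) le_rfl, ?_, ?_⟩
    · intro row hrow a ha
      obtain ⟨r, hr, rfl⟩ := List.getElem_of_mem hrow
      obtain ⟨c, hc⟩ := List.getElem?_of_mem ha
      have h1 : content T r c = (a : WithTop ℕ) := by
        rw [content_eq_coe, List.getD_eq_getElem _ _ hr, hc]
      constructor
      · by_contra h2
        have h3 : (r, c) ∈ Λ 0 := by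
          rw [h.mem_iff, h1]
          exact_mod_cast (show a ≤ 0 by omega)
        rw [hΛ.zero] at h3
        simp at h3
      · by_contra h2
        have h3 : (r, c) ∈ Λ a := by rw [h.mem_iff, h1]
        rw [hK a (by omega), h.mem_iff, h1] at h3
        exact h2 (by exact_mod_cast h3)
    · intro row hrow i hi
      obtain ⟨r, hr, rfl⟩ := List.getElem_of_mem hrow
      rw [count_le_one_iff]
      intro c c' hc h1 h2
      have h3 : content T r c = (prm i : WithTop ℕ) := by
        rw [content_eq_coe, List.getD_eq_getElem _ _ hr, h1]
      have h4 : content T r c' = (prm i : WithTop ℕ) := by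
        rw [content_eq_coe, List.getD_eq_getElem _ _ hr, h2]
      rw [show prm i = (2 * i - 2) + 1 by unfold prm; omega, h.content_eq_succ] at h3 h4
      have h5 := (hΛ.strip (2 * i - 2)).2
      rw [show haimanType (2 * i - 2 + 1) = false by unfold haimanType; simp; omega] at h5
      simp only [Bool.false_eq_true, if_false] at h5
      obtain ⟨d, rfl⟩ : ∃ d, c' = d + 1 := ⟨c' - 1, by omega⟩
      exact h3.2 ((Λ _).up_left_mem le_rfl (by omega) (h5 r d h4.1))
    · intro c i hi
      rw [count_le_one_iff]
      intro r r' hr h1 h2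
      rw [getElem?_column_eq_some h.partition, show unp i = (2 * i - 1) + 1 by unfold unp; omega,
        h.content_eq_succ] at h1
      rw [getElem?_column_eq_some h.partition, show unp i = (2 * i - 1) + 1 by unfold unp; omega,
        h.content_eq_succ] at h2
      have h5 := (hΛ.strip (2 * i - 1)).2
      rw [show haimanType (2 * i - 1 + 1) = true by unfold haimanType; simp; omega] at h5
      simp only [if_true] at h5
      obtain ⟨d, rfl⟩ : ∃ d, r' = d + 1 := ⟨r' - 1, by omega⟩
      exact h1.2 ((Λ _).up_left_mem (by omega) le_rfl (h5 d c h2.1))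

theorem exists_addBox_of_mem_iff {μ ν : YoungDiagram} {b : ℕ × ℕ}
    (h : ∀ p, p ∈ ν ↔ p ∈ μ ∨ p = b) (hb : b ∉ μ) : Addable μ b ∧ ν = addBox μ b := by
  obtain ⟨r, c⟩ := b
  have hν : (r, c) ∈ ν := (h _).2 (Or.inr rfl)
  have hadd : Addable μ (r, c) := by
    rw [addable_iff_rowLen]
    constructor
    · refine le_antisymm ?_ ?_
      · rw [YoungDiagram.mem_iff_lt_rowLen] at hb
        omega
      · cases c with
        | zero => omega
        | succ d =>
          have h1 := (h (r, d)).1 (ν.up_left_mem le_rfl (Nat.le_succ d) hν)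
          exact YoungDiagram.mem_iff_lt_rowLen.1 (h1.resolve_right (by simp))
    · rintro t rfl
      have h1 := (h (t, c)).1 (ν.up_left_mem (Nat.le_succ t) le_rfl hν)
      exact YoungDiagram.mem_iff_lt_rowLen.1 (h1.resolve_right (by simp))
  refine ⟨hadd, ?_⟩
  ext p
  rw [YoungDiagram.mem_cells, YoungDiagram.mem_cells, h, hadd.mem_addBox]

theorem mem_flatten_iff_content {T : Filling} {v : ℕ} :
    v ∈ T.flatten ↔ ∃ r c, content T r c = (v : WithTop ℕ) := by
  simp only [content_eq_coe]
  constructor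
  · intro h
    obtain ⟨row, h1, h2⟩ := List.mem_flatten.1 h
    obtain ⟨r, hr, rfl⟩ := List.getElem_of_mem h1
    obtain ⟨c, hc⟩ := List.getElem?_of_mem h2
    exact ⟨r, c, by rw [List.getD_eq_getElem _ _ hr, hc]⟩
  · rintro ⟨r, c, h⟩
    rcases Nat.lt_or_ge r T.length with h1 | h1
    · rw [List.getD_eq_getElem _ _ h1] at h
      exact List.mem_flatten.2 ⟨_, List.getElem_mem h1, List.mem_of_getElem? h⟩
    · rw [List.getD_eq_default _ _ h1] at h
      simp at h

theorem eq_of_content_eq_of_nodup {T : Filling} (hT : T.flatten.Nodup) {r c r' c' v : ℕ}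
    (h : content T r c = (v : WithTop ℕ)) (h' : content T r' c' = (v : WithTop ℕ)) :
    (r, c) = (r', c') := by
  have hr := lt_length_of_content_ne_top (by rw [h]; simp : content T r c ≠ ⊤)
  have hr' := lt_length_of_content_ne_top (by rw [h']; simp : content T r' c' ≠ ⊤)
  rw [content_eq_coe, List.getD_eq_getElem _ _ hr] at h
  rw [content_eq_coe, List.getD_eq_getElem _ _ hr'] at h'
  rw [List.nodup_flatten, List.pairwise_iff_getElem] at hT
  obtain ⟨h1, h2⟩ := hT
  rcases Nat.lt_trichotomy r r' with h3 | rfl | h3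
  · exact absurd (List.mem_of_getElem? h') (h2 r r' hr hr' h3 (List.mem_of_getElem? h))
  · obtain ⟨h4, h5⟩ := List.getElem?_eq_some_iff.1 h
    obtain ⟨h6, h7⟩ := List.getElem?_eq_some_iff.1 h'
    rw [((h1 _ (List.getElem_mem hr)).getElem_inj_iff).1 (h5.trans h7.symm)]
  · exact absurd (List.mem_of_getElem? h) (h2 r' r hr' hr h3 (List.mem_of_getElem? h'))

theorem IsStandard.exists_chain {S : Filling} (h : IsStandard S) :
    ∃ M, Represents S M ∧ IsStandardChain S.flatten.length M ∧
      ∀ a, S.flatten.length ≤ a → M a = M S.flatten.length := by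
  have hnodup : S.flatten.Nodup := h.entries.nodup_iff.2 List.nodup_range'
  have hent : ∀ v, v ∈ S.flatten ↔ 1 ≤ v ∧ v ≤ S.flatten.length := by
    intro v
    rw [h.entries.mem_iff, List.mem_range'_1]
    omega
  obtain ⟨M, hM⟩ := exists_represents h.partition
    (fun r c => by
      rcases eq_or_ne (content S r (c + 1)) ⊤ with h1 | h1
      · rw [h1]
        exact le_top
      · have hr := lt_length_of_content_ne_top h1
        rw [content_ne_top, List.getD_eq_getElem _ _ hr] at h1
        have h2 := List.pairwise_iff_getElem.1 (h.row_strict _ (List.getElem_mem hr)) c (c + 1)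
          (by omega) h1 (by omega)
        have h3 : content S r c = (S[r][c] : ℕ) := by
          rw [content_eq_coe, List.getD_eq_getElem _ _ hr, List.getElem?_eq_getElem]
        have h4 : content S r (c + 1) = (S[r][c + 1] : ℕ) := by
          rw [content_eq_coe, List.getD_eq_getElem _ _ hr, List.getElem?_eq_getElem]
        rw [h3, h4]
        exact_mod_cast h2.le)
    (fun r c => by
      rcases eq_or_ne (content S (r + 1) c) ⊤ with h1 | h1
      · rw [h1]
        exact le_top
      · obtain ⟨v, hv⟩ := exists_content_eq h1
        obtain ⟨u, hu⟩ := exists_content_eq (content_ne_top_of_le h.partition (Nat.le_succ r) le_rfl h1)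
        rw [hu, hv]
        rw [← getElem?_column_eq_some h.partition] at hu hv
        obtain ⟨h5, h6⟩ := List.getElem?_eq_some_iff.1 hu
        obtain ⟨h7, h8⟩ := List.getElem?_eq_some_iff.1 hv
        have h2 := List.pairwise_iff_getElem.1 (h.col_strict c) r (r + 1) h5 h7 (by omega)
        rw [h6, h8] at h2
        exact_mod_cast h2.le)
  refine ⟨M, hM, ⟨?_, fun a ha => ?_⟩, fun a ha => ?_⟩
  · ext ⟨r, c⟩
    rw [YoungDiagram.mem_cells, hM.mem_iff]
    simp only [YoungDiagram.cells_bot, Finset.notMem_empty, iff_false]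
    intro h1
    obtain ⟨v, hv⟩ := exists_content_eq (ne_top_of_le_coe h1)
    have h2 := (hent v).1 (mem_flatten_iff_content.2 ⟨r, c, hv⟩)
    rw [hv] at h1
    have h3 : v ≤ 0 := by exact_mod_cast h1
    omega
  · obtain ⟨r, c, hrc⟩ := mem_flatten_iff_content.1 ((hent (a + 1)).2 ⟨by omega, by omega⟩)
    refine ⟨(r, c), exists_addBox_of_mem_iff ?_ (hM.content_eq_succ.1 hrc).2⟩
    rintro ⟨r', c'⟩
    constructor
    · intro h1
      by_cases h2 : (r', c') ∈ M a
      · exact Or.inl h2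
      · exact Or.inr (eq_of_content_eq_of_nodup hnodup (hM.content_eq_succ.2 ⟨h1, h2⟩) hrc)
    · rintro (h1 | h1)
      · rw [hM.mem_iff] at h1 ⊢
        exact h1.trans (by exact_mod_cast Nat.le_succ a)
      · rw [h1]
        exact (hM.content_eq_succ.1 hrc).1
  · ext ⟨r, c⟩
    rw [YoungDiagram.mem_cells, YoungDiagram.mem_cells, hM.mem_iff, hM.mem_iff]
    constructor
    · intro h1
      obtain ⟨v, hv⟩ := exists_content_eq (ne_top_of_le_coe h1)
      rw [hv]
      exact_mod_cast ((hent v).1 (mem_flatten_iff_content.2 ⟨r, c, hv⟩)).2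
    · exact fun h1 => h1.trans (by exact_mod_cast ha)

theorem isStandard_of_represents {S : Filling} {n : ℕ} {M : ℕ → YoungDiagram}
    (h : Represents S M) (hS : S.flatten.Perm (List.range' 1 n)) : IsStandard S := by
  have hl : S.flatten.length = n := by simpa using hS.length_eq
  have hnodup : S.flatten.Nodup := hS.nodup_iff.2 List.nodup_range'
  have key : ∀ {r c r' c' u v : ℕ}, r ≤ r' → c ≤ c' → (r, c) ≠ (r', c') →
      content S r c = (u : WithTop ℕ) → content S r' c' = (v : WithTop ℕ) → u < v := by
    intro r c r' c' u v h1 h2 h3 h4 h5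
    have h6 := h.weak h1 h2
    rw [h4, h5] at h6
    have h7 : u ≤ v := by exact_mod_cast h6
    rcases h7.lt_or_eq with h8 | rfl
    · exact h8
    · exact absurd (eq_of_content_eq_of_nodup hnodup h4 h5) h3
  refine ⟨h.partition, by rw [hl]; exact hS, ?_, ?_⟩
  · intro row hrow
    obtain ⟨r, hr, rfl⟩ := List.getElem_of_mem hrow
    rw [List.pairwise_iff_getElem]
    intro i j hi hj hij
    refine key (r := r) (r' := r) le_rfl hij.le (by simp; omega) ?_ ?_
    · rw [content_eq_coe, List.getD_eq_getElem _ _ hr, List.getElem?_eq_getElem]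
    · rw [content_eq_coe, List.getD_eq_getElem _ _ hr, List.getElem?_eq_getElem]
  · intro c
    rw [List.pairwise_iff_getElem]
    intro i j hi hj hij
    refine key (c := c) (c' := c) hij.le le_rfl (by simp; omega) ?_ ?_
    · rw [← getElem?_column_eq_some h.partition, List.getElem?_eq_getElem]
    · rw [← getElem?_column_eq_some h.partition, List.getElem?_eq_getElem]

/-! ### Transposition and the half unit shift -/

theorem content_transpose {T : Filling} (hT : IsPartition (shape T)) (r c : ℕ) :
    content (transpose T) r c = content T c r := by
  have h1 : (transpose T).getD r [] = column T r := by
    unfold transpose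
    rcases Nat.lt_or_ge r (T.headD []).length with h | h
    · rw [List.getD_eq_getElem _ _ (by simpa using h)]
      simp
    · rw [List.getD_eq_default _ _ (by simpa using h)]
      symm
      rw [List.eq_nil_iff_length_eq_zero, ← Nat.le_zero, ← List.getElem?_eq_none_iff,
        getElem?_column hT]
      rw [List.getElem?_eq_none_iff]
      simpa [List.headD_eq_head?_getD, List.getD_eq_getElem?_getD, List.head?_eq_getElem?] using h
  unfold content
  rw [h1, getElem?_column hT]

theorem isPartition_shape_transpose {T : Filling} (hT : IsPartition (shape T)) :
    IsPartition (shape (transpose T)) := by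
  rw [isPartition_shape_iff]
  constructor
  · intro r c h
    rw [content_transpose hT] at h ⊢
    exact content_ne_top_of_le hT le_rfl (Nat.le_succ r) h
  · intro row hrow
    obtain ⟨c, hc, rfl⟩ := List.mem_map.1 hrow
    rw [List.mem_range] at hc
    rw [← List.length_pos_iff]
    by_contra h1
    have h2 : (column T c)[0]? = none := List.getElem?_eq_none_iff.2 (by omega)
    rw [getElem?_column hT, List.getElem?_eq_none_iff] at h2
    simp only [List.headD_eq_head?_getD, List.getD_eq_getElem?_getD,
      List.head?_eq_getElem?] at hc h2
    omega

theorem content_map_map (g : ℕ → ℕ) (T : Filling) (r c : ℕ) :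
    content (T.map (List.map g)) r c = (content T r c).map g := by
  unfold content
  rw [getElem?_getD_eq, getElem?_getD_eq, List.getElem?_map]
  cases T[r]? with
  | none => rfl
  | some row =>
    simp only [Option.map_some, Option.bind_some, List.getElem?_map]
    cases row[c]? <;> rfl

theorem isPartition_shape_map {T : Filling} (g : ℕ → ℕ) (hT : IsPartition (shape T)) :
    IsPartition (shape (T.map (List.map g))) := by
  have : shape (T.map (List.map g)) = shape T := by simp [shape, Function.comp_def]
  rwa [this]

theorem minus_plus {T : Filling} (hT : IsPartition (shape T)) : minus (plus T) = T := by
  have h1 : IsPartition (shape (plus T)) := isPartition_shape_map _ (isPartition_shape_transpose hT)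
  refine filling_ext (isPartition_shape_map _ (isPartition_shape_transpose h1)) hT fun r c => ?_
  unfold minus
  rw [content_map_map, content_transpose h1]
  unfold plus
  rw [content_map_map, content_transpose hT]
  rcases eq_or_ne (content T r c) ⊤ with h2 | h2
  · rw [h2]
    rfl
  · obtain ⟨v, hv⟩ := exists_content_eq h2
    rw [hv]
    rfl

theorem represents_plus {T : Filling} {Λ : ℕ → YoungDiagram} (h : Represents T Λ) (h0 : Λ 0 = ⊥) :
    Represents (plus T) (fun a => (Λ (a - 1)).transpose) := by
  refine ⟨isPartition_shape_map _ (isPartition_shape_transpose h.partition), fun r c a => ?_⟩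
  unfold plus
  rw [content_map_map, content_transpose h.partition, YoungDiagram.mem_transpose, Prod.swap_prod_mk]
  have hpos : ∀ v : ℕ, content T c r = (v : WithTop ℕ) → 1 ≤ v := by
    intro v hv
    by_contra h1
    have h2 : (c, r) ∈ Λ 0 := by
      rw [h.mem_iff, hv, Nat.cast_le]
      omega
    rw [h0] at h2
    simp at h2
  rw [h.mem_iff]
  rcases eq_or_ne (content T c r) ⊤ with h2 | h2
  · rw [h2]
    exact iff_of_false (fun h3 => ne_top_of_le_coe h3 rfl) fun h3 => ne_top_of_le_coe h3 rfl
  · obtain ⟨v, hv⟩ := exists_content_eq h2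
    have h3 := hpos v hv
    rw [hv]
    have h4 : (WithTop.map (· + 1) (v : WithTop ℕ)) = ((v + 1 : ℕ) : WithTop ℕ) := rfl
    rw [h4, Nat.cast_le, Nat.cast_le]
    omega

/-- The half unit shift of a word transposes the diagrams of its insertion tableau, as it exchanges
primed and unprimed letters. -/
theorem growth_map_succ {w : List ℕ} (hw : ∀ x ∈ w, 1 ≤ x) (a : ℕ) :
    growth haimanType (w.map (· + 1)) a = (growth haimanType w (a - 1)).transpose := by
  induction w using List.reverseRecOn generalizing a with
  | nil =>
    ext p
    simp [growth]
  | append_singleton w x ih =>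
    have ih' := ih fun y hy => hw y (by simp [hy])
    have hx := hw x (by simp)
    rw [List.map_append, List.map_singleton, growth_append, growth_append]
    have htype : ∀ b, haimanType (b + 1) = !haimanType b := by
      intro b
      unfold haimanType
      rcases Nat.mod_two_eq_zero_or_one b with h | h
      · have : (b + 1) % 2 = 1 := by omega
        simp [h, this]
      · have : (b + 1) % 2 = 0 := by omega
        simp [h, this]
    have hbox : ∀ b, x ≤ b → newBox haimanType (growth haimanType (w.map (· + 1))) (x + 1) (b + 1) =
        (newBox haimanType (growth haimanType w) x b).swap := by
      intro b hb
      induction b, hb using Nat.le_induction with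
      | base =>
        rw [newBox_self, newBox_self, ih', htype, Nat.add_sub_cancel, startBox_transpose]
      | succ b hb ih2 =>
        rw [newBox_succ _ _ (by omega), newBox_succ _ _ hb, ih2, ih', htype (b + 1),
          Nat.add_sub_cancel, bumpBox_transpose]
    rcases Nat.lt_or_ge a (x + 1) with h | h
    · rw [insertChain_of_lt _ _ h, insertChain_of_lt _ _ (by omega), ih']
    · obtain ⟨b, rfl⟩ : ∃ b, a = b + 1 := ⟨a - 1, by omega⟩
      rw [insertChain_of_le _ _ h, insertChain_of_le _ _ (by omega), ih', hbox b (by omega),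
        addBox_transpose, Nat.add_sub_cancel]

theorem plus_insertionTableau {w : List ℕ} (hw : ∀ x ∈ w, 1 ≤ x) :
    plus (insertionTableau w) = insertionTableau (w.map (· + 1)) := by
  have h1 := represents_plus (represents_insertionTableau hw).1 (isChain_growth _ hw).zero
  have h2 := (represents_insertionTableau (w := w.map (· + 1)) (by simp)).1
  rw [funext (growth_map_succ hw)] at h2
  exact h1.eq h2

/-! ### Bracketing the reading word of a tableau -/

/-- Letters other than `a` and `b` do not affect the bracketing. -/
theorem foldl_bracketStep_filter {α : Type} {a b : ℕ} {p : ℕ × α → Bool}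
    (ha : ∀ x : α, p (a, x) = true) (hb : ∀ x : α, p (b, x) = true) (L : List (ℕ × α))
    (s : List α × List α) :
    (L.filter p).foldl (bracketStep a b) s = L.foldl (bracketStep a b) s := by
  induction L generalizing s with
  | nil => rfl
  | cons x L ih =>
    obtain ⟨v, x⟩ := x
    rw [List.filter_cons]
    split_ifs with h
    · exact ih _
    · rw [ih, List.foldl_cons]
      congr 1
      have h1 : v ≠ a := by
        rintro rfl
        exact h (ha x)
      have h2 : v ≠ b := by
        rintro rfl
        exact h (hb x)
      simp [bracketStep, h1, h2]

/-- The effect of a row on the state of the bracketing. The row has its letters `a` in the columns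
from `l` to `m` and its letters `b` in the columns from `n` to `q`. -/
def rowStep (l m n q t : ℕ) (s : List (ℕ × ℕ) × List (ℕ × ℕ)) :
    List (ℕ × ℕ) × List (ℕ × ℕ) :=
  (((List.range' (l + s.2.length) (m - l - s.2.length)).map (Prod.mk t)).reverse ++ s.1,
    ((List.range' n (q - n)).map (Prod.mk t)).reverse ++ s.2.drop (m - l))

/-- Reading a row from left to right changes the state of the bracketing by `rowStep`. -/
theorem foldl_row {a b l m n q : ℕ} (hlm : l ≤ m) (hmn : m ≤ n) (hab : a ≠ b) (t : ℕ) {row : List ℕ}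
    (h : ∀ c v, row[c]? = some v → (v = a ↔ l ≤ c ∧ c < m) ∧ (v = b ↔ n ≤ c ∧ c < q))
    (s : List (ℕ × ℕ) × List (ℕ × ℕ)) :
    (row.zipIdx.map fun y => (y.1, (t, y.2))).foldl (bracketStep a b) s =
      rowStep l (min row.length m) n (min row.length q) t s := by
  obtain ⟨A, B⟩ := s
  induction row using List.reverseRecOn with
  | nil => simp [rowStep]
  | append_singleton row v ih =>
    have h1 := h row.length v (by simp)
    rw [List.zipIdx_append, List.map_append, List.foldl_append, ih fun c v hv => h c v (by
      rw [List.getElem?_append_left (List.getElem?_eq_some_iff.1 hv).1, hv])]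
    simp only [List.zipIdx_cons, List.zipIdx_nil, List.map_cons, List.map_nil, List.foldl_cons,
      List.foldl_nil, List.length_append, List.length_singleton, Nat.zero_add]
    generalize row.length = j at h1 ⊢
    by_cases hb : v = b
    · -- one more letter `b`
      obtain ⟨h2, h3⟩ := h1.2.1 hb
      rw [show min j m = m by omega, show min (j + 1) m = m by omega, show min j q = j by omega,
        show min (j + 1) q = j + 1 by omega]
      simp only [bracketStep, hb, if_true, rowStep]
      rw [show j + 1 - n = (j - n) + 1 by omega, List.range'_concat, show n + 1 * (j - n) = j by omega]
      simp
    · by_cases ha : v = a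
      · obtain ⟨h2, h3⟩ := h1.1.1 ha
        rw [show min j m = j by omega, show min (j + 1) m = j + 1 by omega]
        simp only [bracketStep, rowStep, ha, if_true]
        rw [show min j q - n = 0 by omega, show min (j + 1) q - n = 0 by omega]
        simp only [List.range'_zero, List.map_nil, List.reverse_nil, List.nil_append]
        rcases Nat.lt_or_ge (j - l) B.length with h4 | h4
        · rw [List.drop_eq_getElem_cons h4]
          simp only
          rw [show j + 1 - l = j - l + 1 by omega, show j - l + 1 - B.length = 0 by omega,
            show j - l - B.length = 0 by omega]
          simp [hab]
        · rw [List.drop_eq_nil_of_le h4, List.drop_eq_nil_of_le (by omega)]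
          simp only
          rw [show j + 1 - l - B.length = (j - l - B.length) + 1 by omega, List.range'_concat,
            show l + B.length + 1 * (j - l - B.length) = j by omega]
          simp [hab]
      · have e1 : min (j + 1) m - l = min j m - l := by
          have := mt h1.1.2 ha
          omega
        have e2 : min (j + 1) q - n = min j q - n := by
          have := mt h1.2.2 hb
          omega
        simp only [bracketStep, hb, ha, if_false, rowStep, e1, e2]

theorem Represents.content_le_iff {T : Filling} {Λ : ℕ → YoungDiagram} (h : Represents T Λ)
    {r c a : ℕ} : content T r c ≤ (a : WithTop ℕ) ↔ c < (Λ a).rowLen r := by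
  rw [← h.mem_iff, YoungDiagram.mem_iff_lt_rowLen]

theorem Represents.content_eq_iff {T : Filling} {Λ : ℕ → YoungDiagram} (h : Represents T Λ)
    {r c v : ℕ} : content T r c = ((v + 1 : ℕ) : WithTop ℕ) ↔
      (Λ v).rowLen r ≤ c ∧ c < (Λ (v + 1)).rowLen r := by
  rw [h.content_eq_succ, YoungDiagram.mem_iff_lt_rowLen, YoungDiagram.mem_iff_lt_rowLen]
  omega

/-- The states of the bracketing of the reading word after the rows from the bottom up to the
row `t`. -/
theorem Represents.exists_states {T : Filling} {Λ : ℕ → YoungDiagram} (h : Represents T Λ)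
    (hΛ : IsChain haimanType Λ) {i : ℕ} (hi : 1 ≤ i) :
    ∃ S : ℕ → List (ℕ × ℕ) × List (ℕ × ℕ), (∃ N, ∀ t, N ≤ t → S t = ([], [])) ∧
      S 0 = unbracketed (unp i) (unp (i + 1)) (reading T) ∧
      ∀ t, S t = rowStep ((Λ (2 * i - 1)).rowLen t) ((Λ (2 * i)).rowLen t)
        ((Λ (2 * i + 1)).rowLen t) ((Λ (2 * i + 2)).rowLen t) t (S (t + 1)) := by
  have hmono : ∀ a b t, a ≤ b → (Λ a).rowLen t ≤ (Λ b).rowLen t := by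
    intro a b t hab
    by_contra h1
    have := YoungDiagram.mem_iff_lt_rowLen.1
      (hΛ.mono hab (YoungDiagram.mem_iff_lt_rowLen.2 (not_le.1 h1)))
    omega
  have hlen : ∀ a t, (Λ a).rowLen t ≤ (T.getD t []).length := by
    intro a t
    by_contra h1
    have := content_ne_top.1 (ne_top_of_le_coe (h.content_le_iff.2 (not_le.1 h1)))
    omega
  let cells : List ℕ × ℕ → List (ℕ × ℕ × ℕ) := fun x => x.1.zipIdx.map fun y => (y.1, (x.2, y.2))
  let S : ℕ → List (ℕ × ℕ) × List (ℕ × ℕ) := fun t =>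
    ((T.zipIdx.drop t).reverse.flatMap cells).foldl (bracketStep (unp i) (unp (i + 1))) ([], [])
  have hS : ∀ t, T.length ≤ t → S t = ([], []) := fun t ht => by
    simp only [S]
    rw [List.drop_eq_nil_of_le (by simpa using ht)]
    rfl
  refine ⟨S, ⟨T.length, hS⟩, ?_, fun t => ?_⟩
  · simp only [S, unbracketed, reading, List.drop_zero]
    rw [foldl_bracketStep_filter]
    · simp [unp]
    · simp [unp]
  · rcases Nat.lt_or_ge t T.length with ht | ht
    · have e : S t = (cells (T[t], t)).foldl (bracketStep (unp i) (unp (i + 1))) (S (t + 1)) := by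
        simp only [S]
        rw [List.drop_eq_getElem_cons (by simpa using ht)]
        simp
      have hrow := hlen (2 * i + 2) t
      have hlm := hmono (2 * i - 1) (2 * i) t (by omega)
      have hmn := hmono (2 * i) (2 * i + 1) t (by omega)
      have hnq := hmono (2 * i + 1) (2 * i + 2) t (by omega)
      rw [List.getD_eq_getElem _ _ ht] at hrow
      rw [e]
      simp only [cells]
      rw [foldl_row (q := (Λ (2 * i + 2)).rowLen t) hlm hmn (by unfold unp; omega)]
      · rw [min_eq_right (by omega), min_eq_right (by omega)]
      · intro c v hv
        have h1 : content T t c = (v : WithTop ℕ) := by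
          rw [content_eq_coe, List.getD_eq_getElem _ _ ht, hv]
        have h2 := h.content_eq_iff (r := t) (c := c) (v := 2 * i - 1)
        have h3 := h.content_eq_iff (r := t) (c := c) (v := 2 * i + 1)
        rw [h1, Nat.cast_inj] at h2 h3
        rw [show 2 * i - 1 + 1 = 2 * i by omega] at h2
        exact ⟨h2, h3⟩
    · rw [hS t ht, hS (t + 1) (by omega)]
      have h0 : ∀ a, (Λ a).rowLen t = 0 := fun a => by
        have := hlen a t
        rw [List.getD_eq_default _ _ ht] at this
        simpa using this
      simp [rowStep, h0]

/-- The data that decide about the bracketing of a reading word: the states `S t` after the rows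
from the bottom up to the row `t`, and the eventual value `κ` of the heights. -/
structure IsBracketing (l m n q : ℕ → ℕ) (S : ℕ → List (ℕ × ℕ) × List (ℕ × ℕ)) (κ : ℤ) : Prop where
  lm : ∀ t, l t ≤ m t
  nq : ∀ t, n t ≤ q t
  start : ∃ N, ∀ t, N ≤ t → S t = ([], []) ∧ height l m n q t = κ
  step : ∀ t, S t = rowStep (l t) (m t) (n t) (q t) t (S (t + 1))

namespace IsBracketing

variable {l m n q : ℕ → ℕ} {S : ℕ → List (ℕ × ℕ) × List (ℕ × ℕ)} {κ : ℤ}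

theorem length_fst (h : IsBracketing l m n q S κ) (t : ℕ) :
    (S t).1.length = (S (t + 1)).1.length + (m t - l t - (S (t + 1)).2.length) := by
  rw [h.step t]
  simp only [rowStep, List.length_append, List.length_reverse, List.length_map, List.length_range']
  omega

theorem length_snd (h : IsBracketing l m n q S κ) (t : ℕ) :
    (S t).2.length = (q t - n t) + ((S (t + 1)).2.length - (m t - l t)) := by
  rw [h.step t]
  simp only [rowStep, List.length_append, List.length_reverse, List.length_map, List.length_range',
    List.length_drop]

/-- Bracketing removes a letter `i` and a letter `j` at a time, so the excess of the unbracketed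
letters `i` over the unbracketed letters `j`, before the letters `j` of row `t`, is given by the
height. -/
theorem eq_height (h : IsBracketing l m n q S κ) (t : ℕ) :
    ((S (t + 1)).1.length : ℤ) + (m t - l t) = (S (t + 1)).2.length + height l m n q t - κ := by
  obtain ⟨N, hN⟩ := h.start
  have key : ∀ k t, N ≤ t + k → ((S (t + 1)).1.length : ℤ) + (m t - l t) =
      (S (t + 1)).2.length + height l m n q t - κ := by
    intro k
    induction k with
    | zero =>
      intro t ht
      have h1 := h.length_fst t
      have h2 := h.lm t
      rw [(hN t (by omega)).1, (hN (t + 1) (by omega)).1] at h1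
      rw [(hN t (by omega)).2, (hN (t + 1) (by omega)).1]
      simp at h1 ⊢
      omega
    | succ k ih =>
      intro t ht
      have h1 := ih (t + 1) (by omega)
      have h2 : height l m n q (t + 1) =
        height l m n q t + ((q (t + 1) : ℤ) - n (t + 1)) - ((m t : ℤ) - l t) := rfl
      have h3 := h.length_fst (t + 1)
      have h4 := h.length_snd (t + 1)
      have := h.lm (t + 1)
      have := h.nq (t + 1)
      omega
  exact key N t (by omega)

theorem length_fst_le (h : IsBracketing l m n q S κ) {M : ℤ} (hM : κ ≤ M) {t : ℕ}
    (ht : ∀ s, t ≤ s → height l m n q s ≤ M) : ((S t).1.length : ℤ) ≤ M - κ := by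
  obtain ⟨N, hN⟩ := h.start
  have key : ∀ k t, N ≤ t + k → (∀ s, t ≤ s → height l m n q s ≤ M) →
      ((S t).1.length : ℤ) ≤ M - κ := by
    intro k
    induction k with
    | zero =>
      intro t h1 _
      rw [(hN t (by omega)).1]
      simp
      omega
    | succ k ih =>
      intro t h1 h2
      have h3 := ih (t + 1) (by omega) fun s hs => h2 s (by omega)
      have h4 := h2 t le_rfl
      have h5 := h.eq_height t
      have h6 := h.length_fst t
      have := h.lm t
      omega
  exact key N t (by omega) ht

theorem le_length_fst (h : IsBracketing l m n q S κ) (t : ℕ) :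
    height l m n q t - κ ≤ (S t).1.length := by
  have h1 := h.eq_height t
  have h2 := h.length_fst t
  have := h.lm t
  omega

/-- All letters `i` are bracketed if no height exceeds the eventual one. -/
theorem fst_eq_nil (h : IsBracketing l m n q S κ) (hK : ∀ t, height l m n q t ≤ κ) :
    (S 0).1 = [] := by
  have := h.length_fst_le le_rfl (t := 0) fun s _ => hK s
  rw [← List.length_eq_zero_iff]
  omega

/-- The rightmost unbracketed letter `i` is the last letter `i` of the lowest row of maximal
height. -/
theorem head?_fst (h : IsBracketing l m n q S κ) {r : ℕ} (hr : LowestMax (height l m n q) r) :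
    (S 0).1.head? = some (r, m r - 1) := by
  have hκ : κ ≤ height l m n q r - 1 := by
    obtain ⟨N, hN⟩ := h.start
    have h1 := hr.1 (max N (r + 1)) (by omega)
    rw [(hN _ (le_max_left _ _)).2] at h1
    omega
  have h1 := h.length_fst_le hκ (t := r + 1) fun s hs => by
    have := hr.1 s (by omega)
    omega
  have h2 := h.le_length_fst r
  have h3 : (S r).1.head? = some (r, m r - 1) := by
    have h4 := h.length_fst r
    obtain ⟨d, hd⟩ : ∃ d, m r - l r - (S (r + 1)).2.length = d + 1 :=
      ⟨m r - l r - (S (r + 1)).2.length - 1, by omega⟩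
    rw [h.step r]
    simp only [rowStep, hd, List.range'_concat]
    rw [show l r + (S (r + 1)).2.length + 1 * d = m r - 1 by omega]
    simp
  -- the rows above do not contribute any more
  have h4 : ∀ k ≤ r, (S (r - k)).1 = (S r).1 := by
    intro k
    induction k with
    | zero => simp
    | succ k ih =>
      intro hk
      have h5 := ih (by omega)
      rw [show r - k = r - (k + 1) + 1 by omega] at h5
      have h6 : (S (r - (k + 1) + 1)).1 <:+ (S (r - (k + 1))).1 := by
        conv_rhs => rw [h.step]
        exact List.suffix_append _ _
      rw [h5] at h6
      symm
      apply h6.eq_of_length_le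
      have h7 := h.length_fst_le (M := height l m n q r) (by omega) (t := r - (k + 1)) fun s _ => by
        rcases Nat.lt_trichotomy s r with h8 | rfl | h8
        · exact hr.2 s h8
        · exact le_rfl
        · exact (hr.1 s h8).le
      omega
  have h5 := h4 r le_rfl
  rw [Nat.sub_self] at h5
  rw [h5, h3]

/-- A bound for the unbracketed letters `j` below row `t`, in terms of a bound `M` for the heights
from this row downwards. -/
theorem length_snd_le (h : IsBracketing l m n q S κ) {M : ℤ} {t : ℕ}
    (ht : ∀ s, t ≤ s → height l m n q s ≤ M) :
    ((S (t + 1)).2.length : ℤ) ≤ max 0 (M - height l m n q t + (m t - l t)) := by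
  obtain ⟨N, hN⟩ := h.start
  have key : ∀ k t, N ≤ t + k → (∀ s, t ≤ s → height l m n q s ≤ M) →
      ((S (t + 1)).2.length : ℤ) ≤ max 0 (M - height l m n q t + (m t - l t)) := by
    intro k
    induction k with
    | zero =>
      intro t h1 _
      rw [(hN (t + 1) (by omega)).1]
      simp
    | succ k ih =>
      intro t h1 h2
      have h3 := ih (t + 1) (by omega) fun s hs => h2 s (by omega)
      have h4 := h2 (t + 1) (by omega)
      have h6 := h.length_snd (t + 1)
      have h7 : height l m n q (t + 1) =
        height l m n q t + ((q (t + 1) : ℤ) - n (t + 1)) - ((m t : ℤ) - l t) := rfl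
      have := h.lm (t + 1)
      have := h.nq (t + 1)
      omega
  exact key N t (by omega) ht

/-- All letters `j` are bracketed if no height is positive. -/
theorem snd_eq_nil (h : IsBracketing l m n q S κ) (hK : ∀ t, height l m n q t ≤ 0) :
    (S 0).2 = [] := by
  have h1 := h.length_snd_le (t := 0) fun s _ => hK s
  have h2 := h.length_snd 0
  have h3 : height l m n q 0 = (q 0 : ℤ) - n 0 := rfl
  have h4 := hK 0
  have := h.lm 0
  have := h.nq 0
  rw [← List.length_eq_zero_iff]
  omega

/-- The leftmost unbracketed letter `j` is the first letter `j` of the topmost row of maximal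
height. -/
theorem getLast?_snd (h : IsBracketing l m n q S κ) {r : ℕ} (hr : TopmostMax (height l m n q) r)
    (hpos : 0 < height l m n q r) : (S 0).2.getLast? = some (r, n r) := by
  have h1 := h.length_snd_le (M := height l m n q r) (t := r) fun s hs => by
    rcases hs.eq_or_lt with rfl | hs
    · exact le_rfl
    · exact hr.2 s hs
  have hlm := h.lm r
  have hnq := h.nq r
  have hd : (n r : ℤ) < q r := by
    rcases r with _ | t
    · have h3 : height l m n q 0 = (q 0 : ℤ) - n 0 := rfl
      omega
    · have h3 : height l m n q (t + 1) =
        height l m n q t + ((q (t + 1) : ℤ) - n (t + 1)) - ((m t : ℤ) - l t) := rfl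
      have := hr.1 t (by omega)
      have := h.lm t
      omega
  -- the letters `j` of the lower rows are bracketed within row `r`
  have h2 : (S r).2 = ((List.range' (n r) (q r - n r)).map (Prod.mk r)).reverse := by
    rw [h.step r]
    simp only [rowStep]
    rw [List.drop_eq_nil_of_le (by omega), List.append_nil]
  have h3 : (S r).2.getLast? = some (r, n r) := by
    rw [h2, List.getLast?_reverse, List.head?_map]
    obtain ⟨d, hd⟩ : ∃ d, q r - n r = d + 1 := ⟨q r - n r - 1, by omega⟩
    rw [hd, List.range'_succ]
    rfl
  have h4 : ∀ k ≤ r, (S (r - k)).2.getLast? = some (r, n r) ∧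
      ((S (r - k)).2.length : ℤ) - (q (r - k) - n (r - k)) + height l m n q (r - k) =
        height l m n q r := by
    intro k
    induction k with
    | zero =>
      intro _
      refine ⟨h3, ?_⟩
      simp only [Nat.sub_zero]
      rw [h2]
      simp
      omega
    | succ k ih =>
      intro hk
      obtain ⟨h5, h6⟩ := ih (by omega)
      obtain ⟨t, ht⟩ : ∃ t, r - (k + 1) = t := ⟨_, rfl⟩
      rw [show r - k = t + 1 by omega] at h5 h6
      rw [ht]
      have h7 : height l m n q (t + 1) =
        height l m n q t + ((q (t + 1) : ℤ) - n (t + 1)) - ((m t : ℤ) - l t) := rfl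
      have h8 := hr.1 t (by omega)
      have h9 := h.lm t
      have h10 := h.length_snd t
      have h11 := h.nq t
      refine ⟨?_, by omega⟩
      rw [h.step t]
      simp only [rowStep]
      rw [List.getLast?_append_of_ne_nil, List.getLast?_drop, if_neg (by omega), h5]
      rw [← List.length_pos_iff, List.length_drop]
      omega
  have h5 := (h4 r le_rfl).1
  rwa [Nat.sub_self] at h5

end IsBracketing

/-! ### The operators on tableaux in terms of diagrams -/

/-- The diagrams of the letters `i`, `(i + 1)'` and `i + 1`, by their row lengths: strips that are
horizontal, vertical and horizontal. -/
structure ThreeStrips (l m n q : ℕ → ℕ) : Prop where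
  lm : ∀ t, l t ≤ m t
  mn : ∀ t, m t ≤ n t
  nq : ∀ t, n t ≤ q t
  horizontal_lm : ∀ t, m (t + 1) ≤ l t
  vertical_mn : ∀ t, n t ≤ m t + 1
  horizontal_nq : ∀ t, q (t + 1) ≤ n t

theorem IsChain.threeStrips {Λ : ℕ → YoungDiagram} (hΛ : IsChain haimanType Λ) {i : ℕ}
    (hi : 1 ≤ i) : ThreeStrips (Λ (2 * i - 1)).rowLen (Λ (2 * i)).rowLen (Λ (2 * i + 1)).rowLen
      (Λ (2 * i + 2)).rowLen := by
  have s1 := hΛ.strip (2 * i - 1)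
  have s2 := hΛ.strip (2 * i)
  have s3 := hΛ.strip (2 * i + 1)
  rw [show 2 * i - 1 + 1 = 2 * i by omega, show haimanType (2 * i) = true by simp [haimanType],
    strip_true_iff] at s1
  rw [show haimanType (2 * i + 1) = false by simp [haimanType], strip_false_iff] at s2
  rw [show haimanType (2 * i + 1 + 1) = true by simp [haimanType]; omega, strip_true_iff] at s3
  exact ⟨s1.1, s2.1, s3.1, s1.2, s2.2, s3.2⟩

theorem length_add_length_le {T : Filling} (h : ∀ row ∈ T, row ≠ []) :
    T.length + (T.getD 0 []).length ≤ T.flatten.length + 1 := by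
  have key : ∀ T : Filling, (∀ row ∈ T, row ≠ []) → T.length ≤ T.flatten.length := by
    intro T h
    induction T with
    | nil => simp
    | cons row T ih =>
      have h1 := ih fun x hx => h x (by simp [hx])
      have h2 := List.length_pos_iff.2 (h row (by simp))
      simp only [List.length_cons, List.flatten_cons, List.length_append]
      omega
  cases T with
  | nil => simp
  | cons row T =>
    have h1 := key T fun x hx => h x (by simp [hx])
    simp only [List.length_cons, List.flatten_cons, List.length_append, List.getD_cons_zero]
    omega

section

variable {T : Filling} {Λ : ℕ → YoungDiagram}

theorem Represents.rowLen_le (h : Represents T Λ) (a t : ℕ) :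
    (Λ a).rowLen t ≤ (T.getD t []).length := by
  by_contra h1
  have := content_ne_top.1 (ne_top_of_le_coe (h.content_le_iff.2 (not_le.1 h1)))
  omega

theorem Represents.rowLen_le_zero (h : Represents T Λ) (a t : ℕ) :
    (Λ a).rowLen t ≤ (T.getD 0 []).length :=
  ((Λ a).rowLen_anti 0 t (Nat.zero_le t)).trans (h.rowLen_le a 0)

theorem Represents.rowLen_eq_zero (h : Represents T Λ) (a : ℕ) {t : ℕ} (ht : T.length ≤ t) :
    (Λ a).rowLen t = 0 := by
  have := h.rowLen_le a t
  rw [List.getD_eq_default _ _ ht] at this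
  simpa using this

theorem Represents.isOneOf_iff (h : Represents T Λ) (hΛ : IsChain haimanType Λ) {v r c : ℕ} :
    isOneOf (v + 1) (v + 2) (content T r c) = true ↔
      (Λ v).rowLen r ≤ c ∧ c < (Λ (v + 2)).rowLen r := by
  unfold isOneOf
  rw [Bool.or_eq_true, decide_eq_true_eq, decide_eq_true_eq, h.content_eq_iff,
    h.content_eq_iff (v := v + 1)]
  have h1 := (hΛ.strip v).rowLen_le r
  have h2 := (hΛ.strip (v + 1)).rowLen_le r
  rw [show v + 1 + 1 = v + 2 from rfl] at h2 ⊢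
  omega

/-- The southwestern end of a ribbon. -/
theorem Represents.ribbonSW_eq (h : Represents T Λ) (hΛ : IsChain haimanType Λ) {v : ℕ}
    (h1 : ∀ t, (Λ (v + 2)).rowLen (t + 1) ≤ (Λ v).rowLen t + 1) (k : ℕ) :
    ∀ r c, (Λ v).rowLen r ≤ c → c < (Λ (v + 2)).rowLen r → c + (T.length - 1 - r) ≤ k →
      ∃ r', r ≤ r' ∧ ribbonSW T (v + 1) (v + 2) k (r, c) = (r', (Λ v).rowLen r') ∧
        (∀ t, r ≤ t → t < r' → (Λ v).rowLen t < (Λ (v + 2)).rowLen (t + 1)) ∧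
        (Λ (v + 2)).rowLen (r' + 1) ≤ (Λ v).rowLen r' := by
  induction k with
  | zero =>
    intro r c h2 h3 h4
    have h5 : (Λ v).rowLen r = c := by omega
    refine ⟨r, le_rfl, by rw [h5]; rfl, fun t h6 h7 => by omega, ?_⟩
    rw [h.rowLen_eq_zero _ (by omega)]
    omega
  | succ k ih =>
    intro r c h2 h3 h4
    have hr : r < T.length := by
      by_contra h5
      rw [h.rowLen_eq_zero _ (by omega)] at h3
      omega
    have h5 := (Λ v).rowLen_anti r (r + 1) (by omega)
    have h6 := h1 r
    rw [ribbonSW]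
    simp only [h.isOneOf_iff hΛ]
    by_cases h7 : c < (Λ (v + 2)).rowLen (r + 1)
    · rw [if_pos ⟨by omega, h7⟩]
      have hr' : r + 1 < T.length := by
        by_contra h5
        rw [h.rowLen_eq_zero _ (by omega)] at h7
        omega
      obtain ⟨r', h8, h9, h10, h11⟩ := ih (r + 1) c (by omega) h7 (by omega)
      refine ⟨r', by omega, h9, fun t h12 h13 => ?_, h11⟩
      rcases Nat.eq_or_lt_of_le h12 with rfl | h14
      · omega
      · exact h10 t h14 h13
    · rw [if_neg (by omega)]
      by_cases h8 : (Λ v).rowLen r < c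
      · rw [if_pos ⟨by omega, by omega, by omega⟩]
        exact ih r (c - 1) (by omega) (by omega) (by omega)
      · rw [if_neg (by omega)]
        exact ⟨r, le_rfl, by rw [show (Λ v).rowLen r = c by omega], fun t h9 h10 => by omega, by omega⟩

/-- The northeastern end of a ribbon. -/
theorem Represents.ribbonNE_eq (h : Represents T Λ) (hΛ : IsChain haimanType Λ) {v : ℕ}
    (h1 : ∀ t, (Λ (v + 2)).rowLen (t + 1) ≤ (Λ v).rowLen t + 1) (k : ℕ) :
    ∀ r c, (Λ v).rowLen r ≤ c → c < (Λ (v + 2)).rowLen r →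
      r + ((T.getD 0 []).length - 1 - c) ≤ k →
      ∃ r', r' ≤ r ∧ ribbonNE T (v + 1) (v + 2) k (r, c) = (r', (Λ (v + 2)).rowLen r' - 1) ∧
        (∀ t, r' ≤ t → t < r → (Λ v).rowLen t < (Λ (v + 2)).rowLen (t + 1)) ∧
        ∀ s, r' = s + 1 → (Λ (v + 2)).rowLen r' ≤ (Λ v).rowLen s := by
  induction k with
  | zero =>
    intro r c h2 h3 h4
    have h5 := h.rowLen_le_zero (v + 2) r
    refine ⟨r, le_rfl, by rw [show (Λ (v + 2)).rowLen r - 1 = c by omega]; rfl,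
      fun t h6 h7 => by omega, fun s hs => by omega⟩
  | succ k ih =>
    intro r c h2 h3 h4
    have h5 := h.rowLen_le_zero (v + 2) r
    rw [ribbonNE]
    simp only [h.isOneOf_iff hΛ]
    by_cases h7 : 0 < r ∧ (Λ v).rowLen (r - 1) ≤ c
    · obtain ⟨s, rfl⟩ : ∃ s, r = s + 1 := ⟨r - 1, by omega⟩
      have h8 := (Λ (v + 2)).rowLen_anti s (s + 1) (by omega)
      rw [Nat.add_sub_cancel] at h7 ⊢
      rw [if_pos ⟨h7.1, h7.2, by omega⟩]
      obtain ⟨r', h8, h9, h10, h11⟩ := ih s c (by omega) (by omega) (by omega)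
      refine ⟨r', by omega, h9, fun t h12 h13 => ?_, h11⟩
      rcases Nat.lt_or_ge t s with h14 | h14
      · exact h10 t h12 h14
      · obtain rfl : t = s := by omega
        omega
    · rw [if_neg fun h8 => h7 ⟨h8.1, h8.2.1⟩]
      by_cases h8 : c + 1 < (Λ (v + 2)).rowLen r
      · rw [if_pos ⟨by omega, h8⟩]
        exact ih r (c + 1) (by omega) h8 (by omega)
      · rw [if_neg (by omega)]
        refine ⟨r, le_rfl, by rw [show (Λ (v + 2)).rowLen r - 1 = c by omega],
          fun t h9 h10 => by omega, ?_⟩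
        rintro s rfl
        have := h1 s
        rw [Nat.add_sub_cancel] at h7
        omega

theorem Represents.modifyAt (h : Represents T Λ) {Λ' : ℕ → YoungDiagram} {v r c : ℕ} (g : ℕ → ℕ)
    (hv : content T r c = (v : WithTop ℕ))
    (h1 : ∀ a p, p ≠ (r, c) → (p ∈ Λ' a ↔ p ∈ Λ a)) (h2 : ∀ a, (r, c) ∈ Λ' a ↔ g v ≤ a) :
    Represents (PrimedCrystal.modifyAt g T (r, c)) Λ' := by
  refine ⟨by rw [shape_modifyAt]; exact h.partition, fun r' c' a => ?_⟩
  rw [content_modifyAt]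
  split_ifs with h3
  · obtain ⟨rfl, rfl⟩ := Prod.mk.inj h3
    rw [hv, h2]
    have h4 : (WithTop.map g (v : WithTop ℕ)) = ((g v : ℕ) : WithTop ℕ) := rfl
    rw [h4, Nat.cast_le]
  · rw [h1 a _ h3, h.mem_iff]

theorem Lowered.mem_iff {μ μ' : YoungDiagram} {r : ℕ} (h : Lowered μ.rowLen μ'.rowLen r)
    (p : ℕ × ℕ) : p ∈ μ ↔ p ∈ μ' ∨ p = (r, μ'.rowLen r) := by
  obtain ⟨t, c⟩ := p
  have := h t
  rw [YoungDiagram.mem_iff_lt_rowLen, YoungDiagram.mem_iff_lt_rowLen, Prod.mk.injEq]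
  split_ifs at this with h1
  · subst h1
    omega
  · omega

/-- Raising the letters of two boxes by a half unit each. -/
theorem Represents.raise_two (h : Represents T Λ) (hΛ : IsChain haimanType Λ)
    {Λ' : ℕ → YoungDiagram} (hΛ' : IsChain haimanType Λ') {v r r' : ℕ}
    (e : ∀ a, a ≠ v + 1 → a ≠ v + 2 → Λ' a = Λ a)
    (h1 : Lowered (Λ (v + 1)).rowLen (Λ' (v + 1)).rowLen r)
    (h2 : Lowered (Λ (v + 2)).rowLen (Λ' (v + 2)).rowLen r') :
    Represents (PrimedCrystal.modifyAt (· + 1) (PrimedCrystal.modifyAt (· + 1) T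
      (r, (Λ' (v + 1)).rowLen r)) (r', (Λ' (v + 2)).rowLen r')) Λ' := by
  have m1 := h1.mem_iff
  have m2 := h2.mem_iff
  have n1 : (r, (Λ' (v + 1)).rowLen r) ∉ Λ' (v + 1) := by
    rw [YoungDiagram.mem_iff_lt_rowLen]
    exact lt_irrefl _
  have n2 : (r', (Λ' (v + 2)).rowLen r') ∉ Λ' (v + 2) := by
    rw [YoungDiagram.mem_iff_lt_rowLen]
    exact lt_irrefl _
  have hx : ∀ a, (r, (Λ' (v + 1)).rowLen r) ∈ Λ a ↔ v + 1 ≤ a := by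
    intro a
    constructor
    · intro h3
      by_contra h4
      rw [← e a (by omega) (by omega)] at h3
      exact n1 (hΛ'.mono (by omega : a ≤ v + 1) h3)
    · exact fun h3 => hΛ.mono h3 ((m1 _).2 (Or.inr rfl))
  have hxc : content T r ((Λ' (v + 1)).rowLen r) = ((v + 1 : ℕ) : WithTop ℕ) := by
    rw [h.content_eq_succ, hx, hx]
    omega
  -- the intermediate filling
  let Λ₁ : ℕ → YoungDiagram := fun a => if a = v + 1 then Λ' a else Λ a
  have hT₁ : Represents (PrimedCrystal.modifyAt (· + 1) T (r, (Λ' (v + 1)).rowLen r)) Λ₁ := by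
    refine h.modifyAt _ hxc (fun a p hp => ?_) fun a => ?_
    · simp only [Λ₁]
      split_ifs with h3
      · subst h3
        rw [m1]
        simp [hp]
      · rfl
    · simp only [Λ₁]
      split_ifs with h3
      · subst h3
        exact iff_of_false n1 (by omega)
      · rw [hx]
        omega
  have hqc : content (PrimedCrystal.modifyAt (· + 1) T (r, (Λ' (v + 1)).rowLen r)) r'
      ((Λ' (v + 2)).rowLen r') = ((v + 2 : ℕ) : WithTop ℕ) := by
    rw [hT₁.content_eq_succ]
    simp only [Λ₁, if_true]
    rw [if_neg (by omega)]
    exact ⟨(m2 _).2 (Or.inr rfl), fun h3 => n2 (hΛ'.mono (by omega) h3)⟩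
  refine hT₁.modifyAt _ hqc (fun a p hp => ?_) fun a => ?_
  · simp only [Λ₁]
    split_ifs with h3
    · rfl
    · rcases eq_or_ne a (v + 2) with rfl | h4
      · rw [m2]
        simp [hp]
      · rw [e a h3 h4]
  · constructor
    · intro h3
      by_contra h4
      exact n2 (hΛ'.mono (by omega) h3)
    · intro h3
      rw [e a (by omega) (by omega)]
      exact hΛ.mono (by omega) ((m2 _).2 (Or.inr rfl))

/-- Lowering the letters of two boxes by a half unit each. -/
theorem Represents.lower_two (h : Represents T Λ) (hΛ : IsChain haimanType Λ)
    {Λ' : ℕ → YoungDiagram} (hΛ' : IsChain haimanType Λ') {v r r' : ℕ}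
    (e : ∀ a, a ≠ v + 1 → a ≠ v + 2 → Λ' a = Λ a)
    (h1 : Lowered (Λ' (v + 1)).rowLen (Λ (v + 1)).rowLen r')
    (h2 : Lowered (Λ' (v + 2)).rowLen (Λ (v + 2)).rowLen r) :
    Represents (PrimedCrystal.modifyAt (· - 1) (PrimedCrystal.modifyAt (· - 1) T
      (r, (Λ (v + 2)).rowLen r)) (r', (Λ (v + 1)).rowLen r')) Λ' := by
  have m1 := h1.mem_iff
  have m2 := h2.mem_iff
  have n1 : (r', (Λ (v + 1)).rowLen r') ∉ Λ (v + 1) := by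
    rw [YoungDiagram.mem_iff_lt_rowLen]
    exact lt_irrefl _
  have n2 : (r, (Λ (v + 2)).rowLen r) ∉ Λ (v + 2) := by
    rw [YoungDiagram.mem_iff_lt_rowLen]
    exact lt_irrefl _
  have hx : ∀ a, (r, (Λ (v + 2)).rowLen r) ∈ Λ a ↔ v + 3 ≤ a := by
    intro a
    constructor
    · intro h3
      by_contra h4
      exact n2 (hΛ.mono (by omega) h3)
    · intro h3
      rw [← e a (by omega) (by omega)]
      exact hΛ'.mono (by omega) ((m2 _).2 (Or.inr rfl))
  have hxc : content T r ((Λ (v + 2)).rowLen r) = ((v + 3 : ℕ) : WithTop ℕ) := by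
    rw [h.content_eq_succ (v := v + 2), hx, hx]
    omega
  let Λ₁ : ℕ → YoungDiagram := fun a => if a = v + 2 then Λ' a else Λ a
  have hT₁ : Represents (PrimedCrystal.modifyAt (· - 1) T (r, (Λ (v + 2)).rowLen r)) Λ₁ := by
    refine h.modifyAt _ hxc (fun a p hp => ?_) fun a => ?_
    · simp only [Λ₁]
      split_ifs with h3
      · subst h3
        rw [m2]
        simp [hp]
      · rfl
    · simp only [Λ₁]
      split_ifs with h3
      · subst h3
        exact iff_of_true ((m2 _).2 (Or.inr rfl)) (by omega)
      · rw [hx]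
        omega
  have hqc : content (PrimedCrystal.modifyAt (· - 1) T (r, (Λ (v + 2)).rowLen r)) r'
      ((Λ (v + 1)).rowLen r') = ((v + 2 : ℕ) : WithTop ℕ) := by
    rw [hT₁.content_eq_succ]
    simp only [Λ₁, if_true]
    rw [if_neg (by omega)]
    exact ⟨hΛ'.mono (by omega) ((m1 _).2 (Or.inr rfl)), n1⟩
  refine hT₁.modifyAt _ hqc (fun a p hp => ?_) fun a => ?_
  · simp only [Λ₁]
    split_ifs with h3
    · rfl
    · rcases eq_or_ne a (v + 1) with rfl | h4
      · rw [m1]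
        simp [hp]
      · rw [e a h4 h3]
  · constructor
    · intro h3
      by_contra h4
      rw [e a (by omega) (by omega)] at h3
      exact n1 (hΛ.mono (by omega) h3)
    · intro h3
      exact hΛ'.mono (by omega) ((m1 _).2 (Or.inr rfl))

end

section

variable {T : Filling} {Λ : ℕ → YoungDiagram}

/-- The second box of `f_i`. -/
theorem Represents.exists_boxQ (h : Represents T Λ) (hΛ : IsChain haimanType Λ) {i : ℕ}
    (hi : 1 ≤ i) {r : ℕ} {m' : ℕ → ℕ} (hlm : (Λ (2 * i - 1)).rowLen r ≤ m' r)
    (hm : Lowered (Λ (2 * i)).rowLen m' r) :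
    ∃ r' c', boxQ i T r (m' r) = some (r', c') ∧ r ≤ r' ∧
      (∀ t, r ≤ t → t < r' → m' t < (Λ (2 * i + 2)).rowLen (t + 1)) ∧
      (r' = r ∧ ((Λ (2 * i + 1)).rowLen r = (Λ (2 * i)).rowLen r + 1 ∨
          (Λ (2 * i + 2)).rowLen (r + 1) ≤ m' r) ∨
        r < r' ∧ (Λ (2 * i + 1)).rowLen r = (Λ (2 * i)).rowLen r ∧
          (Λ (2 * i + 2)).rowLen (r' + 1) ≤ (Λ (2 * i)).rowLen r') ∧
      (r' = r → c' + 1 = (Λ (2 * i + 1)).rowLen r) ∧ (r < r' → c' = (Λ (2 * i)).rowLen r') := by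
  obtain ⟨lm, mn, nq, hlm', vmn, hnq⟩ := hΛ.threeStrips hi
  have hmr := hm r
  simp only [if_true] at hmr
  have e1 : (unp (i + 1) : WithTop ℕ) ≤ content T r (m' r + 1) ↔
      (Λ (2 * i + 1)).rowLen r = (Λ (2 * i)).rowLen r := by
    have h1 := h.content_le_iff (r := r) (c := m' r + 1) (a := 2 * i + 1)
    have h2 : (unp (i + 1) : WithTop ℕ) ≤ content T r (m' r + 1) ↔
        ¬ content T r (m' r + 1) ≤ ((2 * i + 1 : ℕ) : WithTop ℕ) := by
      rcases eq_or_ne (content T r (m' r + 1)) ⊤ with h3 | h3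
      · rw [h3]
        exact iff_of_true le_top fun h4 => ne_top_of_le_coe h4 rfl
      · obtain ⟨u, hu⟩ := exists_content_eq h3
        rw [hu, Nat.cast_le, Nat.cast_le]
        unfold unp
        omega
    rw [h2, h1]
    have := mn r
    omega
  have e2 : (unp (i + 1) : WithTop ℕ) < content T (r + 1) (m' r) ↔
      (Λ (2 * i + 2)).rowLen (r + 1) ≤ m' r := by
    rw [← not_le, show unp (i + 1) = 2 * i + 2 by unfold unp; omega, h.content_le_iff]
    omega
  have e3 : content T r (m' r + 1) = (prm (i + 1) : WithTop ℕ) ↔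
      (Λ (2 * i + 1)).rowLen r = (Λ (2 * i)).rowLen r + 1 := by
    rw [show prm (i + 1) = 2 * i + 1 by unfold prm; omega, h.content_eq_iff]
    have := vmn r
    omega
  have e4 := h.isOneOf_iff hΛ (v := 2 * i) (r := r + 1) (c := m' r)
  rw [show 2 * i + 1 = prm (i + 1) by unfold prm; omega,
    show 2 * i + 2 = unp (i + 1) by unfold unp; omega] at e4
  have hmn := mn r
  have hvmn := vmn r
  have hl := hlm' r
  have hq := hnq r
  unfold boxQ
  simp only [e1, e2, e3, e4]
  by_cases h1 : (Λ (2 * i + 1)).rowLen r = (Λ (2 * i)).rowLen r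
  · by_cases h2 : (Λ (2 * i + 2)).rowLen (r + 1) ≤ m' r
    · rw [if_pos ⟨h1, h2⟩]
      exact ⟨r, m' r, rfl, le_rfl, fun t h3 h4 => by omega, Or.inl ⟨rfl, Or.inr h2⟩,
        fun _ => by omega, fun h3 => by omega⟩
    · rw [if_neg fun h3 => h2 h3.2, if_neg (by omega), if_pos ⟨h1, by omega, by
        rw [show unp (i + 1) = 2 * i + 2 by unfold unp; omega]
        omega⟩]
      have h3 := h.rowLen_eq_zero (2 * i + 2) (t := r + 1)
      have h4 := length_add_length_le (isPartition_shape_iff.1 h.partition).2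
      have h5 := h.rowLen_le_zero (2 * i + 2) (r + 1)
      obtain ⟨r', h6, h7, h8, h9⟩ := h.ribbonSW_eq hΛ (v := 2 * i)
        (fun t => (hnq t).trans (vmn t)) T.flatten.length (r + 1) (m' r) (by omega) (by omega)
        (by omega)
      refine ⟨r', (Λ (2 * i)).rowLen r', ?_, by omega, ?_, Or.inr ⟨by omega, h1, h9⟩,
        fun h10 => by omega, fun _ => rfl⟩
      · rw [show prm (i + 1) = 2 * i + 1 by unfold prm; omega,
          show unp (i + 1) = 2 * i + 2 by unfold unp; omega, h7]
      · intro t h10 h11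
        rcases h10.eq_or_lt with rfl | h12
        · omega
        · have h13 := hm t
          rw [if_neg (by omega)] at h13
          have := h8 t (by omega) h11
          omega
  · rw [if_neg fun h3 => h1 h3.1, if_pos (by omega)]
    exact ⟨r, m' r + 1, rfl, le_rfl, fun t h3 h4 => by omega, Or.inl ⟨rfl, Or.inl (by omega)⟩,
      fun _ => by omega, fun h3 => by omega⟩

/-- The second box of `e_i`. -/
theorem Represents.exists_boxP (h : Represents T Λ) (hΛ : IsChain haimanType Λ) {i : ℕ}
    (hi : 1 ≤ i) {r : ℕ} {n' : ℕ → ℕ} (hnq : n' r ≤ (Λ (2 * i + 2)).rowLen r)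
    (hm : Lowered n' (Λ (2 * i + 1)).rowLen r) :
    ∃ r' c', boxP i T r ((Λ (2 * i + 1)).rowLen r) = some (r', c') ∧ r' ≤ r ∧
      (∀ t, r' ≤ t → t < r → (Λ (2 * i - 1)).rowLen t < n' (t + 1)) ∧
      (r' = r ∧ ((Λ (2 * i + 1)).rowLen r = (Λ (2 * i)).rowLen r + 1 ∨
          ∀ s, r = s + 1 → n' r ≤ (Λ (2 * i - 1)).rowLen s) ∨
        r' < r ∧ (Λ (2 * i + 1)).rowLen r = (Λ (2 * i)).rowLen r ∧
          ∀ s, r' = s + 1 → (Λ (2 * i + 1)).rowLen r' ≤ (Λ (2 * i - 1)).rowLen s) ∧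
      (r' = r → c' = (Λ (2 * i)).rowLen r) ∧ (r' < r → c' + 1 = (Λ (2 * i + 1)).rowLen r') := by
  obtain ⟨lm, mn, nq, hlm', vmn, hnq'⟩ := hΛ.threeStrips hi
  have hmr := hm r
  simp only [if_true] at hmr
  have hmn := mn r
  have hvmn := vmn r
  have e1 : contentW T r ((Λ (2 * i + 1)).rowLen r) ≤ (unp i : WithTop ℕ) ↔
      (Λ (2 * i + 1)).rowLen r = (Λ (2 * i)).rowLen r := by
    unfold contentW
    split_ifs with h1
    · exact iff_of_true zero_le (by omega)
    · rw [show unp i = 2 * i from rfl, h.content_le_iff]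
      omega
  have e2 : contentN T r ((Λ (2 * i + 1)).rowLen r) < (unp i : WithTop ℕ) ↔
      ∀ s, r = s + 1 → n' r ≤ (Λ (2 * i - 1)).rowLen s := by
    unfold contentN
    rcases r with _ | s
    · simp [unp]
      omega
    · rw [if_neg (by omega), Nat.add_sub_cancel]
      have h1 : content T s ((Λ (2 * i + 1)).rowLen (s + 1)) < (unp i : WithTop ℕ) ↔
          content T s ((Λ (2 * i + 1)).rowLen (s + 1)) ≤ ((2 * i - 1 : ℕ) : WithTop ℕ) := by
        rcases eq_or_ne (content T s ((Λ (2 * i + 1)).rowLen (s + 1))) ⊤ with h3 | h3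
        · rw [h3]
          exact iff_of_false (fun h4 => ne_top_of_le_coe h4.le rfl)
            fun h4 => ne_top_of_le_coe h4 rfl
        · obtain ⟨u, hu⟩ := exists_content_eq h3
          rw [hu, Nat.cast_lt, Nat.cast_le]
          unfold unp
          omega
      rw [h1, h.content_le_iff]
      constructor
      · intro h2 t ht
        obtain rfl : s = t := by omega
        omega
      · intro h2
        have := h2 s rfl
        omega
  have e3 : contentW T r ((Λ (2 * i + 1)).rowLen r) = (prm (i + 1) : WithTop ℕ) ↔
      (Λ (2 * i + 1)).rowLen r = (Λ (2 * i)).rowLen r + 1 := by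
    unfold contentW
    rw [show prm (i + 1) = 2 * i + 1 by unfold prm; omega]
    split_ifs with h1
    · refine iff_of_false ?_ (by omega)
      rw [← Nat.cast_zero, Nat.cast_inj]
      omega
    · rw [h.content_eq_iff]
      omega
  have e4 : ∀ s, isOneOf (unp i) (prm (i + 1)) (content T s ((Λ (2 * i + 1)).rowLen r)) = true ↔
      (Λ (2 * i - 1)).rowLen s ≤ (Λ (2 * i + 1)).rowLen r ∧
        (Λ (2 * i + 1)).rowLen r < (Λ (2 * i + 1)).rowLen s := by
    intro s
    have := h.isOneOf_iff hΛ (v := 2 * i - 1) (r := s) (c := (Λ (2 * i + 1)).rowLen r)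
    rwa [show 2 * i - 1 + 1 = unp i by unfold unp; omega,
      show 2 * i - 1 + 2 = prm (i + 1) by unfold prm; omega,
      show (Λ (prm (i + 1))) = Λ (2 * i + 1) by congr 1] at this
  unfold boxP
  simp only
  by_cases h1 : (Λ (2 * i + 1)).rowLen r = (Λ (2 * i)).rowLen r
  · by_cases h2 : ∀ s, r = s + 1 → n' r ≤ (Λ (2 * i - 1)).rowLen s
    · rw [if_pos ⟨e1.2 h1, e2.2 h2⟩]
      exact ⟨r, _, rfl, le_rfl, fun t h3 h4 => by omega, Or.inl ⟨rfl, Or.inr h2⟩, fun _ => h1,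
        fun h3 => by omega⟩
    · rw [if_neg fun h3 => h2 (e2.1 h3.2), if_neg fun h3 => by have := e3.1 h3; omega]
      push Not at h2
      obtain ⟨s, rfl, h2⟩ := h2
      have h3 := hnq' s
      have hc : contentN T (s + 1) ((Λ (2 * i + 1)).rowLen (s + 1)) =
          content T s ((Λ (2 * i + 1)).rowLen (s + 1)) := by simp [contentN]
      rw [hc, if_pos ⟨e1.2 h1, (e4 s).2 ⟨by omega, by omega⟩⟩, Nat.add_sub_cancel]
      have h3' := h.rowLen_eq_zero (2 * i + 1) (t := s)
      have h4 := length_add_length_le (isPartition_shape_iff.1 h.partition).2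
      have h5 := h.rowLen_le_zero (2 * i + 1) s
      have hv : 2 * i - 1 + 2 = 2 * i + 1 := by omega
      have h6 := h.ribbonNE_eq hΛ (v := 2 * i - 1) (by
        rw [hv]
        intro t
        have := hlm' t
        have := vmn (t + 1)
        omega) T.flatten.length s ((Λ (2 * i + 1)).rowLen (s + 1)) (by omega) (by rw [hv]; omega)
        (by omega)
      rw [hv] at h6
      obtain ⟨r', h6, h7, h8, h9⟩ := h6
      have h10 : 0 < (Λ (2 * i + 1)).rowLen r' := by
        have := (Λ (2 * i + 1)).rowLen_anti r' s h6
        omega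
      refine ⟨r', (Λ (2 * i + 1)).rowLen r' - 1, ?_, by omega, ?_, Or.inr ⟨by omega, h1, h9⟩,
        fun h10 => by omega, fun _ => by omega⟩
      · rw [show unp i = 2 * i - 1 + 1 by unfold unp; omega,
          show prm (i + 1) = 2 * i + 1 by unfold prm; omega, h7]
      · intro t h10 h11
        rcases Nat.lt_or_ge t s with h12 | h12
        · have h13 := hm (t + 1)
          rw [if_neg (by omega)] at h13
          have := h8 t h10 h12
          omega
        · obtain rfl : t = s := by omega
          omega
  · rw [if_neg fun h3 => h1 (e1.1 h3.1), if_pos (e3.2 (by omega))]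
    exact ⟨r, _, rfl, le_rfl, fun t h3 h4 => by omega, Or.inl ⟨rfl, Or.inl (by omega)⟩,
      fun _ => by omega, fun h3 => by omega⟩

theorem Represents.exists_isBracketing (h : Represents T Λ) (hΛ : IsChain haimanType Λ) {i : ℕ}
    (hi : 1 ≤ i) : ∃ S κ, S 0 = unbracketed (unp i) (unp (i + 1)) (reading T) ∧
      IsBracketing (Λ (2 * i - 1)).rowLen (Λ (2 * i)).rowLen (Λ (2 * i + 1)).rowLen
        (Λ (2 * i + 2)).rowLen S κ := by
  obtain ⟨S, ⟨N, h1⟩, h2, h3⟩ := h.exists_states hΛ hi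
  have hst := hΛ.threeStrips hi
  refine ⟨S, height (Λ (2 * i - 1)).rowLen (Λ (2 * i)).rowLen (Λ (2 * i + 1)).rowLen
        (Λ (2 * i + 2)).rowLen T.length, h2, hst.lm, hst.nq, ⟨max N T.length, fun t ht => ?_⟩, h3⟩
  refine ⟨h1 t (by omega), ?_⟩
  have ht' : T.length ≤ t := by omega
  clear ht
  induction t, ht' using Nat.le_induction with
  | base => rfl
  | succ t ht ih =>
    rw [height, ih]
    simp [h.rowLen_eq_zero _ ht, h.rowLen_eq_zero _ (show T.length ≤ t + 1 by omega)]

/-- The operator `f_i` on a tableau leads to the chain `Λ'` that lacks one box in each of the two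
middle diagrams. The hypothesis `hn` says that the second of these boxes is at the end of the ribbon
that starts next to the first one. -/
theorem Represents.exists_tabF (h : Represents T Λ) (hΛ : IsChain haimanType Λ)
    {Λ' : ℕ → YoungDiagram} (hΛ' : IsChain haimanType Λ') {i : ℕ} (hi : 1 ≤ i) {r : ℕ}
    (hr : LowestMax (height (Λ (2 * i - 1)).rowLen (Λ (2 * i)).rowLen (Λ (2 * i + 1)).rowLen
      (Λ (2 * i + 2)).rowLen) r)
    (hm : Lowered (Λ (2 * i)).rowLen (Λ' (2 * i)).rowLen r)
    (e : ∀ a, a ≠ 2 * i → a ≠ 2 * i + 1 → Λ' a = Λ a)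
    (hn : ∀ r', r ≤ r' → (∀ t, r ≤ t → t < r' →
        (Λ' (2 * i)).rowLen t < (Λ (2 * i + 2)).rowLen (t + 1)) →
      (r' = r ∧ ((Λ (2 * i + 1)).rowLen r = (Λ (2 * i)).rowLen r + 1 ∨
          (Λ (2 * i + 2)).rowLen (r + 1) ≤ (Λ' (2 * i)).rowLen r) ∨
        r < r' ∧ (Λ (2 * i + 1)).rowLen r = (Λ (2 * i)).rowLen r ∧
          (Λ (2 * i + 2)).rowLen (r' + 1) ≤ (Λ (2 * i)).rowLen r') →
      Lowered (Λ (2 * i + 1)).rowLen (Λ' (2 * i + 1)).rowLen r') :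
    ∃ T', tabF i T = some T' ∧ Represents T' Λ' := by
  obtain ⟨S, κ, h1, h2⟩ := h.exists_isBracketing hΛ hi
  have h3 := h2.head?_fst hr
  rw [h1] at h3
  have hmr := hm r
  simp only [if_true] at hmr
  rw [show (Λ (2 * i)).rowLen r - 1 = (Λ' (2 * i)).rowLen r by omega] at h3
  have h4 := (hΛ'.threeStrips hi).lm r
  rw [e (2 * i - 1) (by omega) (by omega)] at h4
  obtain ⟨r', c', h5, h6, h7, h8, h9, h10⟩ := h.exists_boxQ hΛ hi h4 hm
  have h11 := hn r' h6 h7 h8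
  have hv : 2 * i - 1 + 1 = 2 * i := by omega
  have hv' : 2 * i - 1 + 2 = 2 * i + 1 := by omega
  have h12 := h.raise_two hΛ hΛ' (v := 2 * i - 1) (r := r) (r' := r')
    (fun a ha ha' => e a (by omega) (by omega)) (by rw [hv]; exact hm) (by rw [hv']; exact h11)
  rw [hv, hv'] at h12
  refine ⟨_, ?_, h12⟩
  unfold tabF
  rw [h3]
  simp only [Option.bind_some]
  rw [h5, Option.map_some]
  congr 3
  have h13 := h11 r'
  simp only [if_true] at h13
  rcases h6.eq_or_lt with h14 | h14
  · have := h9 h14.symm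
    rw [h14] at this
    omega
  · rw [h10 h14]
    have h15 := (hΛ'.threeStrips hi).mn r'
    have h16 := (hΛ.threeStrips hi).vertical_mn r'
    have h17 := hm r'
    rw [if_neg (by omega)] at h17
    omega

/-- The operator `e_i` on a tableau leads to the chain `Λ'` that has one more box in each of the two
middle diagrams. The hypothesis `hn` says that the second of these boxes is at the end of the ribbon
that starts next to the first one. -/
theorem Represents.exists_tabE (h : Represents T Λ) (hΛ : IsChain haimanType Λ)
    {Λ' : ℕ → YoungDiagram} (hΛ' : IsChain haimanType Λ') {i : ℕ} (hi : 1 ≤ i) {r : ℕ}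
    (hr : TopmostMax (height (Λ (2 * i - 1)).rowLen (Λ (2 * i)).rowLen (Λ (2 * i + 1)).rowLen
      (Λ (2 * i + 2)).rowLen) r)
    (hpos : 0 < height (Λ (2 * i - 1)).rowLen (Λ (2 * i)).rowLen (Λ (2 * i + 1)).rowLen
      (Λ (2 * i + 2)).rowLen r)
    (hm : Lowered (Λ' (2 * i + 1)).rowLen (Λ (2 * i + 1)).rowLen r)
    (e : ∀ a, a ≠ 2 * i → a ≠ 2 * i + 1 → Λ' a = Λ a)
    (hn : ∀ r', r' ≤ r → (∀ t, r' ≤ t → t < r →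
        (Λ (2 * i - 1)).rowLen t < (Λ' (2 * i + 1)).rowLen (t + 1)) →
      (r' = r ∧ ((Λ (2 * i + 1)).rowLen r = (Λ (2 * i)).rowLen r + 1 ∨
          ∀ s, r = s + 1 → (Λ' (2 * i + 1)).rowLen r ≤ (Λ (2 * i - 1)).rowLen s) ∨
        r' < r ∧ (Λ (2 * i + 1)).rowLen r = (Λ (2 * i)).rowLen r ∧
          ∀ s, r' = s + 1 → (Λ (2 * i + 1)).rowLen r' ≤ (Λ (2 * i - 1)).rowLen s) →
      Lowered (Λ' (2 * i)).rowLen (Λ (2 * i)).rowLen r') :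
    ∃ T', tabE i T = some T' ∧ Represents T' Λ' := by
  obtain ⟨S, κ, h1, h2⟩ := h.exists_isBracketing hΛ hi
  have h3 := h2.getLast?_snd hr hpos
  rw [h1] at h3
  have hmr := hm r
  simp only [if_true] at hmr
  have h4 := (hΛ'.threeStrips hi).nq r
  rw [e (2 * i + 2) (by omega) (by omega)] at h4
  obtain ⟨r', c', h5, h6, h7, h8, h9, h10⟩ := h.exists_boxP hΛ hi h4 hm
  have h11 := hn r' h6 h7 h8
  have hv : 2 * i - 1 + 1 = 2 * i := by omega
  have hv' : 2 * i - 1 + 2 = 2 * i + 1 := by omega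
  have h12 := h.lower_two hΛ hΛ' (v := 2 * i - 1) (r := r) (r' := r')
    (fun a ha ha' => e a (by omega) (by omega)) (by rw [hv]; exact h11) (by rw [hv']; exact hm)
  rw [hv, hv'] at h12
  refine ⟨_, ?_, h12⟩
  unfold tabE
  rw [h3]
  simp only [Option.bind_some]
  rw [h5, Option.map_some]
  congr 3
  have h13 := h11 r'
  simp only [if_true] at h13
  rcases h6.eq_or_lt with h14 | h14
  · rw [h9 h14, h14]
  · have h18 := h10 h14
    have h15 := (hΛ'.threeStrips hi).mn r'
    have h16 := (hΛ.threeStrips hi).vertical_mn r'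
    have h17 := hm r'
    rw [if_neg (by omega)] at h17
    omega

end

/-! ### Insertion commutes with the operators -/

theorem one_le_of_mem_map_swap {a b : ℕ} (ha : 1 ≤ a) (hb : 1 ≤ b) {w : List ℕ}
    (hw : ∀ x ∈ w, 1 ≤ x) : ∀ x ∈ w.map (Equiv.swap a b), 1 ≤ x := by
  intro x hx
  obtain ⟨y, hy, rfl⟩ := List.mem_map.1 hx
  rw [Equiv.swap_apply_def]
  split_ifs
  · exact hb
  · exact ha
  · exact hw y hy

/-- To see `f_i` as a usual crystal operator, the letters `(i + 1)'` and `i + 1` are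
switched. -/
theorem growth_switch_right {i : ℕ} (hi : 1 ≤ i) {w : List ℕ} (hw : ∀ x ∈ w, 1 ≤ x) :
    ∃ U, U = growth (haimanType ∘ Equiv.swap (2 * i + 1) (2 * i + 2))
        (w.map (Equiv.swap (2 * i + 1) (2 * i + 2))) ∧
      (∀ a, a ≠ 2 * i + 1 → growth haimanType w a = U a) ∧
      Switched (growth haimanType w (2 * i)) (U (2 * i + 1)) (growth haimanType w (2 * i + 1))
        (growth haimanType w (2 * i + 2)) ∧
      TwoStrips (growth haimanType w (2 * i - 1)).rowLen (growth haimanType w (2 * i)).rowLen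
        (U (2 * i + 1)).rowLen := by
  have hw' := one_le_of_mem_map_swap (a := 2 * i + 1) (b := 2 * i + 2) (by omega) (by omega) hw
  obtain ⟨h1, h2⟩ := switched_growth (τ := haimanType ∘ Equiv.swap (2 * i + 1) (2 * i + 2))
    (n := 2 * i) (by simp [haimanType]) (by simp [haimanType]) hw'
  have e1 : (haimanType ∘ Equiv.swap (2 * i + 1) (2 * i + 2)) ∘
      Equiv.swap (2 * i + 1) (2 * i + 2) = haimanType := by
    funext a
    simp
  have e2 : (w.map (Equiv.swap (2 * i + 1) (2 * i + 2))).map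
      (Equiv.swap (2 * i + 1) (2 * i + 2)) = w := by
    rw [List.map_map]
    convert List.map_id w
    funext a
    simp
  rw [e1, e2] at h1 h2
  refine ⟨_, rfl, h1, ?_, ?_⟩
  · rwa [h1 (2 * i) (by omega), h1 (2 * i + 2) (by omega)]
  · have h3 := (isChain_growth (haimanType ∘ Equiv.swap (2 * i + 1) (2 * i + 2)) hw').twoStrips
      (n := 2 * i - 1)
    rw [show 2 * i - 1 + 1 = 2 * i by omega, show 2 * i - 1 + 2 = 2 * i + 1 by omega] at h3
    rw [h1 (2 * i) (by omega), h1 (2 * i - 1) (by omega)]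
    apply h3
    · simp only [Function.comp_apply]
      rw [Equiv.swap_apply_of_ne_of_ne (by omega) (by omega)]
      simp [haimanType]
    · simp [haimanType]

/-- Insertion commutes with `f_i`. -/
theorem map_insertionTableau_wordF {i : ℕ} (hi : 1 ≤ i) {w : List ℕ} (hw : ∀ x ∈ w, 1 ≤ x) :
    (wordF i w).map insertionTableau = tabF i (insertionTableau w) := by
  have hrep := (represents_insertionTableau hw).1
  have hΛ := isChain_growth haimanType hw
  obtain ⟨U, hU, hUe, ⟨k, hk⟩, hs⟩ := growth_switch_right hi hw
  have hwU := one_le_of_mem_map_swap (a := 2 * i + 1) (b := 2 * i + 2) (by omega) (by omega) hw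
  have hv : 2 * i - 1 + 1 = 2 * i := by omega
  have hv' : 2 * i - 1 + 2 = 2 * i + 1 := by omega
  have hτ1 : (haimanType ∘ Equiv.swap (2 * i + 1) (2 * i + 2)) (2 * i - 1 + 1) = true := by
    rw [hv, Function.comp_apply, Equiv.swap_apply_of_ne_of_ne (by omega) (by omega)]
    simp [haimanType]
  have hτ2 : (haimanType ∘ Equiv.swap (2 * i + 1) (2 * i + 2)) (2 * i - 1 + 2) = true := by
    rw [hv', Function.comp_apply, Equiv.swap_apply_left]
    simp [haimanType]
  have hlow := (lower_map (Equiv.swap (2 * i + 1) (2 * i + 2)).injective (a := 2 * i)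
    (b := 2 * i + 2) (by omega) w).1
  rw [Equiv.swap_apply_right, Equiv.swap_apply_of_ne_of_ne (by omega) (by omega)] at hlow
  have hword : wordF i w = lower (2 * i) (2 * i + 2) w := by
    unfold wordF unp
    rw [show 2 * (i + 1) = 2 * i + 2 by omega]
  rw [hword]
  have hat : heightAt U (2 * i - 1) = height (growth haimanType w (2 * i - 1)).rowLen
      (growth haimanType w (2 * i)).rowLen (growth haimanType w (2 * i)).rowLen
      (U (2 * i + 1)).rowLen := by
    unfold heightAt
    rw [hv, hv', ← hUe (2 * i) (by omega), ← hUe (2 * i - 1) (by omega)]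
  cases hw' : lower (2 * i) (2 * i + 2) w with
  | none =>
    have hK := heightsOf_growth hτ1 hτ2 hwU
    rw [← hU, hat, hv, hv'] at hK
    rw [hw', Option.map_none, lower_eq_none_iff] at hlow
    rw [hlow] at hK
    obtain ⟨S, κ, h1, h2⟩ := hrep.exists_isBracketing hΛ hi
    have key := height_switch_right (l := (growth haimanType w (2 * i - 1)).rowLen) hk
    have h3 : (S 0).1 = [] := by
      apply h2.fst_eq_nil
      obtain ⟨N, hN⟩ := h2.start
      obtain ⟨N', hN'⟩ := hK.limit
      let t := max (max N N') (insertionTableau w).length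
      have h4 := (hN t (by omega)).2
      have h5 := hN' t (by omega)
      have h6 := key t
      rw [hrep.rowLen_eq_zero (2 * i + 2) (show (haiman w).1.length ≤ t + 1 from by
        have : (insertionTableau w).length ≤ t := le_max_right _ _
        exact this.trans (Nat.le_succ t)), if_neg (by omega)] at h6
      intro s
      have h7 := key s
      have h8 := hK.le s
      split_ifs at h7 <;> omega
    unfold tabF
    rw [show insertionTableau w = (haiman w).1 from rfl, ← h1, h3]
    rfl
  | some w' =>
    have hw1 := forall_mem_of_lower (by omega) hw' (p := fun x => 1 ≤ x) (by omega) hw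
    rw [hw', Option.map_some] at hlow
    have hrep' := (represents_insertionTableau hw1).1
    have hΛ' := isChain_growth haimanType hw1
    obtain ⟨U', hU', hUe', ⟨k', hk'⟩, -⟩ := growth_switch_right hi hw1
    have hL := loweredChain_growth (n := 2 * i - 1) hτ1 hτ2 hwU (by rw [hv, hv']; exact hlow)
    rw [← hU, ← hU'] at hL
    obtain ⟨he, r, hr, hm⟩ := hL
    rw [hat] at hr
    rw [hv] at he hm
    have he' : ∀ a, a ≠ 2 * i → a ≠ 2 * i + 1 → growth haimanType w' a = growth haimanType w a :=
      fun a h1 h2 => by rw [hUe' a h2, he a h1, hUe a h2]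
    rw [← hUe (2 * i) (by omega), ← hUe' (2 * i) (by omega)] at hm
    rw [he (2 * i + 1) (by omega), he' (2 * i + 2) (by omega) (by omega)] at hk'
    obtain ⟨T', h1, h2⟩ := hrep.exists_tabF hΛ hΛ' hi (hr.switch_right hk hs) hm he'
      fun r' h1 h2 h3 => hk.lowered_right hk' hs hr hm h1 h2 h3
    rw [Option.map_some, show insertionTableau w = (haiman w).1 from rfl, h1]
    exact congrArg some (hrep'.eq h2)

/-- To see `e_i` as a usual crystal operator, the letters `i` and `(i + 1)'` are switched. -/
theorem growth_switch_left {i : ℕ} (hi : 1 ≤ i) {w : List ℕ} (hw : ∀ x ∈ w, 1 ≤ x) :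
    ∃ V, V = growth (haimanType ∘ Equiv.swap (2 * i) (2 * i + 1))
        (w.map (Equiv.swap (2 * i) (2 * i + 1))) ∧
      (∀ a, a ≠ 2 * i → V a = growth haimanType w a) ∧
      Switched (growth haimanType w (2 * i - 1)) (growth haimanType w (2 * i)) (V (2 * i))
        (growth haimanType w (2 * i + 1)) ∧
      TwoStrips (V (2 * i)).rowLen (growth haimanType w (2 * i + 1)).rowLen
        (growth haimanType w (2 * i + 2)).rowLen := by
  have hw' := one_le_of_mem_map_swap (a := 2 * i) (b := 2 * i + 1) (by omega) (by omega) hw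
  have h0 := switched_growth (τ := haimanType) (n := 2 * i - 1)
  rw [show 2 * i - 1 + 1 = 2 * i by omega, show 2 * i - 1 + 2 = 2 * i + 1 by omega] at h0
  obtain ⟨h1, h2⟩ := h0 (by simp [haimanType]) (by simp [haimanType]) hw
  refine ⟨_, rfl, h1, h2, ?_⟩
  have h3 := (isChain_growth (haimanType ∘ Equiv.swap (2 * i) (2 * i + 1)) hw').twoStrips
    (n := 2 * i)
  rw [h1 (2 * i + 1) (by omega), h1 (2 * i + 2) (by omega)] at h3
  apply h3
  · simp [haimanType]
  · rw [Function.comp_apply, Equiv.swap_apply_of_ne_of_ne (by omega) (by omega)]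
    simp [haimanType]

/-- Insertion commutes with `e_i`. If `e_i` changes `w` to `w'`, then `f_i` changes `w'` to `w`, so
the commutation of the usual crystal operators is applied to `w'`. -/
theorem map_insertionTableau_wordE {i : ℕ} (hi : 1 ≤ i) {w : List ℕ} (hw : ∀ x ∈ w, 1 ≤ x) :
    (wordE i w).map insertionTableau = tabE i (insertionTableau w) := by
  have hrep := (represents_insertionTableau hw).1
  have hΛ := isChain_growth haimanType hw
  obtain ⟨V, hV, hVe, ⟨k, hk⟩, hs⟩ := growth_switch_left hi hw
  have hτ1 : (haimanType ∘ Equiv.swap (2 * i) (2 * i + 1)) (2 * i + 1) = true := by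
    simp [haimanType]
  have hτ2 : (haimanType ∘ Equiv.swap (2 * i) (2 * i + 1)) (2 * i + 2) = true := by
    rw [Function.comp_apply, Equiv.swap_apply_of_ne_of_ne (by omega) (by omega)]
    simp [haimanType]
  have hword : wordE i w = raise (2 * i) (2 * i + 2) w := by
    unfold wordE unp
    rw [show 2 * (i + 1) = 2 * i + 2 by omega]
  rw [hword]
  cases hw' : raise (2 * i) (2 * i + 2) w with
  | none =>
    have hK := heightsOf_growth hτ1 hτ2
      (one_le_of_mem_map_swap (a := 2 * i) (b := 2 * i + 1) (by omega) (by omega) hw)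
    have heps := (lower_map (Equiv.swap (2 * i) (2 * i + 1)).injective (a := 2 * i)
      (b := 2 * i + 2) (by omega) w).2
    rw [Equiv.swap_apply_left, Equiv.swap_apply_of_ne_of_ne (by omega) (by omega),
      raise_eq_none_iff.1 hw'] at heps
    rw [heps, ← hV] at hK
    obtain ⟨S, κ, h1, h2⟩ := hrep.exists_isBracketing hΛ hi
    have key := height_switch_left (q := (growth haimanType w (2 * i + 2)).rowLen) hk
    have h3 : (S 0).2 = [] := by
      apply h2.snd_eq_nil
      intro s
      have h7 := key s
      have h8 := hK.le s
      unfold heightAt at h8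
      rw [hVe (2 * i + 1) (by omega), hVe (2 * i + 2) (by omega)] at h8
      split_ifs at h7 <;> simp at h8 <;> omega
    unfold tabE
    rw [show insertionTableau w = (haiman w).1 from rfl, ← h1, h3]
    rfl
  | some w' =>
    have hlow := (lower_eq_some_iff (by omega)).2 hw'
    have hw1 : ∀ x ∈ w', 1 ≤ x := by
      obtain ⟨u, v, rfl, rfl⟩ := exists_eq_of_lower (by omega) hlow
      intro x hx
      simp only [List.mem_append, List.mem_cons] at hx hw
      rcases hx with hx | rfl | hx
      · exact hw x (Or.inl hx)
      · omega
      · exact hw x (Or.inr (Or.inr hx))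
    have hrep' := (represents_insertionTableau hw1).1
    have hΛ' := isChain_growth haimanType hw1
    obtain ⟨V', hV', hVe', ⟨k', hk'⟩, hs'⟩ := growth_switch_left hi hw1
    have hmap := (lower_map (Equiv.swap (2 * i) (2 * i + 1)).injective (a := 2 * i)
      (b := 2 * i + 2) (by omega) w').1
    rw [Equiv.swap_apply_left, Equiv.swap_apply_of_ne_of_ne (by omega) (by omega), hlow,
      Option.map_some] at hmap
    have hL := loweredChain_growth (n := 2 * i) hτ1 hτ2
      (one_le_of_mem_map_swap (a := 2 * i) (b := 2 * i + 1) (by omega) (by omega) hw1) hmap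
    rw [← hV, ← hV'] at hL
    obtain ⟨he, r, hr, hm⟩ := hL
    have he' : ∀ a, a ≠ 2 * i → a ≠ 2 * i + 1 → growth haimanType w' a = growth haimanType w a :=
      fun a h1 h2 => by rw [← hVe' a h1, ← he a h2, hVe a h1]
    unfold heightAt at hr
    rw [hVe' (2 * i + 1) (by omega), hVe' (2 * i + 2) (by omega), ← he (2 * i) (by omega),
      he' (2 * i + 2) (by omega) (by omega)] at hr
    rw [← he (2 * i) (by omega), he' (2 * i + 2) (by omega) (by omega)] at hs'
    rw [hVe (2 * i + 1) (by omega), hVe' (2 * i + 1) (by omega)] at hm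
    rw [← he (2 * i) (by omega), he' (2 * i - 1) (by omega) (by omega)] at hk'
    obtain ⟨hr1, hr2⟩ := hr.topmostMax hs' hm
    obtain ⟨hr3, hr4⟩ := hr1.switch_left hk hs
    obtain ⟨T', h1, h2⟩ := hrep.exists_tabE hΛ hΛ' hi hr3 (hr4 ▸ hr2) hm he'
      fun r' h1 h2 h3 => hk.lowered_left hk' hs
        ⟨_, fun t ht => hrep'.rowLen_eq_zero (2 * i + 1) ht⟩ hr1 hm h1 h2 h3
    rw [Option.map_some, show insertionTableau w = (haiman w).1 from rfl, h1]
    exact congrArg some (hrep'.eq h2)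

/-- If insertion commutes with an operator, then it also commutes with the operator that is obtained
by transposition and the half unit shift. -/
theorem map_insertionTableau_bar {w : List ℕ} (hw : ∀ x ∈ w, 1 ≤ x)
    {W : List ℕ → Option (List ℕ)} {W' : List ℕ → Option (List ℕ)}
    {F : Filling → Option Filling} (hW : W (w.map (· + 1)) = (W' w).map (List.map (· + 1)))
    (hW' : ∀ w', W' w = some w' → ∀ x ∈ w', 1 ≤ x)
    (hF : (W (w.map (· + 1))).map insertionTableau = F (insertionTableau (w.map (· + 1)))) :
    (W' w).map insertionTableau = (F (plus (insertionTableau w))).map minus := by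
  rw [plus_insertionTableau hw, ← hF, hW]
  cases h : W' w with
  | none => rfl
  | some w' =>
    have h1 := hW' w' h
    simp only [Option.map_some]
    rw [← plus_insertionTableau h1, minus_plus]
    exact (represents_insertionTableau h1).1.partition

/-! ### Shapes -/

theorem Represents.content_ne_top_iff {T : Filling} {Λ : ℕ → YoungDiagram} (h : Represents T Λ)
    {K : ℕ} (hK : ∀ a, K ≤ a → Λ a = Λ K) (r c : ℕ) : content T r c ≠ ⊤ ↔ (r, c) ∈ Λ K := by
  constructor
  · intro h1
    obtain ⟨v, hv⟩ := exists_content_eq h1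
    rw [← hK (max v K) (le_max_right _ _), h.mem_iff, hv, Nat.cast_le]
    exact le_max_left _ _
  · exact fun h1 => ne_top_of_le_coe ((h.mem_iff _ _ _).1 h1)

theorem content_ne_top_iff_of_shape_eq {T T' : Filling} (h : shape T = shape T') (r c : ℕ) :
    content T r c ≠ ⊤ ↔ content T' r c ≠ ⊤ := by
  have key : ∀ T : Filling, (T.getD r []).length = (shape T).getD r 0 := by
    intro T
    simp only [shape, List.getD_eq_getElem?_getD, List.getElem?_map]
    cases T[r]? <;> rfl
  rw [content_ne_top, content_ne_top, key, key, h]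

theorem Represents.top_eq {T T' : Filling} {Λ Λ' : ℕ → YoungDiagram} (h : Represents T Λ)
    (h' : Represents T' Λ') {K K' : ℕ} (hK : ∀ a, K ≤ a → Λ a = Λ K)
    (hK' : ∀ a, K' ≤ a → Λ' a = Λ' K') (e : shape T = shape T') : Λ K = Λ' K' := by
  ext ⟨r, c⟩
  rw [YoungDiagram.mem_cells, YoungDiagram.mem_cells, ← h.content_ne_top_iff hK,
    ← h'.content_ne_top_iff hK', content_ne_top_iff_of_shape_eq e]

theorem shape_of_tabF {i : ℕ} {T T' : Filling} (h : tabF i T = some T') : shape T' = shape T := by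
  unfold tabF at h
  obtain ⟨x, -, h⟩ := Option.bind_eq_some_iff.1 h
  obtain ⟨q, -, rfl⟩ := Option.map_eq_some_iff.1 h
  rw [shape_modifyAt, shape_modifyAt]

theorem shape_of_tabFbar {i : ℕ} {T T' : Filling} (hT : IsPartition (shape T))
    (h : tabFbar i T = some T') : shape T' = shape T := by
  unfold tabFbar at h
  obtain ⟨X, h1, rfl⟩ := Option.map_eq_some_iff.1 h
  have h2 := shape_of_tabF h1
  have h3 : IsPartition (shape (plus T)) := isPartition_shape_map _ (isPartition_shape_transpose hT)
  have h4 : IsPartition (shape X) := h2 ▸ h3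
  refine shape_ext (isPartition_shape_map _ (isPartition_shape_transpose h4)) hT fun r c => ?_
  have h5 : ∀ (g : ℕ → ℕ) (X : Filling), IsPartition (shape X) →
      (content ((transpose X).map (List.map g)) r c ≠ ⊤ ↔ content X c r ≠ ⊤) := by
    intro g X hX
    rw [content_map_map, content_transpose hX, Ne, WithTop.map_eq_top_iff]
  have h6 : ∀ (g : ℕ → ℕ) (X : Filling), IsPartition (shape X) →
      (content ((transpose X).map (List.map g)) c r ≠ ⊤ ↔ content X r c ≠ ⊤) := by
    intro g X hX
    rw [content_map_map, content_transpose hX, Ne, WithTop.map_eq_top_iff]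
  rw [minus, h5 _ X h4, content_ne_top_iff_of_shape_eq h2, plus, h6 _ T hT]

/-! ### The recording tableau is preserved -/

/-- The crystal operators on words either do not change a prefix or act on it by themselves. -/
theorem take_of_lower {a b : ℕ} (hab : a ≠ b) {w w' : List ℕ} (h : lower a b w = some w') (t : ℕ) :
    w'.take t = w.take t ∨ lower a b (w.take t) = some (w'.take t) := by
  induction w using List.reverseRecOn generalizing w' with
  | nil => simp [lower, unbracketed] at h
  | append_singleton w x ih =>
    have hfull : (w ++ [x]).length ≤ t → w'.length = (w ++ [x]).length →
        lower a b ((w ++ [x]).take t) = some (w'.take t) := by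
      intro h1 h2
      rw [List.take_of_length_le h1, List.take_of_length_le (by omega), h]
    have hlen : w'.length = (w ++ [x]).length := by
      obtain ⟨u, v, h1, h2⟩ := exists_eq_of_lower hab h
      rw [h1, h2]
      simp
    rcases Nat.lt_or_ge w.length t with h1 | h1
    · exact Or.inr (hfull (by simp; omega) hlen)
    · rw [lower_append hab] at h
      rw [List.take_append_of_le_length h1]
      split_ifs at h with h2
      · obtain rfl := Option.some.inj h
        left
        rw [List.take_append_of_le_length h1]
      · obtain ⟨w₁, h3, rfl⟩ := Option.map_eq_some_iff.1 h
        have h4 : t ≤ w₁.length := by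
          simp at hlen
          omega
        rw [List.take_append_of_le_length h4]
        exact ih h3

/-- The operators `F` and `E` on tableaux correspond to the usual operators for the letters
`a` and `b` on words. -/
structure Corresponds (k a b : ℕ) (F E : Filling → Option Filling) : Prop where
  ne : a ≠ b
  mem_left : 1 ≤ a ∧ a ≤ 2 * k
  mem_right : 1 ≤ b ∧ b ≤ 2 * k
  map_lower : ∀ w ∈ Words k, (lower a b w).map insertionTableau = F (insertionTableau w)
  map_raise : ∀ w ∈ Words k, (raise a b w).map insertionTableau = E (insertionTableau w)
  shape_eq : ∀ T T', IsPartition (shape T) → F T = some T' → shape T' = shape T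

theorem one_le_of_mem_words {k : ℕ} {w : List ℕ} (hw : w ∈ Words k) : ∀ x ∈ w, 1 ≤ x :=
  fun x hx => (hw x hx).1

theorem corresponds_tabF {k i : ℕ} (hi : 1 ≤ i) (hik : i < k) :
    Corresponds k (unp i) (unp (i + 1)) (tabF i) (tabE i) where
  ne := by unfold unp; omega
  mem_left := by unfold unp; omega
  mem_right := by unfold unp; omega
  map_lower w hw := map_insertionTableau_wordF hi (one_le_of_mem_words hw)
  map_raise w hw := map_insertionTableau_wordE hi (one_le_of_mem_words hw)
  shape_eq T T' _ h := shape_of_tabF h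

theorem lower_mem_words {k a b : ℕ} (hab : a ≠ b) (hb : 1 ≤ b ∧ b ≤ 2 * k) {w w' : List ℕ}
    (hw : w ∈ Words k) (h : lower a b w = some w') : w' ∈ Words k :=
  forall_mem_of_lower hab h hb hw

theorem raise_mem_words {k a b : ℕ} (hab : a ≠ b) (ha : 1 ≤ a ∧ a ≤ 2 * k) {w w' : List ℕ}
    (hw : w ∈ Words k) (h : raise a b w = some w') : w' ∈ Words k := by
  obtain ⟨u, v, rfl, rfl⟩ := exists_eq_of_lower hab ((lower_eq_some_iff hab).2 h)
  intro x hx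
  simp only [Words, Set.mem_ofPred_eq, List.mem_append, List.mem_cons] at hx hw
  rcases hx with hx | rfl | hx
  · exact hw x (Or.inl hx)
  · exact ha
  · exact hw x (Or.inr (Or.inr hx))

theorem corresponds_tabFbar {k i : ℕ} (hi : 1 ≤ i) (hik : i < k) :
    Corresponds k (prm i) (prm (i + 1)) (tabFbar i) (tabEbar i) := by
  have hne : prm i ≠ prm (i + 1) := by unfold prm; omega
  have hl : 1 ≤ prm i ∧ prm i ≤ 2 * k := by unfold prm; omega
  have hr : 1 ≤ prm (i + 1) ∧ prm (i + 1) ≤ 2 * k := by unfold prm; omega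
  have e1 : prm i + 1 = unp i := by unfold prm unp; omega
  have e2 : prm (i + 1) + 1 = unp (i + 1) := by unfold prm unp; omega
  have hinj : Function.Injective fun x : ℕ => x + 1 := add_left_injective 1
  refine ⟨hne, hl, hr, fun w hw => ?_, fun w hw => ?_, fun T T' hT h => shape_of_tabFbar hT h⟩
  · refine map_insertionTableau_bar (one_le_of_mem_words hw) (W := lower (unp i) (unp (i + 1))) ?_
      (fun w' h => one_le_of_mem_words (lower_mem_words hne hr hw h))
      (map_insertionTableau_wordF hi (by simp))
    rw [← e1, ← e2]
    exact (lower_map hinj hne w).1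
  · refine map_insertionTableau_bar (one_le_of_mem_words hw) (W := raise (unp i) (unp (i + 1))) ?_
      (fun w' h => one_le_of_mem_words (raise_mem_words hne hl hw h))
      (map_insertionTableau_wordE hi (by simp))
    rw [← e1, ← e2]
    exact raise_map hinj hne w

/-- The crystal operators preserve the recording tableau, as they preserve the shapes of the
insertion tableaux of all prefixes. -/
theorem recording_eq {k a b : ℕ} {F E : Filling → Option Filling} (h : Corresponds k a b F E)
    {w w' : List ℕ} (hw : w ∈ Words k) (hl : lower a b w = some w') :
    (haiman w').2 = (haiman w).2 := by
  have hw' := lower_mem_words h.ne h.mem_right hw hl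
  have h1 := (represents_recording hw').1
  have h2 := (represents_recording hw).1
  have e : (fun t => growth haimanType (w'.take t) (2 * k)) =
      fun t => growth haimanType (w.take t) (2 * k) := by
    funext t
    rcases take_of_lower h.ne hl t with h3 | h3
    · rw [h3]
    · have h4 : w.take t ∈ Words k := fun x hx => hw x (List.mem_of_mem_take hx)
      have h5 : w'.take t ∈ Words k := fun x hx => hw' x (List.mem_of_mem_take hx)
      have h6 := (represents_insertionTableau (one_le_of_mem_words h4)).1
      have h7 := (represents_insertionTableau (one_le_of_mem_words h5)).1
      refine h7.top_eq h6 (fun b hb => growth_eq_of_le h5 hb) (fun b hb => growth_eq_of_le h4 hb) ?_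
      have h8 := h.map_lower _ h4
      rw [h3, Option.map_some] at h8
      exact h.shape_eq _ _ h6.partition h8.symm
  rw [e] at h1
  exact h1.eq h2

theorem map_haiman_lower {k a b : ℕ} {F E : Filling → Option Filling} (h : Corresponds k a b F E)
    {w : List ℕ} (hw : w ∈ Words k) :
    (lower a b w).map haiman = (F (haiman w).1).map fun T => (T, (haiman w).2) := by
  rw [← show insertionTableau w = (haiman w).1 from rfl, ← h.map_lower w hw]
  cases hl : lower a b w with
  | none => rfl
  | some w' =>
    simp only [Option.map_some]
    rw [← recording_eq h hw hl]
    rfl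

theorem map_haiman_raise {k a b : ℕ} {F E : Filling → Option Filling} (h : Corresponds k a b F E)
    {w : List ℕ} (hw : w ∈ Words k) :
    (raise a b w).map haiman = (E (haiman w).1).map fun T => (T, (haiman w).2) := by
  rw [← show insertionTableau w = (haiman w).1 from rfl, ← h.map_raise w hw]
  cases hl : raise a b w with
  | none => rfl
  | some w' =>
    simp only [Option.map_some]
    rw [recording_eq h (raise_mem_words h.ne h.mem_left hw hl) ((lower_eq_some_iff h.ne).2 hl)]
    rfl

/-! ### The bijection -/

theorem haiman_mem_pairs {k : ℕ} {w : List ℕ} (hw : w ∈ Words k) : haiman w ∈ Pairs k := by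
  have hw1 := one_le_of_mem_words hw
  have h1 := (represents_insertionTableau hw1).1
  obtain ⟨h2, h3⟩ := represents_recording hw
  refine ⟨isPrimedTableau_iff.2 ⟨_, h1, isChain_growth _ hw1, fun a ha => growth_eq_of_le hw ha⟩,
    isStandard_of_represents h2 h3, shape_ext h1.partition h2.partition fun r c => ?_⟩
  rw [h1.content_ne_top_iff (K := 2 * k) fun a ha => growth_eq_of_le hw ha,
    h2.content_ne_top_iff (K := w.length) fun a ha => by
      rw [List.take_of_length_le ha, List.take_length], List.take_length]

theorem bijOn_haiman (k : ℕ) : Set.BijOn haiman (Words k) (Pairs k) := by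
  refine ⟨fun w hw => haiman_mem_pairs hw, fun w hw w' hw' e => ?_, ?_⟩
  · obtain ⟨h1, h2⟩ := represents_recording hw
    obtain ⟨h3, h4⟩ := represents_recording hw'
    have h5 := (represents_insertionTableau (one_le_of_mem_words hw)).1
    have h6 := (represents_insertionTableau (one_le_of_mem_words hw')).1
    rw [← e] at h3 h4 h6
    refine growth_injective hw hw' ?_ (h5.chain_eq h6) fun a => congrFun (h1.chain_eq h3) a
    simpa using h2.symm.length_eq.trans h4.length_eq
  · rintro ⟨T, S⟩ ⟨hT, hS, e⟩
    obtain ⟨Λ, h1, h2, h3⟩ := isPrimedTableau_iff.1 hT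
    obtain ⟨M, h4, h5, h6⟩ := hS.exists_chain
    have h7 := h1.top_eq h4 h3 h6 e
    obtain ⟨w, hw1, hw, hw2, hw3⟩ := h2.exists_growth h3 h5 h7.symm
    refine ⟨w, hw, ?_⟩
    have h8 := (represents_insertionTableau (one_le_of_mem_words hw)).1
    have h9 := (represents_recording hw).1
    rw [hw2] at h8
    have h10 : (fun a => growth haimanType (w.take a) (2 * k)) = M := by
      funext a
      rcases Nat.lt_or_ge S.flatten.length a with h | h
      · rw [List.take_of_length_le (hw1.trans_le h.le), hw2, h7, h6 a h.le]
      · exact hw3 a h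
    rw [h10] at h9
    exact Prod.ext (h8.eq h1) (h9.eq h4)

theorem exists_insertionTableau_eq {k : ℕ} {T : Filling} (hT : T ∈ PT k) :
    ∃ w ∈ Words k, insertionTableau w = T := by
  obtain ⟨Λ, h1, h2, h3⟩ := isPrimedTableau_iff.1 hT
  obtain ⟨n, M, h5, h7⟩ := exists_isStandardChain (Λ (2 * k))
  obtain ⟨w, -, hw, hw2, -⟩ := h2.exists_growth h3 h5 h7
  have h8 := (represents_insertionTableau (one_le_of_mem_words hw)).1
  rw [hw2] at h8
  exact ⟨w, hw, h8.eq h1⟩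

theorem insertionTableau_mem {k : ℕ} {w : List ℕ} (hw : w ∈ Words k) : insertionTableau w ∈ PT k :=
  (haiman_mem_pairs hw).1

theorem tabDW_insertionTableau {k : ℕ} {w : List ℕ} (hw : w ∈ Words k) :
    tabDW k (insertionTableau w) = wordDW k w := by
  have h := (represents_insertionTableau (one_le_of_mem_words hw)).2
  unfold tabDW wordDW insertionTableau
  simp only [h.count_eq]

/-! ### The bicrystal of primed tableaux -/

section

variable {k a b : ℕ} {F E : Filling → Option Filling}

theorem Corresponds.mem_of_eq_some (h : Corresponds k a b F E) {T T' : Filling} (hT : T ∈ PT k)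
    (e : F T = some T') : T' ∈ PT k ∧ shape T' = shape T := by
  refine ⟨?_, h.shape_eq T T' hT.partition e⟩
  obtain ⟨w, hw, rfl⟩ := exists_insertionTableau_eq hT
  rw [← h.map_lower w hw] at e
  obtain ⟨w', h1, rfl⟩ := Option.map_eq_some_iff.1 e
  exact insertionTableau_mem (lower_mem_words h.ne h.mem_right hw h1)

theorem Corresponds.inverse (h : Corresponds k a b F E) {T T' : Filling} (hT : T ∈ PT k)
    (hT' : T' ∈ PT k) : F T = some T' ↔ E T' = some T := by
  constructor
  · intro e
    obtain ⟨w, hw, rfl⟩ := exists_insertionTableau_eq hT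
    rw [← h.map_lower w hw] at e
    obtain ⟨w', h1, rfl⟩ := Option.map_eq_some_iff.1 e
    rw [← h.map_raise w' (lower_mem_words h.ne h.mem_right hw h1),
      (lower_eq_some_iff h.ne).1 h1, Option.map_some]
  · intro e
    obtain ⟨w', hw', rfl⟩ := exists_insertionTableau_eq hT'
    rw [← h.map_raise w' hw'] at e
    obtain ⟨w, h1, rfl⟩ := Option.map_eq_some_iff.1 e
    rw [← h.map_lower w (raise_mem_words h.ne h.mem_left hw' h1),
      (lower_eq_some_iff h.ne).2 h1, Option.map_some]

theorem Corresponds.mem_of_eq_some' (h : Corresponds k a b F E) {T T' : Filling} (hT : T ∈ PT k)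
    (e : E T = some T') : T' ∈ PT k ∧ shape T' = shape T := by
  have h1 : T' ∈ PT k := by
    obtain ⟨w, hw, rfl⟩ := exists_insertionTableau_eq hT
    rw [← h.map_raise w hw] at e
    obtain ⟨w', h1, rfl⟩ := Option.map_eq_some_iff.1 e
    exact insertionTableau_mem (raise_mem_words h.ne h.mem_left hw h1)
  exact ⟨h1, (h.mem_of_eq_some h1 ((h.inverse h1 hT).2 e)).2.symm⟩

/-- The double weights of a tableau and of its image differ by one letter. -/
theorem Corresponds.exists_words (h : Corresponds k a b F E) {T T' : Filling} (hT : T ∈ PT k)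
    (e : F T = some T') : ∃ u v, tabDW k T = wordDW k (u ++ a :: v) ∧
      tabDW k T' = wordDW k (u ++ b :: v) := by
  obtain ⟨w, hw, rfl⟩ := exists_insertionTableau_eq hT
  rw [← h.map_lower w hw] at e
  obtain ⟨w', h1, rfl⟩ := Option.map_eq_some_iff.1 e
  rw [tabDW_insertionTableau hw,
    tabDW_insertionTableau (lower_mem_words h.ne h.mem_right hw h1)]
  obtain ⟨u, v, rfl, rfl⟩ := exists_eq_of_lower h.ne h1
  exact ⟨u, v, rfl, rfl⟩

end

/-- A nonempty union of sets of all primed tableaux of a given shape is a bicrystal. -/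
theorem isBicrystal_of_subset {k : ℕ} {B : Set Filling} (hB : B.Nonempty) (hsub : B ⊆ PT k)
    (hclosed : ∀ T ∈ B, ∀ T' ∈ PT k, shape T' = shape T → T' ∈ B) :
    IsBicrystal k B tabE tabF tabEbar tabFbar (tabDW k) where
  nonempty := hB
  mem i h1 h2 T hT T' h := by
    have hF := corresponds_tabF h1 h2
    have hFbar := corresponds_tabFbar h1 h2
    have key : T' ∈ PT k ∧ shape T' = shape T := by
      rcases h with h | h | h | h
      · exact hF.mem_of_eq_some' (hsub hT) h
      · exact hF.mem_of_eq_some (hsub hT) h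
      · exact hFbar.mem_of_eq_some' (hsub hT) h
      · exact hFbar.mem_of_eq_some (hsub hT) h
    exact hclosed T hT T' key.1 key.2
  inverse i h1 h2 T hT T' hT' := (corresponds_tabF h1 h2).inverse (hsub hT) (hsub hT')
  inverse_bar i h1 h2 T hT T' hT' := (corresponds_tabFbar h1 h2).inverse (hsub hT) (hsub hT')
  weight i h1 h2 T hT T' hT' h := by
    obtain ⟨u, v, e1, e2⟩ := (corresponds_tabF h1 h2).exists_words (hsub hT) h
    rw [e1, e2]
    refine ⟨funext fun c => ?_, funext fun c => ?_⟩
    · simp only [wordDW, List.count_append, List.count_cons, beq_iff_eq]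
      rw [if_neg (by unfold unp prm; omega), if_neg (by unfold unp prm; omega)]
    · simp only [wordDW, toInt, Pi.sub_apply, simpleRoot, List.count_append, List.count_cons,
        beq_iff_eq, unp]
      split_ifs <;> push_cast <;> omega
  weight_bar i h1 h2 T hT T' hT' h := by
    obtain ⟨u, v, e1, e2⟩ := (corresponds_tabFbar h1 h2).exists_words (hsub hT) h
    rw [e1, e2]
    refine ⟨funext fun c => ?_, funext fun c => ?_⟩
    · simp only [wordDW, toInt, Pi.sub_apply, simpleRoot, List.count_append, List.count_cons,
        beq_iff_eq, prm]
      split_ifs <;> push_cast <;> omega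
    · simp only [wordDW, List.count_append, List.count_cons, beq_iff_eq]
      rw [if_neg (by unfold unp prm; omega), if_neg (by unfold unp prm; omega)]

theorem isBicrystalIso_haiman (k : ℕ) : IsBicrystalIso k (Words k) wordE wordF wordEbar wordFbar
    (wordDW k) (Pairs k) (onFirst tabE) (onFirst tabF) (onFirst tabEbar) (onFirst tabFbar)
    (fun X => tabDW k X.1) haiman where
  bij := bijOn_haiman k
  dw_eq _ hw := tabDW_insertionTableau hw
  map_e _ h1 h2 _ hw := map_haiman_raise (corresponds_tabF h1 h2) hw
  map_f _ h1 h2 _ hw := map_haiman_lower (corresponds_tabF h1 h2) hw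
  map_ebar _ h1 h2 _ hw := map_haiman_raise (corresponds_tabFbar h1 h2) hw
  map_fbar _ h1 h2 _ hw := map_haiman_lower (corresponds_tabFbar h1 h2) hw

end PrimedCrystal

theorem mainTheorem6 (k : ℕ) :
    (∀ w ∈ PrimedCrystal.Words k, ∀ i : ℕ, 1 ≤ i → i < k →
      (PrimedCrystal.wordF i w).map PrimedCrystal.insertionTableau =
          PrimedCrystal.tabF i (PrimedCrystal.insertionTableau w) ∧
      (PrimedCrystal.wordFbar i w).map PrimedCrystal.insertionTableau =
          PrimedCrystal.tabFbar i (PrimedCrystal.insertionTableau w)) ∧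
    PrimedCrystal.IsBicrystalIso k
      (PrimedCrystal.Words k) PrimedCrystal.wordE PrimedCrystal.wordF
      PrimedCrystal.wordEbar PrimedCrystal.wordFbar (PrimedCrystal.wordDW k)
      (PrimedCrystal.Pairs k)
      (PrimedCrystal.onFirst PrimedCrystal.tabE) (PrimedCrystal.onFirst PrimedCrystal.tabF)
      (PrimedCrystal.onFirst PrimedCrystal.tabEbar) (PrimedCrystal.onFirst PrimedCrystal.tabFbar)
      (fun X => PrimedCrystal.tabDW k X.1) PrimedCrystal.haiman ∧
    PrimedCrystal.IsBicrystal k (PrimedCrystal.PT k) PrimedCrystal.tabE PrimedCrystal.tabF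
      PrimedCrystal.tabEbar PrimedCrystal.tabFbar (PrimedCrystal.tabDW k) ∧
    (∀ l : List ℕ, {T ∈ PrimedCrystal.PT k | PrimedCrystal.shape T = l}.Nonempty →
      PrimedCrystal.IsBicrystal k {T ∈ PrimedCrystal.PT k | PrimedCrystal.shape T = l}
        PrimedCrystal.tabE PrimedCrystal.tabF PrimedCrystal.tabEbar PrimedCrystal.tabFbar
        (PrimedCrystal.tabDW k)) := by
  refine ⟨fun w hw i h1 h2 => ⟨(PrimedCrystal.corresponds_tabF h1 h2).map_lower w hw,
    (PrimedCrystal.corresponds_tabFbar h1 h2).map_lower w hw⟩,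
    PrimedCrystal.isBicrystalIso_haiman k, ?_, fun l hl => ?_⟩
  · exact PrimedCrystal.isBicrystal_of_subset
      ⟨_, PrimedCrystal.insertionTableau_mem (w := []) (by simp [PrimedCrystal.Words])⟩ subset_rfl
      fun T _ T' hT' _ => hT'
  · exact PrimedCrystal.isBicrystal_of_subset hl (fun T hT => hT.1)
      fun T hT T' hT' e => ⟨hT', e.trans hT.2⟩
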